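/- Let $k$ be an algebraically closed field of characteristic $2$. Let $\overline X$ be a projective variety (integral) over $k$ of even dimension $n>0$, $\mathcal L$ a line bundle on $\overline X$, and $M\subset H^0(\overline X,\mathcal L)$ a linear subspace of dimension $m+1$ with $m>n$. Let $\mathbf P=\mathbf P_*(M)$ be the projective space of one-dimensional subspaces $[f]$ of $M$, so that $\dim\mathbf P=m$; let $X$ be the complement in $\overline X$ of the singular locus and of the base locus of $|M|$, let $\Psi:X\to\mathbf P^\vee$ be the morphism defined by $|M|$, and let $X^\circ\subset X$ be the set of points at which the differential of $\Psi$ is injective. Assume that $X^\circ$ is dense in $\overline X$. For $f\in M\setminus\{0\}$ let $D_{[f]}$ be the divisor $f=0$. The degeneracy subscheme of a homomorphism of vector bundles of ranks $e$ and $f$ is the closed subscheme defined locally by the $\min(e,f)$-minors of a matrix of the homomorphism; the critical subscheme of a morphism $g:V\to W$ of smooth varieties is the degeneracy subscheme of $dg:T(V)\to g^*T(W)$. Let $\mathcal D\subset X\times\mathbf P$ be the universal family of the divisors $D_{[f]}$, i.e. the zero scheme of the canonical section $\sigma$ of $\widetilde{\mathcal L}=\mathrm{pr}_1^*\mathcal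 L\otimes\mathrm{pr}_2^*\mathcal O_{\mathbf P}(1)$ (in terms of a basis $b_0,\dots,b_m$ of $M$ and the dual coordinates $Y_i$, $\sigma=\sum_i b_i\otimes Y_i$), let $\mathcal C$ be the critical subscheme of the projection $\mathcal D\to\mathbf P$, and let $\mathcal C^\circ$ be its part over $X^\circ$, with projections $\pi_1:\mathcal C^\circ\to X^\circ$ and $\pi_2:\mathcal C^\circ\to\mathbf P$. Let $\mathcal E$ be the critical subscheme of $\pi_2$. The universal Hessian $\mathcal H:\pi_1^*T(X^\circ)\otimes\pi_1^*T(X^\circ)\to\widetilde{\mathcal L}\otimes\mathcal O_{\mathcal C^\circ}$ is given, for a local frame $D_1,\dots,D_n$ of $T(X^\circ)$ and a local expression $\Phi$ of $\sigma$ in a trivialization of $\widetilde{\mathcal L}$, by the matrix $(D_iD_j\Phi)|_{\mathcal C^\circ}$; it is anti-symmetric (alternating). Let $\mathcal R\subset\mathcal C^\circ$ be its degeneracy subscheme as an anti-symmetric form, i.e. the closed subscheme defined locally by the Pfaffian of this $n\times n$ matrix, and let $\varpi_2:\mathcal R\to\mathbf P$ be the projection. For a hypersurface $D$ with equation $\phi=0$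 at a point $p$ of $X$ and a formal parameter system $(x_1,\dots,x_n)$ of $X$ at $p$ (so that $\widehat{\mathcal O}_{X,p}=k[[x_1,\dots,x_n]]$), let $R(D,p)$ be the subscheme of $(X,p)^\wedge=\operatorname{Spec}\widehat{\mathcal O}_{X,p}$ defined by $$\phi=\frac{\partial\phi}{\partial x_1}=\dots=\frac{\partial\phi}{\partial x_n}=\rho=0,$$ where $\rho$ is the Pfaffian of the alternating matrix $(\partial^2\phi/\partial x_i\partial x_j)$. (1) Every irreducible component of $\mathcal R$ has codimension at most $1$ in $\mathcal C^\circ$ ($\mathcal R$ may be empty). If every irreducible component of $\mathcal R$ has codimension exactly $1$ in $\mathcal C^\circ$, then $\mathcal R$ is an effective (Cartier) divisor of $\mathcal C^\circ$ and $\mathcal E=2\mathcal R$ as divisors of $\mathcal C^\circ$. (2) Let $P=(p,[f])$ be a (closed) point of $\mathcal R$. Then, as a subscheme of $(\mathrm{pr}_2^{-1}([f]),P)^\wedge\cong(X,p)^\wedge$, the completion $(\varpi_2^{-1}([f]),P)^\wedge$ of the fiber of $\varpi_2$ at $P$ coincides with $R(D_{[f]},p)$, for every choice of the formal parameter system and of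 the equation of $D_{[f]}$. -/

import Mathlib

open AlgebraicGeometry CategoryTheory CategoryTheory.Limits

noncomputable section

namespace PfaffianDegeneracy

universe u

/-! ## Linear algebra: Pfaffians and degeneracy ideals -/

section Algebra

/-- The polynomial `f_n` (`n = 2 * (n / 2)` even) evaluated at the upper triangular entries of the
`n × n` matrix `A`: the sum, over all ways to write the indices as a list of pairs
`[[i₁, j₁], …, [iₘ, jₘ]]` with `i_ν < j_ν` for all `ν` and `i₁ < i₂ < … < iₘ`, of
`sign * A i₁ j₁ * ⋯ * A iₘ jₘ`. Such a list is the same thing as a permutation `s` of the indices,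
`i_ν = s (2ν)` and `j_ν = s (2ν + 1)`, with these two properties (indices start at `0`). -/
def pfaffian {R : Type*} [CommRing R] (n : ℕ) (A : Matrix (Fin n) (Fin n) R) : R :=
  open scoped Classical in
  ∑ s : Equiv.Perm (Fin n),
    if (∀ ν : Fin (n / 2), s ⟨2 * ν.1, by omega⟩ < s ⟨2 * ν.1 + 1, by omega⟩) ∧
        (∀ ν ν' : Fin (n / 2), ν < ν' → s ⟨2 * ν.1, by omega⟩ < s ⟨2 * ν'.1, by omega⟩)
    then ((Equiv.Perm.sign s : ℤ) : R) *
      ∏ ν : Fin (n / 2), A (s ⟨2 * ν.1, by omega⟩) (s ⟨2 * ν.1 + 1, by omega⟩)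
    else 0

/-- The degeneracy ideal of a homomorphism `φ : E → F` of finite free modules: the ideal generated
by the `r`-minors, `r = min (rank E) (rank F)`. It is written without bases: the generators are the
determinants of the matrices `(ξᵢ (φ vⱼ))` for `v₁, …, v_r ∈ E` and linear forms `ξ₁, …, ξ_r`
on `F`; by multilinearity the `r`-minors with respect to any two bases generate the same ideal. -/
def degeneracyIdeal {A E F : Type*} [CommRing A] [AddCommGroup E] [Module A E]
    [AddCommGroup F] [Module A F] (φ : E →ₗ[A] F) : Ideal A :=
  Ideal.span {d : A | ∃ (v : Fin (min (Module.finrank A E) (Module.finrank A F)) → E)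
    (ξ : Fin (min (Module.finrank A E) (Module.finrank A F)) → Module.Dual A F),
    d = Matrix.det (Matrix.of fun i j => ξ i (φ (v j)))}

/-- The ideal in `A` of the critical subscheme of a morphism of smooth `k`-schemes, where `B → A` is
the induced homomorphism of local rings of target and source. The differential `T_X → f^* T_Y`
is, on local rings, the restriction map `Der_k(A, A) → Der_k(B, A) = A ⊗ Der_k(B, B)`. -/
def criticalIdeal (k B A : Type*) [CommRing k] [CommRing B] [CommRing A] [Algebra k B]
    [Algebra k A] [Algebra B A] [IsScalarTower k B A] : Ideal A :=
  degeneracyIdeal (Derivation.compAlgebraMapL k B A A)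

end Algebra

/-! ## Projective space -/

section ProjectiveSpace

variable (k : Type u) [Field k]

instance polyGraded (m : ℕ) : GradedAlgebra (MvPolynomial.homogeneousSubmodule (Fin (m + 1)) k) :=
  MvPolynomial.gradedAlgebra

/-- Projective space `Proj k[Y_0, …, Y_m]`. -/
def projSpace (m : ℕ) : Scheme.{u} :=
  Proj (MvPolynomial.homogeneousSubmodule (Fin (m + 1)) k)

/-- The structure morphism of projective space. -/
def projStr (m : ℕ) : projSpace k m ⟶ Spec (.of k) :=
  Proj.toSpecZero (MvPolynomial.homogeneousSubmodule (Fin (m + 1)) k) ≫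
    Spec.map (CommRingCat.ofHom
      (algebraMap k (MvPolynomial.homogeneousSubmodule (Fin (m + 1)) k 0)))

variable {k} {m : ℕ}

/-- The homogeneous prime ideal of `k[Y_0, …, Y_m]` that a point of projective space is. -/
def pointIdeal (y : projSpace k m) :
    HomogeneousIdeal (MvPolynomial.homogeneousSubmodule (Fin (m + 1)) k) :=
  ProjectiveSpectrum.asHomogeneousIdeal
    (show ProjectiveSpectrum (MvPolynomial.homogeneousSubmodule (Fin (m + 1)) k) from y)

/-- The affine coordinate `Y_j / Y_i` as an element of the local ring at a point `y` where
`Y_i` does not vanish. -/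
def affineCoord (y : projSpace k m) (i : Fin (m + 1))
    (hi : (MvPolynomial.X i : MvPolynomial (Fin (m + 1)) k) ∉ pointIdeal y) (j : Fin (m + 1)) :
    (projSpace k m).presheaf.stalk y :=
  (Proj.stalkIso (MvPolynomial.homogeneousSubmodule (Fin (m + 1)) k) y).inv.hom
    (HomogeneousLocalization.mk
      { deg := 1
        num := ⟨MvPolynomial.X j, MvPolynomial.isHomogeneous_X k j⟩
        den := ⟨MvPolynomial.X i, MvPolynomial.isHomogeneous_X k i⟩
        den_mem := hi })

/-- `y` is the `k`-rational point with homogeneous coordinates `a` (to be used for `a ≠ 0`): all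
the linear forms `a_i Y_j - a_j Y_i` vanish at `y`. -/
def HasCoordinates (y : projSpace k m) (a : Fin (m + 1) → k) : Prop :=
  ∀ i j, (MvPolynomial.C (a i) * MvPolynomial.X j - MvPolynomial.C (a j) * MvPolynomial.X i :
    MvPolynomial (Fin (m + 1)) k) ∈ pointIdeal y

end ProjectiveSpace

/-! ## Schemes over a field -/

section OverField

variable {k : Type u} [Field k]

/-- The homomorphism from `k` to the global functions of a `k`-scheme. -/
def constants {X : Scheme.{u}} (f : X ⟶ Spec (.of k)) : k →+* Γ(X, ⊤) :=
  ((Scheme.ΓSpecIso (.of k)).inv ≫ f.appTop).hom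

/-- The homomorphism from `k` to a local ring of a `k`-scheme. -/
def stalkConstants {X : Scheme.{u}} (f : X ⟶ Spec (.of k)) (x : X) : k →+* X.presheaf.stalk x :=
  (X.presheaf.germ ⊤ x trivial).hom.comp (constants f)

instance projSpaceStalkAlgebra {m : ℕ} (y : projSpace k m) :
    Algebra k ((projSpace k m).presheaf.stalk y) :=
  (stalkConstants (projStr k m) y).toAlgebra

/-- The restriction of a section of a sheaf of modules to a smaller open subset. -/
def res {X : Scheme.{u}} (L : X.Modules) {U V : X.Opens} (h : V ≤ U) (s : Γ(L, U)) : Γ(L, V) :=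
  (L.presheaf.map (homOfLE h).op).hom s

/-- The section `e` of `L` over `U` trivializes `L` over `U`: multiplication of functions by `e` is
an isomorphism from `𝒪_U` to `L|_U`. -/
def IsFrame {X : Scheme.{u}} (L : X.Modules) (U : X.Opens) (e : Γ(L, U)) : Prop :=
  ∀ (V : X.Opens) (h : V ≤ U), Function.Bijective fun r : Γ(X, V) => r • res L h e

/-- `L` is a line bundle: it is locally isomorphic to the structure sheaf. -/
def IsLineBundle {X : Scheme.{u}} (L : X.Modules) : Prop :=
  ∀ x : X, ∃ (U : X.Opens) (e : Γ(L, U)), x ∈ U ∧ IsFrame L U e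

end OverField

/-! ## Linear systems -/

/-- An `m`-dimensional linear system on a projective variety `X` of dimension `n` over `k`, given by
a linear subspace `M` of `H⁰(X, L)` of dimension `m + 1`. The subspace `M` is recorded by a basis
`b_0, …, b_m`; the dual basis `Y_0, …, Y_m` of `M^∨` identifies the projective space of
one-dimensional subspaces of `M` with `Proj k[Y_0, …, Y_m]`. -/
structure LinearSystem (k : Type u) [Field k] (n m : ℕ) where
  /-- The projective variety. -/
  X : Scheme.{u}
  /-- Its structure morphism. -/
  str : X ⟶ Spec (.of k)
  isIntegral : IsIntegral X
  projective : ∃ (r : ℕ) (i : X ⟶ projSpace k r), IsClosedImmersion i ∧ i ≫ projStr k r = str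
  /-- The dimension of the variety is `n`: the function field has transcendence degree `n`. -/
  dim_eq : letI := (stalkConstants str (genericPoint X)).toAlgebra
    Algebra.trdeg k X.functionField = n
  /-- The line bundle. -/
  L : X.Modules
  isLineBundle : IsLineBundle L
  /-- The basis of `M`. -/
  b : Fin (m + 1) → Γ(L, ⊤)
  linearIndependent : ∀ c : Fin (m + 1) → k, ∑ i, constants str (c i) • b i = 0 → c = 0

namespace LinearSystem

variable {k : Type u} [Field k] {n m : ℕ} (S : LinearSystem k n m)

instance stalkAlgebra (p : S.X) : Algebra k (S.X.presheaf.stalk p) :=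
  (stalkConstants S.str p).toAlgebra

/-- `s_0, …, s_m` are the functions `b_j / e` in the local ring at `p`, for some
local trivializing section `e` of `L` at `p`. -/
def IsLocalTuple (p : S.X) (s : Fin (m + 1) → S.X.presheaf.stalk p) : Prop :=
  ∃ (U : S.X.Opens) (hp : p ∈ U) (e : Γ(S.L, U)) (r : Fin (m + 1) → Γ(S.X, U)),
    IsFrame S.L U e ∧ (∀ j, r j • e = res S.L le_top (S.b j)) ∧
      ∀ j, s j = (S.X.presheaf.germ U p hp).hom (r j)

/-- The set `X°` of the points `p` at which the variety is smooth, which are not base points, and at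
which the differential of the morphism `Ψ = (b_0 : … : b_m)` to the dual projective space is
injective. The last condition says that a tangent vector (a derivation of the local ring with
values in the residue field) is zero if it kills all the functions `Ψ^*(Y_j / Y_i) = s_j / s_i`
with `s_i` non-vanishing at `p`. -/
def Xcirc : Set S.X :=
  {p | (S.str.stalkMap p).hom.FormallySmooth ∧
    ∃ s, S.IsLocalTuple p s ∧ (∃ i, IsUnit (s i)) ∧
      ∀ v : Derivation k (S.X.presheaf.stalk p)
          (IsLocalRing.ResidueField (S.X.presheaf.stalk p)),
        (∀ i j g, IsUnit (s i) → s j = g * s i → v g = 0) → v = 0}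

/-- The product of the variety with the parameter space `ℙ` of the linear system. -/
def Z : Scheme.{u} := pullback S.str (projStr k m)

/-- The first projection. -/
def pr₁ : S.Z ⟶ S.X := pullback.fst S.str (projStr k m)

/-- The second projection. -/
def pr₂ : S.Z ⟶ projSpace k m := pullback.snd S.str (projStr k m)

/-- The local ring at `p` of the variety. -/
abbrev OX (p : S.X) : Type u := S.X.presheaf.stalk p

/-- The local ring of the parameter space at the second projection of `z`. -/
abbrev OP (z : S.Z) : Type u := (projSpace k m).presheaf.stalk (S.pr₂ z)

/-- The local ring of the product at `z`. -/
abbrev OZ (z : S.Z) : Type u := S.Z.presheaf.stalk z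

instance algebraOPOZ (z : S.Z) : Algebra (S.OP z) (S.OZ z) := (S.pr₂.stalkMap z).hom.toAlgebra

instance algebraOZ (z : S.Z) : Algebra k (S.OZ z) :=
  ((S.pr₂.stalkMap z).hom.comp (algebraMap k (S.OP z))).toAlgebra

instance towerOPOZ (z : S.Z) : IsScalarTower k (S.OP z) (S.OZ z) :=
  IsScalarTower.of_algebraMap_eq fun _ => rfl

/-- `Φ` is a local expression at `z` of the canonical section `σ = ∑ b_j ⊗ Y_j` of the line bundle
`pr₁^* L ⊗ pr₂^* 𝒪(1)`, namely the quotient of `σ` by the trivializing section `e ⊗ Y_i`. -/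
def IsLocalEquation (z : S.Z) (Φ : S.OZ z) : Prop :=
  ∃ s, S.IsLocalTuple (S.pr₁ z) s ∧
    ∃ (i : Fin (m + 1)) (hi : MvPolynomial.X i ∉ pointIdeal (S.pr₂ z)),
      Φ = ∑ j, (S.pr₁.stalkMap z).hom (s j) *
        (S.pr₂.stalkMap z).hom (affineCoord (S.pr₂ z) i hi j)

/-! A closed subscheme is described by its ideals in the local rings, one for each point. -/

/-- The ideal at `z` of the universal family `𝒟`, the zero scheme of `σ`. -/
def idealD (z : S.Z) : Ideal (S.OZ z) := Ideal.span {Φ | S.IsLocalEquation z Φ}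

/-- The ideal at `z` of the critical subscheme `𝒞` of the projection `𝒟 → ℙ`. -/
def idealC (z : S.Z) : Ideal (S.OZ z) :=
  (criticalIdeal k (S.OP z) (S.OZ z ⧸ S.idealD z)).comap (Ideal.Quotient.mk (S.idealD z))

/-- The local ring of `𝒞` at `z` (the zero ring if `z` is not a point of `𝒞`). -/
abbrev OC (z : S.Z) : Type u := S.OZ z ⧸ S.idealC z

/-- The points of `𝒞°`, the part of `𝒞` that lies over `X°`. -/
def Ccirc : Set S.Z := {z | S.pr₁ z ∈ S.Xcirc ∧ S.idealC z ≠ ⊤}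

/-- The ideal at `z` of the critical subscheme `ℰ` of the projection `π₂ : 𝒞° → ℙ`. -/
def idealE (z : S.Z) : Ideal (S.OC z) := criticalIdeal k (S.OP z) (S.OC z)

/-- The matrix `(D_i D_j Φ)` restricted to `𝒞`, which expresses the universal Hessian with respect
to a local frame `D_1, …, D_n` of `pr₁^* T_X` (the derivations relative to `ℙ`) and the
trivialization of `pr₁^* L ⊗ pr₂^* 𝒪(1)` for which `Φ` is the local expression of `σ`. -/
def hessian (z : S.Z) (D : Module.Basis (Fin n) (S.OZ z) (Derivation (S.OP z) (S.OZ z) (S.OZ z)))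
    (Φ : S.OZ z) : Matrix (Fin n) (Fin n) (S.OC z) :=
  Matrix.of fun i j => Ideal.Quotient.mk (S.idealC z) (D i (D j Φ))

/-- The ideal at `z` of the degeneracy subscheme `ℛ` in `𝒞°` of the universal Hessian as an
anti-symmetric form, defined by the Pfaffians of the matrices that express the universal Hessian
locally (any two of them differ by a unit). -/
def idealR (z : S.Z) : Ideal (S.OC z) :=
  Ideal.span {g | ∃ (D : Module.Basis (Fin n) (S.OZ z) (Derivation (S.OP z) (S.OZ z) (S.OZ z)))
    (Φ : S.OZ z), S.IsLocalEquation z Φ ∧ g = pfaffian n (S.hessian z D Φ)}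

/-- The points of `ℛ`. -/
def R : Set S.Z := {z | z ∈ S.Ccirc ∧ S.idealR z ≠ ⊤}

/-! ## Completed fibers and hypersurface singularities -/

/-- The completion of the local ring of the variety at `p`. -/
abbrev completion (p : S.X) : Type u :=
  AdicCompletion (IsLocalRing.maximalIdeal (S.OX p)) (S.OX p)

/-- The ideal at `p = pr₁ z` of the fiber through `z` of the projection `ϖ₂ : ℛ → ℙ`, considered as
a subscheme of `X` by means of `pr₁` (which, if `z` is a closed point and `k` is algebraically
closed, is an isomorphism from the fiber of `pr₂` through `z` to `X`). The local ring of the fiber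
at `z` is `OC z / (idealR z + 𝔪_[f] OC z)`. -/
def fiberIdeal (z : S.Z) : Ideal (S.OX (S.pr₁ z)) :=
  (S.idealR z ⊔ (IsLocalRing.maximalIdeal (S.OP z)).map (algebraMap (S.OP z) (S.OC z))).comap
    ((Ideal.Quotient.mk (S.idealC z)).comp (S.pr₁.stalkMap z).hom)

/-- The ideal of the completion at `z` of that fiber, as a subscheme of the completion of `X`
at `p`: the kernel of the homomorphism between the completed local rings. -/
def completedFiberIdeal (z : S.Z) : Ideal (S.completion (S.pr₁ z)) :=
  LinearMap.ker (AdicCompletion.map (IsLocalRing.maximalIdeal (S.OX (S.pr₁ z)))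
    (S.fiberIdeal z).mkQ)

/-- The ideal at `p` of the divisor `D_[f]` of zeros of the section `f = ∑ a_j b_j`. -/
def divisorIdeal (a : Fin (m + 1) → k) (p : S.X) : Ideal (S.OX p) :=
  Ideal.span {g | ∃ s, S.IsLocalTuple p s ∧ g = ∑ j, algebraMap k (S.OX p) (a j) * s j}

end LinearSystem

/-- The ideal `(φ, ∂φ/∂x_1, …, ∂φ/∂x_n, ρ)` of `k[[x_1, …, x_n]]`, where `ρ` is the Pfaffian of the
matrix of the second derivatives of `φ`. It defines the scheme `R(D, p)` of a hypersurface
singularity `(D, p)` with the equation `φ = 0`. -/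
def singularityIdealR {k : Type*} [Field k] {n : ℕ} (φ : MvPowerSeries (Fin n) k) :
    Ideal (MvPowerSeries (Fin n) k) :=
  Ideal.span ({φ} ∪ Set.range (fun i => MvPowerSeries.pderiv k i φ) ∪
    {pfaffian n (Matrix.of fun i j => MvPowerSeries.pderiv k i (MvPowerSeries.pderiv k j φ))})

end PfaffianDegeneracy

end

/-! Everything is local at a point `z` of `𝒞°` over `p ∈ X°`. Let `O` be the local ring of `X` at
`p`. Smoothness over a perfect field gives `n` functions `x` whose differentials form a basis of
`Ω[O⁄k]`. Let `y` be affine coordinates of `ℙ`. The local ring of `X × ℙ` is a localization of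
`O[y]`, and the equation of `𝒟` is affine linear in `y`: `Φ = s₀ + ∑ s_j y_j`. Its derivatives `D_l
Φ` along `X` have the same form.

As `p` is not a base point and `dΨ` is injective there, the `n + 1` rows of coefficients of `Φ, D_1
Φ, …, D_n Φ` are linearly independent at `p` (`linearIndependent_jetMatrix`). These functions vanish
at `z`, so their linear parts are already independent (`linearIndependent_linear_part`), and they
can be completed to a system of affine linear coordinates over `O`. Two things follow: the scheme
that they define is locally an affine space over `O`, hence integral (`isDomain_quotient_jet`), and
the derivations of the quotient have explicit free coordinates (`exists_quotient_derivation_equiv`).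
In such coordinates the differential of `𝒟 → ℙ` is `c ⊕ id` with `c = -(D_l Φ)`, so that `𝒞` is `Φ =
D_l Φ = 0`. The differential of `𝒞° → ℙ` is `(0, -H) ⊕ id` with `H` the Hessian; the `0` is the row
of the `D_l Φ`, which vanish on `𝒞`. So `ℰ` is `det H = 0`.

In characteristic two commutators and squares of derivations are derivations, so on `𝒞` the matrix
`H` is symmetric with zero diagonal, and `det H` is the square of its Pfaffian
(`det_eq_pfaffian_sq`). This is `ℰ = 2 ℛ`. The bound on the codimension is Krull's principal ideal
theorem. In a domain the equation of `ℛ` is a zero divisor only if it is zero, which codimension one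
excludes.

For the fibers, the ideal generated by `Φ`, the `D_l Φ` and the Pfaffian depends neither on the
frame nor on the equation (`hessianIdeal_eq`). Restriction to a rational fiber is an evaluation of
`y` which commutes with the `D_l`, so the fiber of `ℛ` is given by the same construction for `f` in
`O` (`fiberIdeal_eq`). In the completion of `O`, the derivations dual to the `dx_l` and the partial
derivatives of any formal parameter system are both bases of the derivations
(`exists_bases_derivation`), so the extended ideal is that of `R(D, p)`. -/

open AlgebraicGeometry CategoryTheory CategoryTheory.Limits

noncomputable section

namespace PfaffianDegeneracy

universe u

/-! ## Pfaffians in characteristic two -/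

section Pfaffian

variable {n : ℕ}

/-- The index `2 ν`. -/
def evenIdx (ν : Fin (n / 2)) : Fin n := ⟨2 * ν.1, by omega⟩

/-- The index `2 ν + 1`. -/
def oddIdx (ν : Fin (n / 2)) : Fin n := ⟨2 * ν.1 + 1, by omega⟩

lemma evenIdx_injective : Function.Injective (evenIdx (n := n)) := fun a b h => by
  simp only [evenIdx, Fin.mk.injEq] at h
  exact Fin.ext (by omega)

lemma oddIdx_injective : Function.Injective (oddIdx (n := n)) := fun a b h => by
  simp only [oddIdx, Fin.mk.injEq] at h
  exact Fin.ext (by omega)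

lemma evenIdx_ne_oddIdx (a b : Fin (n / 2)) : evenIdx a ≠ oddIdx b := fun h => by
  simp only [evenIdx, oddIdx, Fin.mk.injEq] at h
  omega

lemma eq_evenIdx_or_oddIdx (hn : Even n) (i : Fin n) :
    (∃ ν, i = evenIdx ν) ∨ ∃ ν, i = oddIdx ν := by
  obtain ⟨h, rfl⟩ := hn
  rcases Nat.even_or_odd' i.1 with ⟨c, hc | hc⟩
  · exact Or.inl ⟨⟨c, by omega⟩, Fin.ext hc⟩
  · exact Or.inr ⟨⟨c, by omega⟩, Fin.ext hc⟩

/-- The permutations that list the pairs of a perfect matching in the normalized way. -/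
def IsNormalized (s : Equiv.Perm (Fin n)) : Prop :=
  (∀ ν : Fin (n / 2), s (evenIdx ν) < s (oddIdx ν)) ∧
    ∀ ν ν' : Fin (n / 2), ν < ν' → s (evenIdx ν) < s (evenIdx ν')

/-- Perfect matchings, as involutions without fixed points. -/
def IsMatching (t : Equiv.Perm (Fin n)) : Prop := ∀ i, t (t i) = i ∧ t i ≠ i

open scoped Classical in
lemma pfaffian_eq_sum_isNormalized {R : Type*} [CommRing R] [CharP R 2]
    (A : Matrix (Fin n) (Fin n) R) :
    pfaffian n A = ∑ s : Equiv.Perm (Fin n) with IsNormalized s,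
      ∏ ν : Fin (n / 2), A (s (evenIdx ν)) (s (oddIdx ν)) := by
  rw [pfaffian, Finset.sum_filter]
  refine Finset.sum_congr rfl fun s _ => if_congr Iff.rfl ?_ rfl
  have : ((Equiv.Perm.sign s : ℤ) : R) = 1 := by
    rcases Int.units_eq_one_or (Equiv.Perm.sign s) with h | h <;> simp [h, CharTwo.neg_eq]
  rw [this, one_mul]
  rfl

/-- The matching that a normalized permutation lists. -/
lemma exists_isMatching_of_isNormalized (hn : Even n) (s : Equiv.Perm (Fin n)) :
    ∃ t : Equiv.Perm (Fin n), IsMatching t ∧ (∀ ν, t (s (evenIdx ν)) = s (oddIdx ν)) ∧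
      ∀ ν, t (s (oddIdx ν)) = s (evenIdx ν) := by
  have key : ∀ i : Fin n, ∃ j : Fin n, (∀ ν, i = evenIdx ν → j = oddIdx ν) ∧
      (∀ ν, i = oddIdx ν → j = evenIdx ν) := fun i => by
    rcases eq_evenIdx_or_oddIdx hn i with ⟨ν, rfl⟩ | ⟨ν, rfl⟩
    · exact ⟨oddIdx ν, fun ν' h => by rw [evenIdx_injective h],
        fun ν' h => (evenIdx_ne_oddIdx _ _ h).elim⟩
    · exact ⟨evenIdx ν, fun ν' h => (evenIdx_ne_oddIdx _ _ h.symm).elim,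
        fun ν' h => by rw [oddIdx_injective h]⟩
  choose f hf using key
  have he : ∀ ν, f (evenIdx ν) = oddIdx ν := fun ν => (hf _).1 ν rfl
  have ho : ∀ ν, f (oddIdx ν) = evenIdx ν := fun ν => (hf _).2 ν rfl
  have hinv : Function.Involutive f := fun i => by
    rcases eq_evenIdx_or_oddIdx hn i with ⟨ν, rfl⟩ | ⟨ν, rfl⟩ <;> simp [he, ho]
  refine ⟨s * hinv.toPerm * s⁻¹, fun i => ⟨by simp [hinv _], fun h => ?_⟩, fun ν => by simp [he],
    fun ν => by simp [ho]⟩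
  obtain ⟨j, rfl⟩ := s.surjective i
  have h' : f j = j := by simpa using h
  rcases eq_evenIdx_or_oddIdx hn j with ⟨ν, rfl⟩ | ⟨ν, rfl⟩
  · rw [he] at h'
    exact evenIdx_ne_oddIdx _ _ h'.symm
  · rw [ho] at h'
    exact evenIdx_ne_oddIdx _ _ h'

/-- Recovers the set of first members of the pairs from the matching alone; since a normalized
permutation lists them in increasing order, it is determined by its matching. -/
lemma IsNormalized.lt_iff (hn : Even n) {s t : Equiv.Perm (Fin n)} (hs : IsNormalized s)
    (he : ∀ ν, t (s (evenIdx ν)) = s (oddIdx ν)) (ho : ∀ ν, t (s (oddIdx ν)) = s (evenIdx ν))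
    (i : Fin n) : i < t i ↔ ∃ ν, s (evenIdx ν) = i := by
  obtain ⟨j, rfl⟩ := s.surjective i
  rcases eq_evenIdx_or_oddIdx hn j with ⟨ν, rfl⟩ | ⟨ν, rfl⟩
  · simp [he, hs.1 ν]
  · simp only [ho, EmbeddingLike.apply_eq_iff_eq]
    exact ⟨fun h => absurd h (hs.1 ν).not_gt, fun ⟨ν', h⟩ => (evenIdx_ne_oddIdx _ _ h).elim⟩

/-- `t` exchanges the indices with `i < t i` and the remaining ones. -/
lemma two_mul_card_lt (t : Equiv.Perm (Fin n)) (ht : IsMatching t) :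
    2 * (Finset.univ.filter fun i => i < t i).card = n := by
  have h1 : (Finset.univ.filter fun i => i < t i).card =
      (Finset.univ.filter fun i => ¬ i < t i).card := by
    refine Finset.card_bij (fun i _ => t i) (fun i hi => ?_) (fun i _ j _ h => t.injective h)
      fun i hi => ⟨t i, ?_, (ht i).1⟩
    · simp only [Finset.mem_filter, Finset.mem_univ, true_and] at hi ⊢
      rw [(ht i).1]; exact hi.not_gt
    · simp only [Finset.mem_filter, Finset.mem_univ, true_and] at hi ⊢
      rw [(ht i).1]
      exact lt_of_le_of_ne (not_lt.mp hi) (ht i).2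
  have h2 := Finset.card_filter_add_card_filter_not (s := (Finset.univ : Finset (Fin n)))
    (fun i => i < t i)
  rw [Finset.card_univ, Fintype.card_fin] at h2
  omega

open scoped Classical in
/-- In characteristic two the Pfaffian is the sum over all perfect matchings. -/
lemma pfaffian_eq_sum_isMatching {R : Type*} [CommRing R] [CharP R 2] (hn : Even n)
    (A : Matrix (Fin n) (Fin n) R) :
    pfaffian n A = ∑ t : Equiv.Perm (Fin n) with IsMatching t,
      ∏ i with i < t i, A i (t i) := by
  rw [pfaffian_eq_sum_isNormalized]
  choose τ hτ he ho using exists_isMatching_of_isNormalized hn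
  refine Finset.sum_bij (fun s _ => τ s) (fun s _ => by simp [hτ s]) ?_ ?_ ?_
  · intro s hs s' hs' h
    simp only [Finset.mem_filter, Finset.mem_univ, true_and] at hs hs'
    -- Two strictly increasing enumerations of the same set agree.
    have hst : ∀ ν, s (evenIdx ν) = s' (evenIdx ν) := by
      have h1 : StrictMono fun ν => s (evenIdx ν) := fun a b hab => hs.2 a b hab
      have h2 : StrictMono fun ν => s' (evenIdx ν) := fun a b hab => hs'.2 a b hab
      have hr : Set.range (fun ν => s (evenIdx ν)) = Set.range fun ν => s' (evenIdx ν) := by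
        ext i
        rw [Set.mem_range, Set.mem_range, ← hs.lt_iff hn (he s) (ho s),
          ← hs'.lt_iff hn (he s') (ho s'), h]
      exact congrFun ((StrictMono.range_inj h1 h2).mp hr)
    ext1 i
    rcases eq_evenIdx_or_oddIdx hn i with ⟨ν, rfl⟩ | ⟨ν, rfl⟩
    · exact hst ν
    · rw [← he, ← he, h, hst]
  · intro t ht
    simp only [Finset.mem_filter, Finset.mem_univ, true_and] at ht
    set F := Finset.univ.filter fun i => i < t i with hF
    have hc : F.card = n / 2 := by
      have := two_mul_card_lt t ht
      rw [← hF] at this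
      omega
    -- The preimage of `t` lists the smaller members of the pairs in increasing order, each followed
    -- by its partner.
    set e := F.orderEmbOfFin hc
    have heF : ∀ ν, e ν < t (e ν) := fun ν =>
      (Finset.mem_filter.mp (F.orderEmbOfFin_mem hc ν)).2
    have key : ∀ i : Fin n, ∃ j : Fin n, (∀ ν, i = evenIdx ν → j = e ν) ∧
        (∀ ν, i = oddIdx ν → j = t (e ν)) := fun i => by
      rcases eq_evenIdx_or_oddIdx hn i with ⟨ν, rfl⟩ | ⟨ν, rfl⟩
      · exact ⟨e ν, fun ν' h => by rw [evenIdx_injective h],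
          fun ν' h => (evenIdx_ne_oddIdx _ _ h).elim⟩
      · exact ⟨t (e ν), fun ν' h => (evenIdx_ne_oddIdx _ _ h.symm).elim,
          fun ν' h => by rw [oddIdx_injective h]⟩
    choose f hf using key
    have fe : ∀ ν, f (evenIdx ν) = e ν := fun ν => (hf _).1 ν rfl
    have fo : ∀ ν, f (oddIdx ν) = t (e ν) := fun ν => (hf _).2 ν rfl
    have hne : ∀ ν ν', e ν ≠ t (e ν') := fun ν ν' h => by
      have h1 := heF ν
      have h2 := heF ν'
      rw [h, (ht _).1] at h1
      exact lt_asymm h1 h2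
    have hfinj : Function.Injective f := fun i j h => by
      rcases eq_evenIdx_or_oddIdx hn i with ⟨ν, rfl⟩ | ⟨ν, rfl⟩ <;>
        rcases eq_evenIdx_or_oddIdx hn j with ⟨ν', rfl⟩ | ⟨ν', rfl⟩ <;>
        simp only [fe, fo] at h
      · rw [e.injective h]
      · exact (hne _ _ h).elim
      · exact (hne _ _ h.symm).elim
      · rw [e.injective (t.injective h)]
    let s : Equiv.Perm (Fin n) := Equiv.ofBijective f (Finite.injective_iff_bijective.mp hfinj)
    have hs : IsNormalized s :=
      ⟨fun ν => by simp [s, fe, fo, heF], fun ν ν' h => by simp [s, fe, h]⟩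
    refine ⟨s, by simpa using hs, ?_⟩
    ext1 i
    obtain ⟨j, rfl⟩ := s.surjective i
    rcases eq_evenIdx_or_oddIdx hn j with ⟨ν, rfl⟩ | ⟨ν, rfl⟩
    · rw [he]; simp [s, fe, fo]
    · rw [ho]; simp [s, fe, fo, (ht _).1]
  · intro s hs
    simp only [Finset.mem_filter, Finset.mem_univ, true_and] at hs
    refine Finset.prod_bij (fun ν _ => s (evenIdx ν)) (fun ν _ => ?_)
      (fun ν _ ν' _ h => evenIdx_injective (s.injective h)) (fun i hi => ?_)
      fun ν _ => by rw [he]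
    · simpa [he] using hs.1 ν
    · obtain ⟨ν, hν⟩ := (hs.lt_iff hn (he s) (ho s) i).mp (by simpa using hi)
      exact ⟨ν, Finset.mem_univ _, hν⟩

/-- By symmetry of `A`, an index and its partner contribute the same factor. -/
lemma prod_eq_sq_of_isMatching {R : Type*} [CommRing R] (A : Matrix (Fin n) (Fin n) R)
    (hs : ∀ i j, A i j = A j i) (t : Equiv.Perm (Fin n)) (ht : IsMatching t) :
    ∏ i, A (t i) i = (∏ i with i < t i, A i (t i)) ^ 2 := by
  rw [← Finset.prod_filter_mul_prod_filter_not (s := Finset.univ) (p := fun i => i < t i), sq]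
  congr 1
  · exact Finset.prod_congr rfl fun i _ => hs _ _
  · symm
    refine Finset.prod_bij (fun i _ => t i) (fun i hi => ?_) (fun i _ j _ h => t.injective h)
      (fun i hi => ⟨t i, ?_, (ht i).1⟩) fun i _ => by rw [(ht i).1]
    · simp only [Finset.mem_filter, Finset.mem_univ, true_and] at hi ⊢
      rw [(ht i).1]; exact hi.not_gt
    · simp only [Finset.mem_filter, Finset.mem_univ, true_and] at hi ⊢
      rw [(ht i).1]
      exact lt_of_le_of_ne (not_lt.mp hi) (ht i).2

open scoped Classical in
/-- In characteristic two the determinant of an alternating matrix is the square of its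
Pfaffian. -/
theorem det_eq_pfaffian_sq {R : Type*} [CommRing R] [CharP R 2] (hn : Even n)
    (A : Matrix (Fin n) (Fin n) R) (hs : ∀ i j, A i j = A j i) (hd : ∀ i, A i i = 0) :
    A.det = pfaffian n A ^ 2 := by
  have hdet : A.det = ∑ t : Equiv.Perm (Fin n), ∏ i, A (t i) i := by
    rw [Matrix.det_apply']
    refine Finset.sum_congr rfl fun t _ => ?_
    have : ((Equiv.Perm.sign t : ℤ) : R) = 1 := by
      rcases Int.units_eq_one_or (Equiv.Perm.sign t) with h | h <;> simp [h, CharTwo.neg_eq]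
    rw [this, one_mul]
  have hfix : ∀ t : Equiv.Perm (Fin n), (∃ i, t i = i) → ∏ i, A (t i) i = 0 := by
    rintro t ⟨i, hi⟩
    exact Finset.prod_eq_zero (Finset.mem_univ i) (by rw [hi, hd])
  -- Squaring is additive, so the square of the Pfaffian is the sum of the squares of its terms, and
  -- these are the terms of the determinant at the matchings.
  rw [hdet, pfaffian_eq_sum_isMatching hn, sum_pow_char,
    ← Finset.sum_filter_add_sum_filter_not _ (fun t : Equiv.Perm (Fin n) => IsMatching t)]
  rw [Finset.sum_congr rfl (g := fun t => (∏ i with i < t i, A i (t i)) ^ 2)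
    fun t ht => prod_eq_sq_of_isMatching A hs t (Finset.mem_filter.mp ht).2]
  convert add_zero _
  -- The other terms cancel: `t` and `t⁻¹` contribute the same by symmetry, and a `t` with `t⁻¹ = t`
  -- that is not a matching has a fixed point, so its term contains a diagonal entry.
  refine Finset.sum_involution (fun t _ => t⁻¹) (fun t _ => ?_) (fun t ht hne h => ?_)
    (fun t ht => ?_) (fun t _ => inv_inv t)
  · have : ∏ i, A (t⁻¹ i) i = ∏ i, A (t i) i := by
      rw [← Equiv.prod_comp t]
      exact Finset.prod_congr rfl fun i _ => by rw [t.inv_eq_iff_eq.mpr rfl, hs]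
    rw [this, CharTwo.add_self_eq_zero]
  · refine (Finset.mem_filter.mp ht).2 fun i => ⟨?_, fun hi => hne (hfix t ⟨i, hi⟩)⟩
    conv_lhs => enter [1]; rw [← h]
    exact t.symm_apply_apply i
  · simp only [Finset.mem_filter, Finset.mem_univ, true_and] at ht ⊢
    refine fun hm => ht fun i => ?_
    obtain ⟨h1, h2⟩ := hm (t i)
    rw [t.inv_eq_iff_eq.mpr rfl] at h1 h2
    have h3 : t i = t⁻¹ i := (t.inv_eq_iff_eq.mpr (t.inv_eq_iff_eq.mp h1)).symm
    exact ⟨by rw [h3]; simp, fun h => h2 h.symm⟩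

lemma map_pfaffian {R S : Type*} [CommRing R] [CommRing S] (f : R →+* S)
    (A : Matrix (Fin n) (Fin n) R) : f (pfaffian n A) = pfaffian n (A.map f) := by
  simp only [pfaffian, map_sum]
  refine Finset.sum_congr rfl fun s _ => ?_
  split_ifs <;> simp

lemma pfaffian_smul {R : Type*} [CommRing R] (c : R) (A : Matrix (Fin n) (Fin n) R) :
    pfaffian n (c • A) = c ^ (n / 2) * pfaffian n A := by
  simp only [pfaffian, Finset.mul_sum]
  refine Finset.sum_congr rfl fun s _ => ?_
  split_ifs
  · simp [Finset.prod_mul_distrib]; ring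
  · simp

/-- The generic alternating matrix. -/
def genericAlternating (n : ℕ) (β : Type*) :
    Matrix (Fin n) (Fin n) (MvPolynomial ((Fin n × Fin n) ⊕ β) (ZMod 2)) :=
  Matrix.of fun i j => if i < j then MvPolynomial.X (Sum.inl (i, j))
    else if j < i then MvPolynomial.X (Sum.inl (j, i)) else 0

/-- In characteristic two, `pf (B A Bᵀ) = det B * pf A` for alternating `A`. -/
theorem pfaffian_mul_mul_transpose {R : Type*} [CommRing R] (h2 : (2 : R) = 0) (hn : Even n)
    (A B : Matrix (Fin n) (Fin n) R) (hs : ∀ i j, A i j = A j i) (hd : ∀ i, A i i = 0) :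
    pfaffian n (B * A * B.transpose) = B.det * pfaffian n A := by
  cases subsingleton_or_nontrivial R
  · exact Subsingleton.elim _ _
  have : CharP R 2 := CharTwo.of_one_ne_zero_of_two_eq_zero one_ne_zero h2
  -- Only the squares of the two sides are known to agree. Over a polynomial ring over `ZMod 2` the
  -- Frobenius is injective, so the identity holds for generic matrices and can then be specialized.
  let T := MvPolynomial ((Fin n × Fin n) ⊕ (Fin n × Fin n)) (ZMod 2)
  let A' : Matrix (Fin n) (Fin n) T := genericAlternating n (Fin n × Fin n)
  let B' : Matrix (Fin n) (Fin n) T := Matrix.of fun i j => MvPolynomial.X (Sum.inr (i, j))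
  have hs' : ∀ i j, A' i j = A' j i := fun i j => by
    simp only [A', genericAlternating, Matrix.of_apply]
    rcases lt_trichotomy i j with h | rfl | h
    · simp [h, h.not_gt]
    · rfl
    · simp [h, h.not_gt]
  have hd' : ∀ i, A' i i = 0 := fun i => by simp [A', genericAlternating]
  have hsC : ∀ i j, (B' * A' * B'.transpose) i j = (B' * A' * B'.transpose) j i := fun i j => by
    have hA : A'.transpose = A' := Matrix.ext fun i j => hs' j i
    have : (B' * A' * B'.transpose).transpose = B' * A' * B'.transpose := by
      simp [Matrix.transpose_mul, hA, Matrix.mul_assoc]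
    exact congrFun (congrFun this j) i
  have hdC : ∀ i, (B' * A' * B'.transpose) i i = 0 := fun i => by
    have : (B' * A' * B'.transpose) i i = ∑ p : Fin n × Fin n, B' i p.1 * A' p.1 p.2 * B' i p.2 := by
      rw [Fintype.sum_prod_type_right, Matrix.mul_apply]
      exact Finset.sum_congr rfl fun j _ => by
        rw [Matrix.mul_apply, Matrix.transpose_apply, Finset.sum_mul]
    rw [this]
    refine Finset.sum_involution (fun p _ => p.swap) (fun p _ => ?_) (fun p _ hp h => hp ?_)
      (fun p _ => Finset.mem_univ _) (fun p _ => p.swap_swap)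
    · have : B' i p.swap.1 * A' p.swap.1 p.swap.2 * B' i p.swap.2 =
          B' i p.1 * A' p.1 p.2 * B' i p.2 := by
        simp only [Prod.fst_swap, Prod.snd_swap, hs' p.2 p.1]; ring
      rw [this, CharTwo.add_self_eq_zero]
    · have : p.1 = p.2 := congrArg Prod.snd h
      rw [this, hd']; ring
  have key : pfaffian n (B' * A' * B'.transpose) = B'.det * pfaffian n A' := by
    have h2 : pfaffian n (B' * A' * B'.transpose) ^ 2 = (B'.det * pfaffian n A') ^ 2 := by
      rw [← det_eq_pfaffian_sq hn _ hsC hdC, mul_pow, ← det_eq_pfaffian_sq hn _ hs' hd',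
        Matrix.det_mul, Matrix.det_mul, Matrix.det_transpose]
      ring
    exact frobenius_inj T 2 h2
  let f : T →+* R := MvPolynomial.eval₂Hom (ZMod.castHom dvd_rfl R)
    (Sum.elim (fun p => A p.1 p.2) (fun p => B p.1 p.2))
  have hfl : ∀ i j, f (MvPolynomial.X (Sum.inl (i, j))) = A i j := fun i j =>
    MvPolynomial.eval₂Hom_X' _ _ _
  have hfr : ∀ i j, f (MvPolynomial.X (Sum.inr (i, j))) = B i j := fun i j =>
    MvPolynomial.eval₂Hom_X' _ _ _
  have hA : A'.map f = A := Matrix.ext fun i j => by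
    simp only [A', genericAlternating, Matrix.map_apply, Matrix.of_apply]
    rcases lt_trichotomy i j with h | rfl | h
    · simp [h, hfl]
    · simp [hd]
    · simp [h, h.not_gt, hfl, hs j i]
  have hB : B'.map f = B := Matrix.ext fun i j => by simp [B', hfr]
  have := congrArg f key
  rwa [map_mul, map_pfaffian, map_pfaffian, RingHom.map_det, RingHom.mapMatrix_apply, hA, hB,
    Matrix.map_mul, Matrix.map_mul, Matrix.transpose_map, hA, hB] at this

end Pfaffian

/-! ## Degeneracy ideals -/

section Degeneracy

variable {A E F : Type*} [CommRing A] [AddCommGroup E] [Module A E] [AddCommGroup F] [Module A F]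

/-- Together with `degeneracyIdeal_le`, this replaces the index type `Fin (min …)` by any type of
the same cardinality, so that minors can be written in blocks. -/
lemma det_mem_degeneracyIdeal {ι : Type*} [Fintype ι] [DecidableEq ι] (φ : E →ₗ[A] F)
    (hι : min (Module.finrank A E) (Module.finrank A F) = Fintype.card ι) (v : ι → E)
    (ξ : ι → Module.Dual A F) :
    Matrix.det (Matrix.of fun i j => ξ i (φ (v j))) ∈ degeneracyIdeal φ := by
  let e : Fin (min (Module.finrank A E) (Module.finrank A F)) ≃ ι :=
    Fintype.equivOfCardEq (by simpa using hι)
  refine Ideal.subset_span ⟨v ∘ e, ξ ∘ e, ?_⟩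
  rw [← Matrix.det_submatrix_equiv_self e]
  rfl

lemma degeneracyIdeal_le {ι : Type*} [Fintype ι] [DecidableEq ι] (φ : E →ₗ[A] F)
    (hι : min (Module.finrank A E) (Module.finrank A F) = Fintype.card ι) (I : Ideal A)
    (h : ∀ (v : ι → E) (ξ : ι → Module.Dual A F),
      Matrix.det (Matrix.of fun i j => ξ i (φ (v j))) ∈ I) :
    degeneracyIdeal φ ≤ I := by
  let e : ι ≃ Fin (min (Module.finrank A E) (Module.finrank A F)) :=
    Fintype.equivOfCardEq (by simpa using hι.symm)
  refine Ideal.span_le.mpr ?_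
  rintro _ ⟨v, ξ, rfl⟩
  rw [← Matrix.det_submatrix_equiv_self e]
  exact h (v ∘ e) (ξ ∘ e)

lemma det_mem_of_row_mem {ι : Type*} [Fintype ι] [DecidableEq ι] (M : Matrix ι ι A) (I : Ideal A)
    (i : ι) (h : ∀ j, M i j ∈ I) : M.det ∈ I := by
  rw [← Ideal.Quotient.eq_zero_iff_mem, RingHom.map_det]
  exact Matrix.det_eq_zero_of_row_eq_zero i fun j => Ideal.Quotient.eq_zero_iff_mem.mpr (h j)

lemma finrank_eq_card_of_equiv_fun [Nontrivial A] {ι : Type*} [Fintype ι] (e : E ≃ₗ[A] (ι → A)) :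
    Module.finrank A E = Fintype.card ι := by
  rw [e.finrank_eq, Module.finrank_fintype_fun_eq_card]

variable {ν μ : Type*} [Fintype ν] [Fintype μ] [DecidableEq ν] [DecidableEq μ]

/-- The degeneracy ideal of `c ⊕ id : A^ν × A^μ → A × A^μ` is generated by the coefficients of the
linear form `c`. -/
theorem degeneracyIdeal_eq_span_range [Nontrivial A] [Nonempty ν] (e : E ≃ₗ[A] (ν ⊕ μ → A))
    (f : F ≃ₗ[A] (Unit ⊕ μ → A)) (φ : E →ₗ[A] F) (c : ν → A)
    (h₁ : ∀ v, f (φ v) (Sum.inl ()) = ∑ l, c l * e v (Sum.inl l))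
    (h₂ : ∀ v j, f (φ v) (Sum.inr j) = e v (Sum.inr j)) :
    degeneracyIdeal φ = Ideal.span (Set.range c) := by
  have hr : min (Module.finrank A E) (Module.finrank A F) = Fintype.card (Unit ⊕ μ) := by
    rw [finrank_eq_card_of_equiv_fun e, finrank_eq_card_of_equiv_fun f]
    have : 0 < Fintype.card ν := Fintype.card_pos
    simp only [Fintype.card_sum, Fintype.card_unit]
    omega
  apply le_antisymm
  · refine degeneracyIdeal_le φ hr _ fun v ξ => ?_
    -- Every minor factors through the coordinates of the target, where the row of the first
    -- coordinate is a combination of the `c l`.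
    have : (Matrix.of fun i j => ξ i (φ (v j))) =
        (Matrix.of fun i o => ξ i (f.symm (Pi.single o 1))) * Matrix.of fun o j => f (φ (v j)) o := by
      ext i j
      simp only [Matrix.of_apply, Matrix.mul_apply]
      conv_lhs => rw [← f.symm_apply_apply (φ (v j)), pi_eq_sum_univ' (f (φ (v j)))]
      simp [mul_comm]
    rw [this, Matrix.det_mul]
    refine Ideal.mul_mem_left _ _ (det_mem_of_row_mem _ _ (Sum.inl ()) fun j => ?_)
    rw [Matrix.of_apply, h₁]
    exact Ideal.sum_mem _ fun l _ => Ideal.mul_mem_right _ _ (Ideal.subset_span ⟨l, rfl⟩)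
  · refine Ideal.span_le.mpr ?_
    rintro _ ⟨l, rfl⟩
    -- Conversely, the basis vector `l` of the first block together with all those of the second
    -- gives the minor `c l`.
    have := det_mem_degeneracyIdeal φ hr
      (Sum.elim (fun _ => e.symm (Pi.single (Sum.inl l) 1)) fun j => e.symm (Pi.single (Sum.inr j) 1))
      fun o => (LinearMap.proj o).comp f.toLinearMap
    convert this
    have hM : (Matrix.of fun i j => ((LinearMap.proj i).comp f.toLinearMap) (φ ((Sum.elim
        (fun _ => e.symm (Pi.single (Sum.inl l) 1)) fun j => e.symm (Pi.single (Sum.inr j) 1) :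
        Unit ⊕ μ → E) j))) = Matrix.diagonal (Sum.elim (fun _ => c l) (fun _ => 1)) := by
      ext i j
      rcases i with i | i <;> rcases j with j | j
      · simp [h₁, Pi.single_apply]
      · simp [h₁]
      · simp [h₂]
      · simp [h₂, Pi.single_apply, Matrix.diagonal_apply]
    rw [hM, Matrix.det_diagonal]
    simp

/-- The degeneracy ideal of `(0, H) ⊕ id : A^ν × A^μ → (A × A^ν) × A^μ` is generated by the
determinant of `H`. -/
theorem degeneracyIdeal_eq_span_det [Nontrivial A] (e : E ≃ₗ[A] (ν ⊕ μ → A))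
    (f : F ≃ₗ[A] (Option ν ⊕ μ → A)) (φ : E →ₗ[A] F) (H : Matrix ν ν A)
    (h₀ : ∀ v, f (φ v) (Sum.inl none) = 0)
    (h₁ : ∀ v i, f (φ v) (Sum.inl (some i)) = ∑ l, H i l * e v (Sum.inl l))
    (h₂ : ∀ v j, f (φ v) (Sum.inr j) = e v (Sum.inr j)) :
    degeneracyIdeal φ = Ideal.span {H.det} := by
  have hr : min (Module.finrank A E) (Module.finrank A F) = Fintype.card (ν ⊕ μ) := by
    rw [finrank_eq_card_of_equiv_fun e, finrank_eq_card_of_equiv_fun f]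
    simp only [Fintype.card_sum, Fintype.card_option]
    omega
  -- The coordinate `none` of the image is always zero, so `φ` is the square matrix `M` followed by
  -- the inclusion `g` of the other coordinates.
  let M : Matrix (ν ⊕ μ) (ν ⊕ μ) A := Matrix.fromBlocks H 0 0 1
  have hM : M.det = H.det := by simp [M]
  let g : ν ⊕ μ → Option ν ⊕ μ := Sum.map some id
  have hg : ∀ v i, f (φ v) (g i) = ∑ l, M i l * e v l := fun v i => by
    rcases i with i | i
    · simp [g, M, h₁]
    · simp [g, M, h₂, Matrix.one_apply]
  have hf : ∀ v, f (φ v) = ∑ i, f (φ v) (g i) • Pi.single (g i) 1 := fun v => by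
    conv_lhs => rw [pi_eq_sum_univ' (f (φ v))]
    simp [g, Fintype.sum_sum_type, Fintype.sum_option, h₀]
  apply le_antisymm
  · refine degeneracyIdeal_le φ hr _ fun v ξ => ?_
    have : (Matrix.of fun i j => ξ i (φ (v j))) =
        (Matrix.of fun i o => ξ i (f.symm (Pi.single (g o) 1))) * (M *
          Matrix.of fun o j => e (v j) o) := by
      ext i j
      simp only [Matrix.of_apply, Matrix.mul_apply]
      conv_lhs => rw [← f.symm_apply_apply (φ (v j)), hf, map_sum, map_sum]
      refine Finset.sum_congr rfl fun o _ => ?_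
      rw [map_smul, map_smul, hg, smul_eq_mul, mul_comm]
    rw [this, Matrix.det_mul, Matrix.det_mul, hM]
    exact Ideal.mul_mem_left _ _ (Ideal.mul_mem_right _ _ (Ideal.subset_span rfl))
  · rw [Ideal.span_singleton_le_iff_mem]
    have := det_mem_degeneracyIdeal φ hr (fun o => e.symm (Pi.single o 1))
      fun o => (LinearMap.proj (g o)).comp f.toLinearMap
    convert this
    rw [← hM]
    congr 1
    ext i j
    simp [hg, Pi.single_apply]

end Degeneracy

/-! ## Differential bases -/

section DifferentialBasis

variable (k R : Type*) [CommRing k] [CommRing R] [Algebra k R] {ι : Type*}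

/-- The differentials of the family `t` form a basis of the Kähler differentials. -/
structure IsDifferentialBasis (t : ι → R) : Prop where
  linearIndependent : LinearIndependent R fun i => KaehlerDifferential.D k R (t i)
  span : ⊤ ≤ Submodule.span R (Set.range fun i => KaehlerDifferential.D k R (t i))

variable {k R}

namespace IsDifferentialBasis

variable {t : ι → R} (h : IsDifferentialBasis k R t)
include h

/-- The basis of the Kähler differentials. -/
def basis : Module.Basis ι R (Ω[R⁄k]) := Module.Basis.mk h.linearIndependent h.span

lemma basis_apply (i : ι) : h.basis i = KaehlerDifferential.D k R (t i) := by simp [basis]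

/-- The derivations dual to the differentials of `t`. -/
def dual (i : ι) : Derivation k R R := (h.basis.coord i).compDer (KaehlerDifferential.D k R)

lemma dual_apply_self [DecidableEq ι] (i j : ι) : h.dual i (t j) = if j = i then 1 else 0 := by
  simp [dual, ← h.basis_apply, Finsupp.single_apply]

/-- The chain rule: `d f = ∑ ∂_i f d t_i`, to which the linear form of `v` on the differentials is
applied. -/
lemma apply_eq [Fintype ι] {M : Type*} [AddCommGroup M] [Module R M] [Module k M]
    [IsScalarTower k R M] (v : Derivation k R M) (f : R) : v f = ∑ i, h.dual i f • v (t i) := by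
  have := congrArg v.liftKaehlerDifferential (h.basis.sum_repr (KaehlerDifferential.D k R f))
  rw [v.liftKaehlerDifferential_comp_D] at this
  rw [← this, map_sum]
  refine Finset.sum_congr rfl fun i _ => ?_
  rw [map_smul, h.basis_apply, v.liftKaehlerDifferential_comp_D]
  rfl

lemma derivation_ext [Fintype ι] {M : Type*} [AddCommGroup M] [Module R M] [Module k M]
    [IsScalarTower k R M] {v w : Derivation k R M} (hvw : ∀ i, v (t i) = w (t i)) : v = w := by
  ext f
  rw [h.apply_eq v, h.apply_eq w]
  exact Finset.sum_congr rfl fun i _ => by rw [hvw]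

lemma exists_derivation {M : Type*} [AddCommGroup M] [Module R M] [Module k M]
    [IsScalarTower k R M] (a : ι → M) : ∃ v : Derivation k R M, ∀ i, v (t i) = a i := by
  refine ⟨(h.basis.constr k a).compDer (KaehlerDifferential.D k R), fun i => ?_⟩
  have : h.basis.constr k a (KaehlerDifferential.D k R (t i)) = a i := by
    rw [← h.basis_apply, Module.Basis.constr_basis]
  simpa using this

/-- A derivation is the family of its values at the members of a differential basis. -/
def derivationEquiv [Fintype ι] (A : Type*) [CommRing A] [Algebra k A] [Algebra R A]
    [IsScalarTower k R A] : Derivation k R A ≃ₗ[A] (ι → A) :=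
  LinearEquiv.ofBijective
    { toFun := fun v i => v (t i)
      map_add' := fun _ _ => rfl
      map_smul' := fun _ _ => rfl }
    ⟨fun _ _ hvw => h.derivation_ext fun i => congrFun hvw i,
      fun a => (h.exists_derivation a).imp fun _ hv => funext hv⟩

end IsDifferentialBasis

/-- A derivation with values in a quotient that kills generators of the ideal factors through
the quotient. -/
lemma exists_derivation_quotient {k R σ : Type*} [CommRing k] [CommRing R] [Algebra k R] (F : σ → R)
    (w : Derivation k R (R ⧸ Ideal.span (Set.range F))) (hw : ∀ s, w (F s) = 0) :
    ∃ v : Derivation k (R ⧸ Ideal.span (Set.range F)) (R ⧸ Ideal.span (Set.range F)),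
      ∀ f, v (Ideal.Quotient.mk _ f) = w f := by
  -- Multiples of the generators are killed as well, because the ideal acts as zero on the values of
  -- `w`.
  have hI : ∀ f ∈ Ideal.span (Set.range F), w f = 0 := fun f hf => by
    induction hf using Submodule.span_induction with
    | mem x hx => obtain ⟨s, rfl⟩ := hx; exact hw s
    | zero => exact map_zero w
    | add x y _ _ hx hy => rw [map_add, hx, hy, add_zero]
    | smul a x hx hx0 =>
      rw [smul_eq_mul, w.leibniz, hx0, smul_zero, zero_add, Algebra.smul_def,
        Ideal.Quotient.algebraMap_eq, Ideal.Quotient.eq_zero_iff_mem.mpr hx, zero_mul]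
  let l : (R ⧸ Ideal.span (Set.range F)) →ₗ[k] (R ⧸ Ideal.span (Set.range F)) :=
    { toFun := Quotient.lift (s := Submodule.quotientRel _) w fun a b hab => by
        have := hI _ ((Submodule.quotientRel_def _).mp hab)
        rwa [map_sub, sub_eq_zero] at this
      map_add' := fun a b => by
        obtain ⟨a, rfl⟩ := Ideal.Quotient.mk_surjective a
        obtain ⟨b, rfl⟩ := Ideal.Quotient.mk_surjective b
        exact w.map_add a b
      map_smul' := fun c a => by
        obtain ⟨a, rfl⟩ := Ideal.Quotient.mk_surjective a
        exact w.map_smul c a }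
  refine ⟨Derivation.mk' l fun a b => ?_, fun f => rfl⟩
  obtain ⟨a, rfl⟩ := Ideal.Quotient.mk_surjective a
  obtain ⟨b, rfl⟩ := Ideal.Quotient.mk_surjective b
  exact w.leibniz a b

end DifferentialBasis

/-! ## The critical ideal of a subscheme of a product -/

section Critical

variable {k R B : Type*} [CommRing k] [CommRing R] [Algebra k R] [CommRing B] [Algebra k B]
  [Algebra B R] [IsScalarTower k B R] {ν τ σ μ : Type*} [Fintype ν] [Fintype τ] [Fintype σ]
  [Fintype μ] [DecidableEq σ] [DecidableEq μ]

/-- Matrices that are inverse to each other, as a linear equivalence. -/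
def mulVecEquiv {A ρ τ : Type*} [CommRing A] [Fintype ρ] [Fintype τ] [DecidableEq ρ]
    [DecidableEq τ] (G : Matrix ρ τ A) (G' : Matrix τ ρ A) (h₁ : G * G' = 1) (h₂ : G' * G = 1) :
    (τ → A) ≃ₗ[A] (ρ → A) :=
  LinearEquiv.ofLinearMap G.mulVecLin G'.mulVecLin
    (by rw [← Matrix.mulVecLin_mul, h₁, Matrix.mulVecLin_one])
    (by rw [← Matrix.mulVecLin_mul, h₂, Matrix.mulVecLin_one])

/-- Coordinates on the derivations of the quotient `A` of `R` by the ideal `(F_s)`. If `x, y` are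
differential coordinates of `R` and the `F_s` are part of a system of linear coordinates of the
`y`-space, then a derivation `v` is determined by the `v (x_l)` and the remaining coordinates of the
`v (y_j)`, and these are arbitrary. -/
theorem exists_quotient_derivation_equiv [DecidableEq τ] {x : ν → R} {y : τ → R}
    (h : IsDifferentialBasis k R (Sum.elim x y)) (F : σ → R)
    (G : Matrix (σ ⊕ μ) τ (R ⧸ Ideal.span (Set.range F)))
    (G' : Matrix τ (σ ⊕ μ) (R ⧸ Ideal.span (Set.range F))) (h₁ : G * G' = 1) (h₂ : G' * G = 1)
    (hG : ∀ s j, G (Sum.inl s) j = Ideal.Quotient.mk _ (h.dual (Sum.inr j) (F s))) :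
    ∃ e : Derivation k (R ⧸ Ideal.span (Set.range F)) (R ⧸ Ideal.span (Set.range F))
        ≃ₗ[R ⧸ Ideal.span (Set.range F)] (ν ⊕ μ → R ⧸ Ideal.span (Set.range F)),
      (∀ v l, e v (Sum.inl l) = v (Ideal.Quotient.mk _ (x l))) ∧
      (∀ v j, e v (Sum.inr j) = G.mulVec (fun j => v (Ideal.Quotient.mk _ (y j))) (Sum.inr j)) ∧
      ∀ v s, G.mulVec (fun j => v (Ideal.Quotient.mk _ (y j))) (Sum.inl s) =
        ∑ l, -Ideal.Quotient.mk _ (h.dual (Sum.inl l) (F s)) * e v (Sum.inl l) := by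
  let A := R ⧸ Ideal.span (Set.range F)
  let mk := Ideal.Quotient.mk (Ideal.span (Set.range F))
  -- The chain rule for `F s`; by `hG` the `y` part is a coordinate of `G` applied to the values at
  -- `y`.
  have hw : ∀ (w : Derivation k R A) s, w (F s) = ∑ l, mk (h.dual (Sum.inl l) (F s)) * w (x l) +
      G.mulVec (fun j => w (y j)) (Sum.inl s) := fun w s => by
    rw [h.apply_eq w, Fintype.sum_sum_type]
    simp only [Algebra.smul_def, Matrix.mulVec, dotProduct, hG]
    rfl
  -- A derivation of the quotient kills `F s`; solving this for the `y` part expresses the first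
  -- coordinates through the values at `x`.
  have hF : ∀ (v : Derivation k A A) s, G.mulVec (fun j => v (mk (y j))) (Sum.inl s) =
      ∑ l, -mk (h.dual (Sum.inl l) (F s)) * v (mk (x l)) := fun v s => by
    have := hw (v.compAlgebraMap R) s
    have h0 : v.compAlgebraMap R (F s) = 0 := by
      have : mk (F s) = 0 := Ideal.Quotient.eq_zero_iff_mem.mpr (Ideal.subset_span ⟨s, rfl⟩)
      change v (mk (F s)) = 0
      rw [this, map_zero]
    rw [h0] at this
    simp only [neg_mul, Finset.sum_neg_distrib]
    exact (neg_eq_of_add_eq_zero_right this.symm).symm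
  let e₀ : Derivation k A A →ₗ[A] (ν ⊕ μ → A) :=
    { toFun := fun v => Sum.elim (fun l => v (mk (x l)))
        fun j => G.mulVec (fun j => v (mk (y j))) (Sum.inr j)
      map_add' := fun v w => by
        ext (l | j)
        · rfl
        · exact congrFun (G.mulVec_add (fun j => v (mk (y j))) fun j => w (mk (y j))) (Sum.inr j)
      map_smul' := fun c v => by
        ext (l | j)
        · rfl
        · exact congrFun (G.mulVec_smul c fun j => v (mk (y j))) (Sum.inr j) }
  have hinj : Function.Injective e₀ := by
    rw [injective_iff_map_eq_zero]
    intro v hv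
    have hx : ∀ l, v (mk (x l)) = 0 := fun l => congrFun hv (Sum.inl l)
    have hy : (fun j => v (mk (y j))) = 0 := by
      have hGv : G.mulVec (fun j => v (mk (y j))) = 0 := by
        ext (s | j)
        · rw [hF]
          simp [hx]
        · exact congrFun hv (Sum.inr j)
      rw [← Matrix.one_mulVec fun j => v (mk (y j)), ← h₂, ← Matrix.mulVec_mulVec, hGv,
        Matrix.mulVec_zero]
    have h0 : v.compAlgebraMap R = 0 := h.derivation_ext fun i => by
      rcases i with l | j
      · exact hx l
      · exact congrFun hy j
    ext a
    obtain ⟨a, rfl⟩ := Ideal.Quotient.mk_surjective a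
    exact Derivation.congr_fun h0 a
  -- The values at `y` are prescribed by `G'` so that the equations for the `F s` hold; the
  -- resulting derivation of `R` descends.
  have hsurj : Function.Surjective e₀ := fun a => by
    let b : τ → A := G'.mulVec (Sum.elim
      (fun s => ∑ l, -mk (h.dual (Sum.inl l) (F s)) * a (Sum.inl l)) fun j => a (Sum.inr j))
    have hb : G.mulVec b = Sum.elim
      (fun s => ∑ l, -mk (h.dual (Sum.inl l) (F s)) * a (Sum.inl l)) fun j => a (Sum.inr j) := by
      rw [Matrix.mulVec_mulVec, h₁, Matrix.one_mulVec]
    obtain ⟨w, hwa⟩ := h.exists_derivation (Sum.elim (fun l => a (Sum.inl l)) b)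
    have hwx : ∀ l, w (x l) = a (Sum.inl l) := fun l => hwa (Sum.inl l)
    have hwy : ∀ j, w (y j) = b j := fun j => hwa (Sum.inr j)
    obtain ⟨v, hv⟩ := exists_derivation_quotient F w fun s => by
      rw [hw]
      simp only [hwx, hwy]
      rw [hb]
      simp
    refine ⟨v, ?_⟩
    ext (l | j)
    · exact (hv _).trans (hwx l)
    · change G.mulVec (fun j => v (mk (y j))) (Sum.inr j) = _
      have : (fun j => v (mk (y j))) = b := funext fun j => (hv _).trans (hwy j)
      rw [this, hb]
      rfl
  exact ⟨LinearEquiv.ofBijective e₀ ⟨hinj, hsurj⟩, fun v l => rfl, fun v j => rfl, hF⟩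

variable {y : τ → B} {x : ν → R}

/-- The critical ideal of a hypersurface. -/
theorem criticalIdeal_hypersurface [Nonempty ν] [DecidableEq ν] [DecidableEq τ]
    (h : IsDifferentialBasis k R (Sum.elim x (algebraMap B R ∘ y)))
    (hB : IsDifferentialBasis k B y) (F : Unit → R) [Nontrivial (R ⧸ Ideal.span (Set.range F))]
    (G : Matrix (Unit ⊕ μ) τ (R ⧸ Ideal.span (Set.range F)))
    (G' : Matrix τ (Unit ⊕ μ) (R ⧸ Ideal.span (Set.range F))) (h₁ : G * G' = 1) (h₂ : G' * G = 1)
    (hG : ∀ s j, G (Sum.inl s) j = Ideal.Quotient.mk _ (h.dual (Sum.inr j) (F s))) :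
    criticalIdeal k B (R ⧸ Ideal.span (Set.range F)) =
      Ideal.span (Set.range fun l => Ideal.Quotient.mk _ (h.dual (Sum.inl l) (F ()))) := by
  obtain ⟨e, he₁, he₂, he₃⟩ := exists_quotient_derivation_equiv h F G G' h₁ h₂ hG
  -- With the coordinates `G · v (y)` on the derivations of `B`, the restriction map has the block
  -- form `c ⊕ id`.
  rw [criticalIdeal, degeneracyIdeal_eq_span_range e
    ((hB.derivationEquiv _).trans (mulVecEquiv G G' h₁ h₂)) _
    (fun l => -Ideal.Quotient.mk _ (h.dual (Sum.inl l) (F ()))) (fun v => he₃ v ())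
    fun v j => (he₂ v j).symm]
  apply le_antisymm <;> refine Ideal.span_le.mpr ?_ <;> rintro _ ⟨l, rfl⟩
  · exact neg_mem (Ideal.subset_span ⟨l, rfl⟩)
  · rw [SetLike.mem_coe, ← neg_mem_iff]
    exact (Ideal.subset_span ⟨l, rfl⟩)

/-- The critical ideal of the critical subscheme of a hypersurface. -/
theorem criticalIdeal_critical [DecidableEq ν] [DecidableEq τ]
    (h : IsDifferentialBasis k R (Sum.elim x (algebraMap B R ∘ y)))
    (hB : IsDifferentialBasis k B y) (F : Option ν → R)
    [Nontrivial (R ⧸ Ideal.span (Set.range F))]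
    (hF : ∀ l, F (some l) = h.dual (Sum.inl l) (F none))
    (G : Matrix (Option ν ⊕ μ) τ (R ⧸ Ideal.span (Set.range F)))
    (G' : Matrix τ (Option ν ⊕ μ) (R ⧸ Ideal.span (Set.range F)))
    (h₁ : G * G' = 1) (h₂ : G' * G = 1)
    (hG : ∀ s j, G (Sum.inl s) j = Ideal.Quotient.mk _ (h.dual (Sum.inr j) (F s))) :
    criticalIdeal k B (R ⧸ Ideal.span (Set.range F)) = Ideal.span {Matrix.det (Matrix.of fun i j =>
      Ideal.Quotient.mk (Ideal.span (Set.range F))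
        (h.dual (Sum.inl j) (h.dual (Sum.inl i) (F none))))} := by
  obtain ⟨e, he₁, he₂, he₃⟩ := exists_quotient_derivation_equiv h F G G' h₁ h₂ hG
  -- The same coordinates on the target; the row of `F none` consists of the first derivatives,
  -- which are zero in the quotient, and the rows of the `F (some i)` form minus the Hessian.
  rw [criticalIdeal, degeneracyIdeal_eq_span_det e
    ((hB.derivationEquiv _).trans (mulVecEquiv G G' h₁ h₂)) _
    (-Matrix.of fun i j => Ideal.Quotient.mk (Ideal.span (Set.range F))
        (h.dual (Sum.inl j) (h.dual (Sum.inl i) (F none)))) (fun v => ?_) (fun v i => ?_)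
    fun v j => (he₂ v j).symm, Matrix.det_neg]
  · exact Ideal.span_singleton_mul_left_unit ((isUnit_one.neg).pow _) _
  · refine (he₃ v none).trans (Finset.sum_eq_zero fun l _ => ?_)
    have : Ideal.Quotient.mk (Ideal.span (Set.range F)) (F (some l)) = 0 :=
      Ideal.Quotient.eq_zero_iff_mem.mpr (Ideal.subset_span ⟨some l, rfl⟩)
    rw [← hF, this, neg_zero, zero_mul]
  · refine (he₃ v (some i)).trans (Finset.sum_congr rfl fun l _ => ?_)
    rw [hF]
    rfl

end Critical

/-! ## Construction of differential bases -/

section Construction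

open TensorProduct

lemma derivation_sum_apply {S A ι : Type*} [CommRing S] [CommRing A] [Algebra S A] [Fintype ι]
    (c : ι → A) (D : ι → Derivation S A A) (f : A) :
    (∑ i, c i • D i) f = ∑ i, c i * D i f := by
  rw [← Derivation.coeFnAddMonoidHom_apply, map_sum, Finset.sum_apply]
  rfl

namespace IsDifferentialBasis

lemma of_basis {k R ι : Type*} [CommRing k] [CommRing R] [Algebra k R] {t : ι → R}
    (b : Module.Basis ι R (Ω[R⁄k])) (hb : ∀ i, b i = KaehlerDifferential.D k R (t i)) :
    IsDifferentialBasis k R t := by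
  have : (fun i => KaehlerDifferential.D k R (t i)) = b := funext fun i => (hb i).symm
  exact ⟨this ▸ b.linearIndependent, this ▸ b.span_eq.ge⟩

lemma mvPolynomial_X (k : Type*) [CommRing k] (τ : Type*) :
    IsDifferentialBasis k (MvPolynomial τ k) (MvPolynomial.X : τ → MvPolynomial τ k) :=
  of_basis (KaehlerDifferential.mvPolynomialBasis k τ) fun i =>
    KaehlerDifferential.mvPolynomialBasis_apply k τ i

/-- The module of differentials of a formally étale extension is obtained by base change. -/
lemma of_formallyEtale {k R ι : Type*} [CommRing k] [CommRing R] [Algebra k R] {t : ι → R}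
    (h : IsDifferentialBasis k R t) (T : Type*) [CommRing T] [Algebra k T] [Algebra R T]
    [IsScalarTower k R T] [Algebra.FormallyEtale R T] :
    IsDifferentialBasis k T (algebraMap R T ∘ t) :=
  of_basis ((h.basis.baseChange T).map
    (KaehlerDifferential.tensorKaehlerEquivOfFormallyEtale k R T)) fun i => by
      simp [h.basis_apply]

/-- Differential bases in a tower `R → S → T` with `T` formally smooth over `S`. -/
lemma sum {R S T ι κ : Type*} [CommRing R] [CommRing S] [CommRing T] [Algebra R S] [Algebra S T]
    [Algebra R T] [IsScalarTower R S T] [Algebra.FormallySmooth S T] [Finite ι] [Finite κ]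
    {x : ι → S} {y : κ → T} (hx : IsDifferentialBasis R S x) (hy : IsDifferentialBasis S T y) :
    IsDifferentialBasis R T (Sum.elim (algebraMap S T ∘ x) y) := by
  cases nonempty_fintype ι
  cases nonempty_fintype κ
  -- Formal smoothness makes the first cotangent homology of `T` over `S` vanish, so the sequence of
  -- differentials is exact on the left too.
  have hinj : Function.Injective (KaehlerDifferential.mapBaseChange R S T) := by
    rw [injective_iff_map_eq_zero]
    intro z hz
    obtain ⟨z, rfl⟩ := (Algebra.H1Cotangent.exact_δ_mapBaseChange R S T z).mp hz
    rw [Subsingleton.elim z 0, map_zero]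
  have hbc : ∀ i, KaehlerDifferential.mapBaseChange R S T ((hx.basis.baseChange T) i) =
      KaehlerDifferential.D R T (algebraMap S T (x i)) := fun i => by simp [hx.basis_apply]
  constructor
  · rw [Fintype.linearIndependent_iff]
    intro g hg
    rw [Fintype.sum_sum_type] at hg
    have hr : ∀ j, g (Sum.inr j) = 0 := by
      have := congrArg (KaehlerDifferential.map R S T T) hg
      simp only [map_add, map_sum, map_smul, map_zero, Sum.elim_inl, Sum.elim_inr,
        Function.comp_apply, KaehlerDifferential.map_D, Algebra.algebraMap_self, RingHom.id_apply,
        Derivation.map_algebraMap, smul_zero, Finset.sum_const_zero, zero_add] at this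
      exact Fintype.linearIndependent_iff.mp hy.linearIndependent _ this
    have hl : ∀ i, g (Sum.inl i) = 0 := by
      simp only [hr, zero_smul, Finset.sum_const_zero, add_zero, Sum.elim_inl,
        Function.comp_apply, ← hbc] at hg
      simp only [← map_smul, ← map_sum] at hg
      exact Fintype.linearIndependent_iff.mp (hx.basis.baseChange T).linearIndependent _
        ((injective_iff_map_eq_zero _).mp hinj _ hg)
    rintro (i | j)
    exacts [hl i, hr j]
  · intro w _
    let c := hy.basis.repr (KaehlerDifferential.map R S T T w)
    have hker : KaehlerDifferential.map R S T T
        (w - ∑ j, c j • KaehlerDifferential.D R T (y j)) = 0 := by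
      rw [map_sub, map_sum, sub_eq_zero]
      conv_lhs => rw [← hy.basis.sum_repr (KaehlerDifferential.map R S T T w)]
      refine Finset.sum_congr rfl fun j _ => ?_
      rw [map_smul, KaehlerDifferential.map_D, hy.basis_apply]
      rfl
    obtain ⟨z, hz⟩ := (KaehlerDifferential.exact_mapBaseChange_map R S T _).mp hker
    have hz' : KaehlerDifferential.mapBaseChange R S T z ∈ Submodule.span T (Set.range fun i =>
        KaehlerDifferential.D R T (Sum.elim (algebraMap S T ∘ x) y i)) := by
      rw [← (hx.basis.baseChange T).sum_repr z, map_sum]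
      refine Submodule.sum_mem _ fun i _ => ?_
      rw [map_smul, hbc]
      exact Submodule.smul_mem _ _ (Submodule.subset_span ⟨Sum.inl i, rfl⟩)
    rw [← sub_add_cancel w (∑ j, c j • KaehlerDifferential.D R T (y j)), ← hz]
    refine add_mem hz' (Submodule.sum_mem _ fun j _ => ?_)
    exact Submodule.smul_mem _ _ (Submodule.subset_span ⟨Sum.inr j, rfl⟩)

section Relative

variable {k R B ν τ : Type*} [CommRing k] [CommRing R] [Algebra k R] [CommRing B] [Algebra k B]
  [Algebra B R] [IsScalarTower k B R] [Fintype τ] {x : ν → R} {y : τ → B}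
  (h : IsDifferentialBasis k R (Sum.elim x (algebraMap B R ∘ y)))
  (hB : IsDifferentialBasis k B y)

-- The derivation kills the differential basis `y` of `B`, hence all of `B`. This makes it linear
-- over `B`.
include hB in
lemma dual_algebraMap_eq_zero (l : ν) (b : B) : h.dual (Sum.inl l) (algebraMap B R b) = 0 := by
  classical
  have : (h.dual (Sum.inl l)).compAlgebraMap B = 0 := hB.derivation_ext fun j => by
    change h.dual (Sum.inl l) (Sum.elim x (algebraMap B R ∘ y) (Sum.inr j)) = 0
    rw [h.dual_apply_self, if_neg (by simp)]
  exact Derivation.congr_fun this b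

/-- The derivations over the second factor dual to the differentials of the first factor. -/
def relDual (l : ν) : Derivation B R R where
  toFun := h.dual (Sum.inl l)
  map_add' := map_add _
  map_smul' b f := by
    rw [Algebra.smul_def, Derivation.leibniz, dual_algebraMap_eq_zero h hB, smul_zero, add_zero]
    simp [Algebra.smul_def]
  map_one_eq_zero' := Derivation.map_one_eq_zero _
  leibniz' := Derivation.leibniz _

lemma relDual_apply (l : ν) (f : R) : h.relDual hB l f = h.dual (Sum.inl l) f := rfl

/-- A derivation over `B` kills the `y`, so only the `x` terms of the chain rule remain. -/
lemma relative_apply_eq [Fintype ν] (v : Derivation B R R) : v = ∑ l, v (x l) • h.relDual hB l := by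
  ext f
  have := h.apply_eq (v.restrictScalars k) f
  rw [Derivation.restrictScalars_apply, Fintype.sum_sum_type] at this
  rw [this, derivation_sum_apply]
  have h0 : ∀ j, (v.restrictScalars k) (Sum.elim x (algebraMap B R ∘ y) (Sum.inr j)) = 0 :=
    fun j => v.map_algebraMap _
  simp only [h0, smul_zero, Finset.sum_const_zero, add_zero]
  refine Finset.sum_congr rfl fun l _ => ?_
  rw [relDual_apply, smul_eq_mul, mul_comm]
  rfl

/-- The basis of the derivations over the second factor. -/
def relBasis [Fintype ν] : Module.Basis ν R (Derivation B R R) :=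
  Module.Basis.mk (v := h.relDual hB)
    (by
      classical
      rw [Fintype.linearIndependent_iff]
      intro g hg l
      have := Derivation.congr_fun hg (x l)
      rw [derivation_sum_apply] at this
      have hd : ∀ i, h.relDual hB i (x l) = if l = i then 1 else 0 := fun i => by
        have := h.dual_apply_self (Sum.inl i) (Sum.inl l)
        rw [relDual_apply]
        simpa using this
      simpa [hd] using this)
    fun v _ => by
      rw [h.relative_apply_eq hB v]
      exact Submodule.sum_mem _ fun l _ => Submodule.smul_mem _ _ (Submodule.subset_span ⟨l, rfl⟩)

lemma relBasis_apply [Fintype ν] (l : ν) (f : R) : h.relBasis hB l f = h.dual (Sum.inl l) f := by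
  rw [relBasis, Module.Basis.mk_apply, relDual_apply]

end Relative

end IsDifferentialBasis

end Construction

/-! ## Hessians -/

section Hessian

variable {n : ℕ} {S A : Type*} [CommRing S] [CommRing A] [Algebra S A]

/-- In characteristic two the square of a derivation is a derivation. -/
def derivationSq (h2 : (2 : A) = 0) (D : Derivation S A A) : Derivation S A A :=
  Derivation.mk' (D.toLinearMap.comp D.toLinearMap) fun a b => by
    change D (D (a * b)) = a • D (D b) + b • D (D a)
    simp only [D.leibniz, map_add, smul_eq_mul]
    -- The mixed term of `D (D (a b))` is `2 D a D b`.
    linear_combination (D a * D b) * h2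

/-- The matrix of second derivatives modulo an ideal. -/
def hessianMod (I : Ideal A) (D : Fin n → Derivation S A A) (Φ : A) :
    Matrix (Fin n) (Fin n) (A ⧸ I) :=
  Matrix.of fun i j => Ideal.Quotient.mk I (D i (D j Φ))

/-- The difference of the two entries is the value of the derivation `⁅D i, D j⁆` at `Φ`. -/
lemma hessianMod_symm {I : Ideal A} (D : Fin n → Derivation S A A) {Φ : A}
    (hE : ∀ E : Derivation S A A, E Φ ∈ I) (i j : Fin n) :
    hessianMod I D Φ i j = hessianMod I D Φ j i := by
  refine Ideal.Quotient.eq.mpr ?_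
  have := hE ⁅D i, D j⁆
  rwa [Derivation.commutator_apply] at this

/-- A diagonal entry is the value at `Φ` of the derivation `D i ∘ D i`. -/
lemma hessianMod_diag (h2 : (2 : A) = 0) {I : Ideal A} (D : Fin n → Derivation S A A) {Φ : A}
    (hE : ∀ E : Derivation S A A, E Φ ∈ I) (i : Fin n) : hessianMod I D Φ i i = 0 :=
  Ideal.Quotient.eq_zero_iff_mem.mpr (hE (derivationSq h2 (D i)))

/-- Modulo an ideal that contains `Φ` and all its first derivatives, the Hessian is a bilinear form
with values in the line bundle: the terms with derivatives of `u` or of `C` drop out and the matrix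
becomes `u C H Cᵀ`. -/
lemma pfaffian_hessianMod_change (h2 : (2 : A) = 0) (hn : Even n) {I : Ideal A}
    (D D' : Fin n → Derivation S A A) (C : Matrix (Fin n) (Fin n) A)
    (hC : ∀ i, D' i = ∑ j, C i j • D j) {Φ : A} (u : A) (hΦ : Φ ∈ I)
    (hE : ∀ E : Derivation S A A, E Φ ∈ I) :
    pfaffian n (hessianMod I D' (u * Φ)) =
      Ideal.Quotient.mk I (u ^ (n / 2) * C.det) * pfaffian n (hessianMod I D Φ) := by
  have hmat : hessianMod I D' (u * Φ) = Ideal.Quotient.mk I u •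
      (C.map (Ideal.Quotient.mk I) * hessianMod I D Φ * (C.map (Ideal.Quotient.mk I)).transpose) := by
    ext i j
    have h1 : Ideal.Quotient.mk I (D' i (D' j (u * Φ))) =
        Ideal.Quotient.mk I u * Ideal.Quotient.mk I (D' i (D' j Φ)) := by
      rw [← map_mul, Ideal.Quotient.eq, Derivation.leibniz]
      simp only [map_add, smul_eq_mul, Derivation.leibniz, add_sub_assoc]
      have e : u * (D' i) ((D' j) Φ) + (D' j) Φ * (D' i) u + (Φ * (D' i) ((D' j) u) +
        ((D' j) u * (D' i) Φ - u * (D' i) ((D' j) Φ))) = (D' i) u * (D' j) Φ +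
        (D' i) ((D' j) u) * Φ + (D' j) u * (D' i) Φ := by ring
      rw [e]
      exact I.add_mem (I.add_mem (I.mul_mem_left _ (hE _)) (I.mul_mem_left _ hΦ))
        (I.mul_mem_left _ (hE _))
    have hap : ∀ i f, D' i f = ∑ j, C i j * D j f := fun i f => by
      rw [hC, derivation_sum_apply]
    have h3 : Ideal.Quotient.mk I (D' i (D' j Φ)) = Ideal.Quotient.mk I
        (∑ b, (∑ a, C i a * D a (D b Φ)) * C j b) := by
      rw [Ideal.Quotient.eq, hap j, map_sum, ← Finset.sum_sub_distrib]
      refine Ideal.sum_mem _ fun b _ => ?_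
      rw [Derivation.leibniz, ← hap, smul_eq_mul, smul_eq_mul]
      have : C j b * (D' i) ((D b) Φ) + (D b) Φ * (D' i) (C j b) - (D' i) ((D b) Φ) * C j b =
        (D' i) (C j b) * D b Φ := by ring
      rw [this]
      exact I.mul_mem_left _ (hE _)
    rw [hessianMod, Matrix.of_apply, h1, h3]
    simp [Matrix.mul_apply, hessianMod]
  have h2' : (2 : A ⧸ I) = 0 := by
    have := congrArg (Ideal.Quotient.mk I) h2
    rwa [map_ofNat, map_zero] at this
  rw [hmat, pfaffian_smul, pfaffian_mul_mul_transpose h2' hn _ _ (hessianMod_symm D hE)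
    (hessianMod_diag h2 D hE), ← RingHom.mapMatrix_apply, ← RingHom.map_det, map_mul, map_pow,
    mul_assoc]

/-- A change of the frame and of the equation changes the Pfaffian of the Hessian by a unit. -/
lemma associated_pfaffian_hessianMod (h2 : (2 : A) = 0) (hn : Even n) {I : Ideal A}
    (b b' : Module.Basis (Fin n) A (Derivation S A A)) {Φ u : A} (hu : IsUnit u) (hΦ : Φ ∈ I)
    (hE : ∀ E : Derivation S A A, E Φ ∈ I) :
    Associated (pfaffian n (hessianMod I b Φ)) (pfaffian n (hessianMod I b' (u * Φ))) := by
  let C : Matrix (Fin n) (Fin n) A := (b.toMatrix b').transpose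
  have hC : ∀ i, b' i = ∑ j, C i j • b j := fun i => (b.sum_repr (b' i)).symm
  have hdet : IsUnit C.det := by
    rw [Matrix.det_transpose]
    exact (Matrix.isUnit_iff_isUnit_det _).mp
      (IsUnit.of_mul_eq_one _ (b.toMatrix_mul_toMatrix_flip b'))
  obtain ⟨w, hw⟩ := ((hu.pow (n / 2)).mul hdet).map (Ideal.Quotient.mk I)
  refine ⟨w, ?_⟩
  rw [pfaffian_hessianMod_change h2 hn b b' C hC u hΦ hE, hw, mul_comm]

/-- The ideal generated by a function, its first derivatives and the Pfaffian of its second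
derivatives. -/
def hessianIdeal (D : Fin n → Derivation S A A) (Φ : A) : Ideal A :=
  Ideal.span ({Φ} ∪ Set.range (fun i => D i Φ) ∪
    {pfaffian n (Matrix.of fun i j => D i (D j Φ))})

/-- The ideal generated by a function and its first derivatives. -/
def jacobianIdeal (D : Fin n → Derivation S A A) (Φ : A) : Ideal A :=
  Ideal.span ({Φ} ∪ Set.range fun i => D i Φ)

lemma self_mem_jacobianIdeal (D : Fin n → Derivation S A A) (Φ : A) : Φ ∈ jacobianIdeal D Φ :=
  Ideal.subset_span (Or.inl rfl)

lemma derivation_mem_jacobianIdeal (b : Module.Basis (Fin n) A (Derivation S A A)) (Φ : A)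
    (E : Derivation S A A) : E Φ ∈ jacobianIdeal b Φ := by
  rw [← b.sum_repr E, derivation_sum_apply]
  exact Ideal.sum_mem _ fun i _ => Ideal.mul_mem_left _ _ (Ideal.subset_span (Or.inr ⟨i, rfl⟩))

lemma jacobianIdeal_le (b b' : Module.Basis (Fin n) A (Derivation S A A)) (Φ u : A) :
    jacobianIdeal b' (u * Φ) ≤ jacobianIdeal b Φ := by
  refine Ideal.span_le.mpr ?_
  rintro _ (rfl | ⟨i, rfl⟩)
  · exact Ideal.mul_mem_left _ _ (self_mem_jacobianIdeal _ _)
  · simp only [Derivation.leibniz, smul_eq_mul, SetLike.mem_coe]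
    exact Ideal.add_mem _ (Ideal.mul_mem_left _ _ (derivation_mem_jacobianIdeal b Φ _))
      (Ideal.mul_mem_right _ _ (self_mem_jacobianIdeal _ _))

lemma jacobianIdeal_eq (b b' : Module.Basis (Fin n) A (Derivation S A A)) (Φ : A) {u : A}
    (hu : IsUnit u) : jacobianIdeal b' (u * Φ) = jacobianIdeal b Φ := by
  refine le_antisymm (jacobianIdeal_le b b' Φ u) ?_
  obtain ⟨w, hw⟩ := hu.exists_left_inv
  have := jacobianIdeal_le b' b (u * Φ) w
  rwa [← mul_assoc, hw, one_mul] at this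

/-- Modulo the Jacobian ideal the Pfaffian is well defined up to a unit; this expresses the whole
ideal through it. -/
lemma hessianIdeal_eq_comap (D : Fin n → Derivation S A A) (Φ : A) {I : Ideal A}
    (hI : jacobianIdeal D Φ = I) :
    hessianIdeal D Φ = (Ideal.span {pfaffian n (hessianMod I D Φ)}).comap
      (Ideal.Quotient.mk I) := by
  have : pfaffian n (hessianMod I D Φ) =
      Ideal.Quotient.mk I (pfaffian n (Matrix.of fun i j => D i (D j Φ))) := by
    rw [map_pfaffian]
    rfl
  rw [this, ← Set.image_singleton, ← Ideal.map_span, Ideal.comap_map_of_surjective _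
    Ideal.Quotient.mk_surjective, ← RingHom.ker_eq_comap_bot, Ideal.mk_ker, hessianIdeal,
    Ideal.span_union, ← hI, jacobianIdeal, sup_comm]

/-- The ideal does not depend on the frame and on the choice of the equation. -/
theorem hessianIdeal_eq (h2 : (2 : A) = 0) (hn : Even n)
    (b b' : Module.Basis (Fin n) A (Derivation S A A)) (Φ : A) {u : A} (hu : IsUnit u) :
    hessianIdeal b' (u * Φ) = hessianIdeal b Φ := by
  rw [hessianIdeal_eq_comap b' _ (jacobianIdeal_eq b b' Φ hu), hessianIdeal_eq_comap b _ rfl]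
  congr 1
  obtain ⟨w, hw⟩ := associated_pfaffian_hessianMod h2 hn b b' hu (self_mem_jacobianIdeal b Φ)
    (derivation_mem_jacobianIdeal b Φ)
  rw [← hw, Ideal.span_singleton_mul_right_unit w.isUnit]

end Hessian

/-! ## Linear equations over a local ring -/

section LinearEquations

/-- Over a local ring, rows that are linearly independent over the residue field can be completed
to an invertible matrix. -/
theorem exists_completion {O ρ τ : Type*} [CommRing O] [IsLocalRing O] [Fintype ρ] [Fintype τ]
    [DecidableEq ρ] [DecidableEq τ] (N : Matrix ρ τ O)
    (hN : LinearIndependent (IsLocalRing.ResidueField O)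
      fun r => (N.map (IsLocalRing.residue O)) r) :
    ∃ (q : ℕ) (G : Matrix (ρ ⊕ Fin q) τ O) (G' : Matrix τ (ρ ⊕ Fin q) O),
      G * G' = 1 ∧ G' * G = 1 ∧ ∀ r j, G (Sum.inl r) j = N r j := by
  classical
  let κ := IsLocalRing.ResidueField O
  -- The rows are extended to a basis over the residue field, and the added rows are lifted
  -- arbitrarily.
  let b₀ := Module.Basis.sumExtend hN
  have : Finite (ρ ⊕ Module.Basis.sumExtendIndex hN) := Module.Finite.finite_basis b₀
  have : Finite (Module.Basis.sumExtendIndex hN) := Finite.sum_right ρ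
  obtain ⟨q, ⟨e⟩⟩ := Finite.exists_equiv_fin (Module.Basis.sumExtendIndex hN)
  let b := b₀.reindex (Equiv.sumCongr (Equiv.refl ρ) e)
  have hb : ∀ r, b (Sum.inl r) = (N.map (IsLocalRing.residue O)) r := fun r => by
    simp only [b, Module.Basis.reindex_apply, Equiv.sumCongr_symm, Equiv.refl_symm,
      Equiv.sumCongr_apply, Sum.map_inl, Equiv.refl_apply, b₀]
    rw [Module.Basis.sumExtend, Module.Basis.reindex_apply, Module.Basis.extend_apply_self]
    rfl
  choose l hl using IsLocalRing.residue_surjective (R := O)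
  let G : Matrix (ρ ⊕ Fin q) τ O := Matrix.of (Sum.elim N fun a j => l (b (Sum.inr a) j))
  have hG : ∀ a, (G.map (IsLocalRing.residue O)) a = b a := by
    rintro (r | a)
    · exact (hb r).symm
    · exact funext fun j => hl _
  -- Both index bases of the same space, so `G` can be made square; its determinant is a unit
  -- because it is nonzero in the residue field.
  let ε : ρ ⊕ Fin q ≃ τ := b.indexEquiv (Pi.basisFun κ τ)
  let Gs : Matrix τ τ O := G.submatrix ε.symm id
  have hdet : IsUnit Gs.det := by
    rw [← isUnit_map_iff (IsLocalRing.residue O), RingHom.map_det, ← Matrix.isUnit_iff_isUnit_det,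
      ← Matrix.linearIndependent_rows_iff_isUnit]
    have : ((IsLocalRing.residue O).mapMatrix Gs).row = b ∘ ε.symm := by
      ext a j
      exact congrFun (hG (ε.symm a)) j
    rw [this]
    exact b.linearIndependent.comp _ ε.symm.injective
  have hGs : G = Gs.submatrix ε id := by ext; simp [Gs]
  refine ⟨q, G, Gs⁻¹.submatrix id ε, ?_, ?_, fun r j => rfl⟩
  · rw [hGs, ← Matrix.submatrix_mul Gs Gs⁻¹ ε id ε Function.bijective_id]
    rw [Matrix.mul_nonsing_inv _ hdet, Matrix.submatrix_one _ ε.injective]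
  · rw [hGs, Matrix.submatrix_mul_equiv Gs⁻¹ Gs id ε id, Matrix.nonsing_inv_mul _ hdet,
      Matrix.submatrix_id_id]

/-- The affine linear polynomials given by the rows of a matrix. -/
def linearPoly {O ρ τ : Type*} [CommRing O] [Fintype τ] (c : ρ → O) (N : Matrix ρ τ O) (r : ρ) :
    MvPolynomial τ O :=
  MvPolynomial.C (c r) + ∑ j, MvPolynomial.C (N r j) * MvPolynomial.X j

/-- An affine linear subspace whose equations can be completed to a coordinate system is integral. -/
theorem isPrime_span_linearPoly {O ρ μ τ : Type*} [CommRing O] [IsDomain O] [Fintype ρ] [Fintype μ]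
    [Fintype τ] [DecidableEq ρ] [DecidableEq μ] [DecidableEq τ] (c : ρ → O) (N : Matrix ρ τ O)
    (G : Matrix (ρ ⊕ μ) τ O) (G' : Matrix τ (ρ ⊕ μ) O) (h₁ : G * G' = 1) (h₂ : G' * G = 1)
    (hG : ∀ r j, G (Sum.inl r) j = N r j) :
    (Ideal.span (Set.range (linearPoly c N))).IsPrime := by
  -- `π` parametrizes the solutions of the linear equations by the added coordinates, and `ψ` writes
  -- these coordinates as linear forms in the old variables.
  let π : MvPolynomial τ O →ₐ[O] MvPolynomial μ O := MvPolynomial.aeval fun j =>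
    ∑ r, MvPolynomial.C (G' j (Sum.inl r)) * -MvPolynomial.C (c r) +
      ∑ a, MvPolynomial.C (G' j (Sum.inr a)) * MvPolynomial.X a
  let ψ : MvPolynomial μ O →ₐ[O] MvPolynomial τ O := MvPolynomial.aeval fun a =>
    ∑ j, MvPolynomial.C (G (Sum.inr a) j) * MvPolynomial.X j
  have e₁ : ∀ a b, ∑ j, G a j * G' j b = if a = b then 1 else 0 := fun a b => by
    rw [← Matrix.mul_apply, h₁, Matrix.one_apply]
  have e₂ : ∀ i j, ∑ a, G' i a * G a j = if i = j then 1 else 0 := fun a b => by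
    rw [← Matrix.mul_apply, h₂, Matrix.one_apply]
  have hπC : ∀ a, π (MvPolynomial.C a) = MvPolynomial.C a := fun a => π.commutes a
  have hψC : ∀ a, ψ (MvPolynomial.C a) = MvPolynomial.C a := fun a => ψ.commutes a
  have hπX : ∀ j, π (MvPolynomial.X j) = ∑ r, MvPolynomial.C (G' j (Sum.inl r)) *
      -MvPolynomial.C (c r) + ∑ a, MvPolynomial.C (G' j (Sum.inr a)) * MvPolynomial.X a :=
    fun j => MvPolynomial.aeval_X _ _
  have hψX : ∀ a, ψ (MvPolynomial.X a) =
      ∑ j, MvPolynomial.C (G (Sum.inr a) j) * MvPolynomial.X j := fun a => MvPolynomial.aeval_X _ _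
  have hπ : ∀ r, π (linearPoly c N r) = 0 := fun r => by
    have h3 : ∀ b, ∑ j, MvPolynomial.C (N r j) * MvPolynomial.C (G' j b) =
        (MvPolynomial.C (if Sum.inl r = b then 1 else 0) : MvPolynomial μ O) := fun b => by
      rw [← e₁ (Sum.inl r) b, map_sum]
      exact Finset.sum_congr rfl fun j _ => by rw [hG, map_mul]
    have : ∑ j, MvPolynomial.C (N r j) * π (MvPolynomial.X j) = -MvPolynomial.C (c r) := by
      simp only [hπX, mul_add, Finset.mul_sum, Finset.sum_add_distrib]
      rw [Finset.sum_comm, Finset.sum_comm (s := Finset.univ (α := τ)) (t := Finset.univ (α := μ))]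
      simp only [← mul_assoc, ← Finset.sum_mul, h3]
      simp
    rw [linearPoly, map_add, map_sum]
    simp only [map_mul, hπC]
    rw [this, add_neg_cancel]
  -- Modulo the equations `ψ` undoes `π`, so the ideal is the kernel of `π`, which maps to a domain.
  have hψπ : ∀ f, f - ψ (π f) ∈ Ideal.span (Set.range (linearPoly c N)) := by
    have hmk : (Ideal.Quotient.mkₐ O (Ideal.span (Set.range (linearPoly c N)))) =
        (Ideal.Quotient.mkₐ O (Ideal.span (Set.range (linearPoly c N)))).comp (ψ.comp π) := by
      refine MvPolynomial.algHom_ext fun j => ?_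
      refine Ideal.Quotient.eq.mpr ?_
      have : MvPolynomial.X j - ψ (π (MvPolynomial.X j)) =
          ∑ r, MvPolynomial.C (G' j (Sum.inl r)) * linearPoly c N r := by
        have h4 : (MvPolynomial.X j : MvPolynomial τ O) =
            ∑ i, (∑ a, MvPolynomial.C (G' j a) * MvPolynomial.C (G a i)) * MvPolynomial.X i := by
          simp only [← map_mul, ← map_sum, e₂]
          simp
        rw [hπX]
        conv_lhs => enter [1]; rw [h4]
        simp only [map_add, map_sum, map_mul, map_neg, hψC, hψX, linearPoly, mul_add,
          Finset.sum_add_distrib, Finset.mul_sum, Finset.sum_mul, Fintype.sum_sum_type, mul_neg,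
          Finset.sum_neg_distrib, ← hG, add_mul]
        rw [Finset.sum_comm, Finset.sum_comm (s := Finset.univ (α := τ)) (t := Finset.univ (α := μ))]
        simp only [mul_assoc]
        ring
      change MvPolynomial.X j - ψ (π (MvPolynomial.X j)) ∈ _
      rw [this]
      exact Ideal.sum_mem _ fun r _ => Ideal.mul_mem_left _ _ (Ideal.subset_span ⟨r, rfl⟩)
    exact fun f => Ideal.Quotient.eq.mp (AlgHom.congr_fun hmk f)
  have hker : Ideal.span (Set.range (linearPoly c N)) = RingHom.ker π := by
    apply le_antisymm
    · refine Ideal.span_le.mpr ?_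
      rintro _ ⟨r, rfl⟩
      exact hπ r
    · intro f hf
      have := hψπ f
      rwa [(RingHom.mem_ker).mp hf, map_zero, sub_zero] at this
  rw [hker]
  exact RingHom.ker_isPrime _

end LinearEquations

set_option linter.unusedSectionVars false

/-! ## Localizations of polynomial rings -/

section PolynomialLocalization

variable (O : Type*) {R τ : Type*} [CommRing O] [CommRing R] [Algebra O R]

/-- `R` is a localization of the polynomial ring over `O` in the variables `y`. -/
def IsPolynomialLocalization (y : τ → R) : Prop :=
  ∃ M : Submonoid (MvPolynomial τ O),
    letI := (MvPolynomial.aeval (R := O) y).toRingHom.toAlgebra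
    IsLocalization M R

namespace IsPolynomialLocalization

variable {O} {y : τ → R} (h : IsPolynomialLocalization O y)
include h

/-- A localization is formally étale, so the differentials of the variables remain a basis. -/
lemma isDifferentialBasis : IsDifferentialBasis O R y := by
  obtain ⟨M, hM⟩ := h
  let _ := (MvPolynomial.aeval (R := O) y).toRingHom.toAlgebra
  have : IsScalarTower O (MvPolynomial τ O) R := .of_algebraMap_eq fun a =>
    ((MvPolynomial.aeval (R := O) y).commutes a).symm
  have : Algebra.FormallyEtale (MvPolynomial τ O) R := .of_isLocalization M
  have := (IsDifferentialBasis.mvPolynomial_X O τ).of_formallyEtale R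
  have e : algebraMap (MvPolynomial τ O) R ∘ MvPolynomial.X = y :=
    funext fun j => MvPolynomial.aeval_X _ _
  rwa [e] at this

lemma formallySmooth : Algebra.FormallySmooth O R := by
  obtain ⟨M, hM⟩ := h
  let _ := (MvPolynomial.aeval (R := O) y).toRingHom.toAlgebra
  have : IsScalarTower O (MvPolynomial τ O) R := .of_algebraMap_eq fun a =>
    ((MvPolynomial.aeval (R := O) y).commutes a).symm
  have : Algebra.FormallyEtale (MvPolynomial τ O) R := .of_isLocalization M
  exact .comp O (MvPolynomial τ O) R

lemma isNoetherianRing [Finite τ] [IsNoetherianRing O] : IsNoetherianRing R := by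
  obtain ⟨M, hM⟩ := h
  let _ := (MvPolynomial.aeval (R := O) y).toRingHom.toAlgebra
  exact IsLocalization.isNoetherianRing M R inferInstance

lemma isPrime_map {I : Ideal (MvPolynomial τ O)} (hI : I.IsPrime)
    (hI' : I.map (MvPolynomial.aeval (R := O) y).toRingHom ≠ ⊤) :
    (I.map (MvPolynomial.aeval (R := O) y).toRingHom).IsPrime := by
  obtain ⟨M, hM⟩ := h
  let _ := (MvPolynomial.aeval (R := O) y).toRingHom.toAlgebra
  refine IsLocalization.isPrime_of_isPrime_disjoint M R I hI ?_
  exact (IsLocalization.map_algebraMap_ne_top_iff_disjoint M R I).mp hI'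

end IsPolynomialLocalization

end PolynomialLocalization

/-! ## The universal family in local coordinates -/

section LocalFamily

variable {k O B R ν τ : Type*} [Field k] [CommRing O] [CommRing B] [CommRing R] [Algebra k O]
  [Algebra k B] [Algebra k R] [Algebra O R] [Algebra B R] [IsScalarTower k O R]
  [IsScalarTower k B R] [Fintype ν] [Fintype τ] {x : ν → O} {y : τ → B}

lemma isDifferentialBasis_sum (hx : IsDifferentialBasis k O x)
    (hloc : IsPolynomialLocalization O (algebraMap B R ∘ y)) :
    IsDifferentialBasis k R (Sum.elim (algebraMap O R ∘ x) (algebraMap B R ∘ y)) := by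
  have := hloc.formallySmooth
  exact hx.sum hloc.isDifferentialBasis

variable (hx : IsDifferentialBasis k O x)
  (h : IsDifferentialBasis k R (Sum.elim (algebraMap O R ∘ x) (algebraMap B R ∘ y)))

/-- This and the next three lemmas identify the dual derivations: those of `x` act on the
coefficients in `O` and kill the `y`, those of `y` are the partial derivatives over `O`. -/
lemma dual_inl_algebraMap (l : ν) (f : O) :
    h.dual (Sum.inl l) (algebraMap O R f) = algebraMap O R (hx.dual l f) := by
  classical
  have : (h.dual (Sum.inl l)).compAlgebraMap O =
      (Algebra.linearMap O R).compDer (hx.dual l) := hx.derivation_ext fun i => by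
    change h.dual (Sum.inl l) (Sum.elim (algebraMap O R ∘ x) (algebraMap B R ∘ y) (Sum.inl i)) =
      algebraMap O R (hx.dual l (x i))
    rw [h.dual_apply_self, hx.dual_apply_self]
    by_cases hil : i = l <;> simp [hil]
  exact Derivation.congr_fun this f

lemma dual_inl_coord (l : ν) (j : τ) : h.dual (Sum.inl l) (algebraMap B R (y j)) = 0 := by
  classical
  exact (h.dual_apply_self (Sum.inl l) (Sum.inr j)).trans (by simp)

include hx in
lemma dual_inr_algebraMap (j : τ) (f : O) : h.dual (Sum.inr j) (algebraMap O R f) = 0 := by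
  classical
  have : (h.dual (Sum.inr j)).compAlgebraMap O = 0 := hx.derivation_ext fun i => by
    change h.dual (Sum.inr j) (Sum.elim (algebraMap O R ∘ x) (algebraMap B R ∘ y) (Sum.inl i)) = 0
    rw [h.dual_apply_self]
    simp
  exact Derivation.congr_fun this f

lemma dual_inr_coord [DecidableEq τ] (i j : τ) :
    h.dual (Sum.inr i) (algebraMap B R (y j)) = if j = i then 1 else 0 := by
  classical
  exact (h.dual_apply_self (Sum.inr i) (Sum.inr j)).trans (by simp)

variable (R y) in
/-- The function `s_0 + ∑ s_j y_j`. -/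
def affineForm (s : Option τ → O) : R :=
  algebraMap O R (s none) + ∑ j, algebraMap O R (s (some j)) * algebraMap B R (y j)

lemma dual_inl_affineForm (l : ν) (s : Option τ → O) :
    h.dual (Sum.inl l) (affineForm R y s) = affineForm R y fun o => hx.dual l (s o) := by
  simp [affineForm, dual_inl_algebraMap hx h, dual_inl_coord h, mul_comm]

include hx in
lemma dual_inr_affineForm (j : τ) (s : Option τ → O) :
    h.dual (Sum.inr j) (affineForm R y s) = algebraMap O R (s (some j)) := by
  classical
  simp [affineForm, dual_inr_algebraMap hx h, dual_inr_coord h]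

/-- The coefficients of the affine forms `Φ` and `D_l Φ`. -/
def jetMatrix (s : Option τ → O) : Matrix (Option ν) (Option τ) O :=
  Matrix.of fun r o => r.elim (s o) fun l => hx.dual l (s o)

variable (R y) in
/-- The affine forms `Φ` and `D_l Φ`. -/
def jet (s : Option τ → O) (r : Option ν) : R := affineForm R y (jetMatrix hx s r)

lemma jet_some (s : Option τ → O) (l : ν) :
    jet R y hx s (some l) = h.dual (Sum.inl l) (jet R y hx s none) := by
  simp only [jet, dual_inl_affineForm hx h]
  rfl

/-- At a point of the critical scheme the linear parts of `Φ` and of the `D_l Φ` are linearly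
independent. -/
lemma linearIndependent_linear_part [IsLocalRing O] [IsLocalRing R]
    [IsLocalHom (algebraMap O R)] (s : Option τ → O)
    (hs : LinearIndependent (IsLocalRing.ResidueField O)
      fun r => ((jetMatrix hx s).map (IsLocalRing.residue O)) r)
    (hF : ∀ r, jet R y hx s r ∈ IsLocalRing.maximalIdeal R) :
    LinearIndependent (IsLocalRing.ResidueField O)
      fun r => (((jetMatrix hx s).submatrix id some).map (IsLocalRing.residue O)) r := by
  rw [Fintype.linearIndependent_iff] at hs ⊢
  intro c hc
  refine hs c (funext fun o => ?_)
  have hsome : ∀ j, ∑ r, c r * IsLocalRing.residue O (jetMatrix hx s r (some j)) = 0 := fun j => by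
    simpa using congrFun hc j
  suffices ∑ r, c r * IsLocalRing.residue O (jetMatrix hx s r o) = 0 by simpa using this
  rcases o with _ | j
  -- Since the forms vanish at the point, each constant term is minus the linear part evaluated at
  -- the residues of `y`. A relation between the linear parts therefore extends to the constant
  -- terms, after passing to the residue field of `R`.
  · let ι := IsLocalRing.ResidueField.map (algebraMap O R)
    have hι : ∀ a, ι (IsLocalRing.residue O a) = IsLocalRing.residue R (algebraMap O R a) :=
      fun a => IsLocalRing.ResidueField.map_residue _ a
    refine ι.injective ?_
    have hr : ∀ r, ι (IsLocalRing.residue O (jetMatrix hx s r none)) =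
        -∑ j, ι (IsLocalRing.residue O (jetMatrix hx s r (some j))) *
          IsLocalRing.residue R (algebraMap B R (y j)) := fun r => by
      have := (IsLocalRing.residue_eq_zero_iff _).mpr (hF r)
      rw [jet, affineForm, map_add, map_sum] at this
      simp only [map_mul, ← hι] at this
      exact eq_neg_of_add_eq_zero_left this
    simp only [map_sum, map_mul, hr, map_zero, mul_neg, Finset.sum_neg_distrib, Finset.mul_sum]
    rw [Finset.sum_comm, neg_eq_zero]
    refine Finset.sum_eq_zero fun j _ => ?_
    simp only [← mul_assoc, ← Finset.sum_mul, ← map_mul, ← map_sum]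
    rw [hsome, map_zero, zero_mul]
  · exact hsome j

variable [DecidableEq ν] [IsDomain O] [IsLocalRing O] [IsLocalRing R] [IsLocalHom (algebraMap O R)]

lemma jet_mem_maximalIdeal [DecidableEq τ] {s : Option τ → O} {I : Ideal R}
    (hI : I = Ideal.span (Set.range (jet R y hx s))) (hI' : I ≠ ⊤) (r : Option ν) :
    jet R y hx s r ∈ IsLocalRing.maximalIdeal R :=
  IsLocalRing.le_maximalIdeal hI' (hI ▸ Ideal.subset_span ⟨r, rfl⟩)

/-- The critical scheme is integral. -/
theorem isDomain_quotient_jet (hloc : IsPolynomialLocalization O (algebraMap B R ∘ y))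
    {s : Option τ → O} (hs : LinearIndependent (IsLocalRing.ResidueField O)
      fun r => ((jetMatrix hx s).map (IsLocalRing.residue O)) r) {I : Ideal R}
    (hI : I = Ideal.span (Set.range (jet R y hx s))) (hI' : I ≠ ⊤) : IsDomain (R ⧸ I) := by
  classical
  obtain ⟨q, G, G', h₁, h₂, hG⟩ := exists_completion _ (linearIndependent_linear_part hx s hs
    (jet_mem_maximalIdeal hx hI hI'))
  have hp := isPrime_span_linearPoly (fun r => jetMatrix hx s r none) _ G G' h₁ h₂ hG
  -- The ideal is extended from the prime ideal of the same affine linear equations in `O[y]`.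
  have hmap : I = (Ideal.span (Set.range (linearPoly (fun r => jetMatrix hx s r none)
      ((jetMatrix hx s).submatrix id some)))).map
        (MvPolynomial.aeval (R := O) (algebraMap B R ∘ y)).toRingHom := by
    rw [Ideal.map_span, ← Set.range_comp, hI]
    congr 2
    ext r
    simp [linearPoly, jet, affineForm]
  have := hloc.isPrime_map hp (hmap ▸ hI')
  rw [← hmap] at this
  exact Ideal.Quotient.isDomain I

include h in
/-- The ideal of the critical subscheme of the universal family. -/
theorem comap_criticalIdeal_eq [Nonempty ν] (hB : IsDifferentialBasis k B y)
    {s : Option τ → O} (hs : LinearIndependent (IsLocalRing.ResidueField O)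
      fun r => ((jetMatrix hx s).map (IsLocalRing.residue O)) r)
    {I : Ideal R} (hI : I = Ideal.span {affineForm R y s})
    (hC : (criticalIdeal k B (R ⧸ I)).comap (Ideal.Quotient.mk I) ≠ ⊤) :
    (criticalIdeal k B (R ⧸ I)).comap (Ideal.Quotient.mk I) =
      Ideal.span (Set.range (jet R y hx s)) := by
  classical
  have hI' : I ≠ ⊤ := by
    rintro rfl
    have : Subsingleton (R ⧸ (⊤ : Ideal R)) := Ideal.Quotient.subsingleton_iff.mpr rfl
    exact hC (by rw [Subsingleton.elim (criticalIdeal k B (R ⧸ (⊤ : Ideal R))) ⊤, Ideal.comap_top])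
  have hmax : affineForm R y s ∈ IsLocalRing.maximalIdeal R :=
    IsLocalRing.le_maximalIdeal hI' (hI ▸ Ideal.subset_span rfl)
  let F : Unit → R := fun _ => affineForm R y s
  have hF : I = Ideal.span (Set.range F) := by rw [hI, Set.range_const]
  let N : Matrix Unit τ O := Matrix.of fun _ j => s (some j)
  -- If all coefficients of the `y_j` were non-units, so would be the constant term, because `Φ`
  -- vanishes at the point; then the row `none` would be zero in the residue field.
  have hN : LinearIndependent (IsLocalRing.ResidueField O)
      fun r => (N.map (IsLocalRing.residue O)) r := by
    rw [linearIndependent_unique_iff]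
    intro h0
    have hj : ∀ j, s (some j) ∈ IsLocalRing.maximalIdeal O := fun j =>
      (IsLocalRing.residue_eq_zero_iff _).mp (congrFun h0 j)
    have hloc : ∀ a : O, a ∈ IsLocalRing.maximalIdeal O ↔
        algebraMap O R a ∈ IsLocalRing.maximalIdeal R := fun a => by
      rw [IsLocalRing.mem_maximalIdeal, IsLocalRing.mem_maximalIdeal, mem_nonunits_iff,
        mem_nonunits_iff, isUnit_map_iff]
    have hn : s none ∈ IsLocalRing.maximalIdeal O := by
      rw [hloc]
      refine (Ideal.add_mem_iff_left _ (Ideal.sum_mem _ fun j _ => ?_)).mp hmax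
      exact Ideal.mul_mem_right _ _ ((hloc _).mp (hj j))
    refine hs.ne_zero none (funext fun o => ?_)
    rcases o with _ | j
    · exact (IsLocalRing.residue_eq_zero_iff _).mpr hn
    · exact (IsLocalRing.residue_eq_zero_iff _).mpr (hj j)
  obtain ⟨q, G, G', h₁, h₂, hG⟩ := exists_completion N hN
  subst hF
  have : Nontrivial (R ⧸ Ideal.span (Set.range F)) := Ideal.Quotient.nontrivial_iff.mpr hI'
  let f : O →+* R ⧸ Ideal.span (Set.range F) := (Ideal.Quotient.mk _).comp (algebraMap O R)
  rw [criticalIdeal_hypersurface h hB F (G.map f) (G'.map f)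
    (by rw [← Matrix.map_mul, h₁, Matrix.map_one _ f.map_zero f.map_one])
    (by rw [← Matrix.map_mul, h₂, Matrix.map_one _ f.map_zero f.map_one]) fun r j => by
      rw [Matrix.map_apply, hG, dual_inr_affineForm hx h]
      rfl]
  have hr : (Set.range fun l => Ideal.Quotient.mk (Ideal.span (Set.range F))
      (h.dual (Sum.inl l) (F ()))) = Ideal.Quotient.mk (Ideal.span (Set.range F)) ''
        Set.range fun l => jet R y hx s (some l) := by
    rw [← Set.range_comp]
    exact congrArg Set.range (funext fun l => congrArg _ (jet_some hx h s l).symm)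
  -- Taking the preimage in `R` adds the equation `Φ` to the first derivatives.
  rw [hr, ← Ideal.map_span, Ideal.comap_map_of_surjective _ Ideal.Quotient.mk_surjective,
    ← RingHom.ker_eq_comap_bot, Ideal.mk_ker, ← Ideal.span_union]
  congr 1
  ext f
  simp only [Set.mem_union, Set.mem_range, Option.exists]
  refine or_comm.trans (or_congr ⟨fun ⟨_, hf⟩ => hf, fun hf => ⟨(), hf⟩⟩ Iff.rfl)

include h in
/-- The critical ideal of the critical subscheme of the universal family. -/
theorem criticalIdeal_eq_span_det (hB : IsDifferentialBasis k B y)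
    {s : Option τ → O} (hs : LinearIndependent (IsLocalRing.ResidueField O)
      fun r => ((jetMatrix hx s).map (IsLocalRing.residue O)) r)
    {I : Ideal R} (hI : I = Ideal.span (Set.range (jet R y hx s))) (hI' : I ≠ ⊤) :
    criticalIdeal k B (R ⧸ I) = Ideal.span {Matrix.det (Matrix.of fun i j =>
      Ideal.Quotient.mk I (h.dual (Sum.inl j) (h.dual (Sum.inl i) (affineForm R y s))))} := by
  classical
  have hmax := jet_mem_maximalIdeal hx hI hI'
  subst hI
  have : Nontrivial (R ⧸ Ideal.span (Set.range (jet R y hx s))) := Ideal.Quotient.nontrivial_iff.mpr hI'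
  obtain ⟨q, G, G', h₁, h₂, hG⟩ := exists_completion _ (linearIndependent_linear_part hx s hs hmax)
  let f : O →+* R ⧸ Ideal.span (Set.range (jet R y hx s)) := (Ideal.Quotient.mk _).comp (algebraMap O R)
  refine criticalIdeal_critical h hB (jet R y hx s) (jet_some hx h s) (G.map f) (G'.map f)
    (by rw [← Matrix.map_mul, h₁, Matrix.map_one _ f.map_zero f.map_one])
    (by rw [← Matrix.map_mul, h₂, Matrix.map_one _ f.map_zero f.map_one]) fun r j => ?_
  rw [Matrix.map_apply, hG, jet, dual_inr_affineForm hx h]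
  rfl

end LocalFamily

/-! ## Existence of differential bases -/

section Existence

open scoped IntermediateField.algebraAdjoinAdjoin in
/-- A finitely generated extension of a perfect field has a differential basis with as many members
as the transcendence degree. -/
lemma exists_isDifferentialBasis_of_perfectField (k K : Type*) [Field k] [Field K] [Algebra k K]
    [PerfectField k] [Algebra.EssFiniteType k K] :
    ∃ s : Finset K, s.card = Algebra.trdeg k K ∧ IsDifferentialBasis k K ((↑) : s → K) := by
  obtain ⟨s, hs, H⟩ := exists_isTranscendenceBasis_and_isSeparable_of_perfectField k K
  let v : s → K := (↑)
  have hv : AlgebraicIndependent k v := hs.1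
  have : Algebra.IsSeparable (IntermediateField.adjoin k (Set.range v)) K := by
    convert! H <;> simp [v]
  let A := Algebra.adjoin k (Set.range v)
  let F := IntermediateField.adjoin k (Set.range v)
  -- From the polynomial ring in a separating transcendence basis to its image, its field of
  -- fractions and the separable extension `K`, each step is formally étale and preserves the
  -- differential basis.
  let _ : Algebra (MvPolynomial s k) A := hv.aevalEquiv.toAlgHom.toRingHom.toAlgebra
  have : IsScalarTower k (MvPolynomial s k) A := .of_algebraMap_eq fun a =>
    (hv.aevalEquiv.commutes a).symm
  have : Algebra.FormallyEtale (MvPolynomial s k) A :=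
    .of_equiv (AlgEquiv.ofBijective (Algebra.ofId (MvPolynomial s k) A) hv.aevalEquiv.bijective)
  have : Algebra.FormallyEtale A F := .of_isLocalization (nonZeroDivisors _)
  have : Algebra.FormallyEtale F K := Algebra.FormallyEtale.of_isSeparable _ K
  have h := (((IsDifferentialBasis.mvPolynomial_X k s).of_formallyEtale A).of_formallyEtale
    F).of_formallyEtale K
  refine ⟨s, ?_, ?_⟩
  · rw [← hs.cardinalMk_eq_trdeg]
    simp
  · convert h using 1
    ext i
    change v i = algebraMap A K (hv.aevalEquiv (MvPolynomial.X i))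
    rw [show algebraMap A K (hv.aevalEquiv (MvPolynomial.X i)) = MvPolynomial.aeval v (MvPolynomial.X i) from
      hv.algebraMap_aevalEquiv _]
    simp

/-- The local ring at a smooth point of a variety of dimension `n` has a differential basis with `n`
members. -/
lemma exists_isDifferentialBasis (k O K : Type*) [Field k] [PerfectField k] [CommRing O] [IsDomain O]
    [IsLocalRing O] [Field K] [Algebra k O] [Algebra O K] [Algebra k K] [IsScalarTower k O K]
    [IsFractionRing O K] [Algebra.FormallySmooth k O] [Algebra.EssFiniteType k O] {n : ℕ}
    (hn : Algebra.trdeg k K = n) : ∃ x : Fin n → O, IsDifferentialBasis k O x := by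
  -- The differentials form a finite projective module over a local ring, so a basis can be selected
  -- from the generators `d f`.
  have : Module.FinitePresentation O (Ω[O⁄k]) := Module.finitePresentation_of_projective _ _
  obtain ⟨κ, a, b, hb⟩ := Module.exists_basis_of_span_of_flat (KaehlerDifferential.D k O)
    (KaehlerDifferential.span_range_derivation k O)
  have hO : IsDifferentialBasis k O a := .of_basis b fun i => by rw [hb]
  -- The number of members is compared in the function field, where it is the transcendence degree.
  have : Algebra.FormallyEtale O K := .of_isLocalization (nonZeroDivisors O)
  have hK := hO.of_formallyEtale K
  have : Algebra.EssFiniteType O K := .of_isLocalization K (nonZeroDivisors O)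
  have : Algebra.EssFiniteType k K := .comp k O K
  obtain ⟨s, hs, h⟩ := exists_isDifferentialBasis_of_perfectField k K
  have e := hK.basis.indexEquiv h.basis
  have hcard : s.card = n := by
    rw [hn] at hs
    exact_mod_cast hs
  let e' : κ ≃ Fin n := e.trans (Fintype.equivFinOfCardEq (by simp [hcard]))
  exact ⟨a ∘ e'.symm, .of_basis (b.reindex e') fun i => by simp [hb]⟩

end Existence

/-! ## Local rings of schemes of finite type over a field -/

section FiniteType

variable {k : Type u} [Field k]

/-- The complement of a prime ideal of a field consists of units, so localizing there changes
nothing. -/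
lemma bijective_germ_spec (y : Spec (.of k)) : Function.Bijective
    (((Spec (.of k)).presheaf.germ ⊤ y trivial).hom.comp (Scheme.ΓSpecIso (.of k)).inv.hom) := by
  let q : PrimeSpectrum k := y
  have hp : (q.asIdeal.primeCompl : Submonoid k) ≤ IsUnit.submonoid k := fun c hc =>
    isUnit_iff_ne_zero.mpr fun h0 => hc (h0 ▸ q.asIdeal.zero_mem)
  have h := congrArg CommRingCat.Hom.hom (Spec.algebraMap_stalkIso_inv (R := .of k) q)
  change Function.Bijective ((Scheme.ΓSpecIso (.of k)).inv ≫
    (Spec (.of k)).presheaf.germ ⊤ y trivial).hom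
  rw [← h]
  exact ((Spec.stalkIso (CommRingCat.of k) q).symm.commRingCatIsoToRingEquiv.bijective).comp
    (IsLocalization.atUnits k q.asIdeal.primeCompl hp).bijective

lemma stalkConstants_eq {X : Scheme.{u}} (f : X ⟶ Spec (.of k)) (x : X) :
    stalkConstants f x = (f.stalkMap x).hom.comp
      (((Spec (.of k)).presheaf.germ ⊤ (f x) trivial).hom.comp
        (Scheme.ΓSpecIso (.of k)).inv.hom) := by
  ext c
  exact (Scheme.Hom.germ_stalkMap_apply f ⊤ x trivial _).symm

lemma stalkConstants_comp {X Y : Scheme.{u}} (g : X ⟶ Y) (f : Y ⟶ Spec (.of k)) (x : X) :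
    stalkConstants (g ≫ f) x = (g.stalkMap x).hom.comp (stalkConstants f (g x)) := by
  ext c
  exact (Scheme.Hom.germ_stalkMap_apply g ⊤ x trivial _).symm

lemma formallySmooth_stalkConstants {X : Scheme.{u}} (f : X ⟶ Spec (.of k)) (x : X)
    (h : (f.stalkMap x).hom.FormallySmooth) : (stalkConstants f x).FormallySmooth := by
  rw [stalkConstants_eq]
  exact .comp (.of_bijective (bijective_germ_spec _)) h

lemma essFiniteType_stalkConstants {X : Scheme.{u}} (f : X ⟶ Spec (.of k)) [LocallyOfFiniteType f]
    (x : X) : (stalkConstants f x).EssFiniteType := by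
  rw [stalkConstants_eq]
  exact .comp (RingHom.FiniteType.essFiniteType (.of_surjective _ (bijective_germ_spec _).2))
    (LocallyOfFiniteType.stalkMap f x)

/-- `Proj` is of finite type over the spectrum of the part of degree zero, and polynomials
homogeneous of degree zero are constants. -/
instance (m : ℕ) : LocallyOfFiniteType (projStr k m) := by
  have hs : Function.Surjective
      (algebraMap k (MvPolynomial.homogeneousSubmodule (Fin (m + 1)) k 0)) := by
    rintro ⟨f, hf⟩
    have : f = MvPolynomial.C (f.coeff 0) := by
      exact MvPolynomial.totalDegree_eq_zero_iff_eq_C.mp (Nat.le_zero.mp hf.totalDegree_le)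
    exact ⟨f.coeff 0, Subtype.ext this.symm⟩
  have : Algebra.FiniteType (MvPolynomial.homogeneousSubmodule (Fin (m + 1)) k 0)
      (MvPolynomial (Fin (m + 1)) k) := by
    refine RingHom.FiniteType.of_comp_finiteType (f := algebraMap k
      (MvPolynomial.homogeneousSubmodule (Fin (m + 1)) k 0)) ?_
    change RingHom.FiniteType (algebraMap k (MvPolynomial (Fin (m + 1)) k))
    exact RingHom.finiteType_algebraMap.mpr inferInstance
  have h₁ : LocallyOfFiniteType (Spec.map (CommRingCat.ofHom
      (algebraMap k (MvPolynomial.homogeneousSubmodule (Fin (m + 1)) k 0)))) :=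
    (HasRingHomProperty.Spec_iff (P := @LocallyOfFiniteType)).mpr
      (RingHom.FiniteType.of_surjective _ hs)
  have h₂ : LocallyOfFiniteType
      (Proj.toSpecZero (MvPolynomial.homogeneousSubmodule (Fin (m + 1)) k)) := inferInstance
  exact MorphismProperty.comp_mem _ _ _ h₂ h₁

end FiniteType

namespace LinearSystem

variable {k : Type u} [Field k] {n m : ℕ} (S : LinearSystem k n m)

instance : IsIntegral S.X := S.isIntegral

instance : LocallyOfFiniteType S.str := by
  obtain ⟨r, i, hi, h⟩ := S.projective
  rw [← h]
  infer_instance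

instance : IsLocallyNoetherian S.X := LocallyOfFiniteType.isLocallyNoetherian S.str

instance (p : S.X) : Algebra.EssFiniteType k (S.OX p) := essFiniteType_stalkConstants S.str p

instance (p : S.X) : IsNoetherianRing (S.OX p) := inferInstance

lemma exists_isDifferentialBasis [PerfectField k] {p : S.X} (hp : p ∈ S.Xcirc) :
    ∃ x : Fin n → S.OX p, IsDifferentialBasis k (S.OX p) x := by
  have : Algebra.FormallySmooth k (S.OX p) := formallySmooth_stalkConstants S.str p hp.1
  let _ : Algebra k S.X.functionField := (stalkConstants S.str (genericPoint S.X)).toAlgebra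
  have : IsScalarTower k (S.OX p) S.X.functionField := .of_algebraMap_eq fun c => by
    symm
    exact S.X.presheaf.germ_stalkSpecializes_apply _ _ _
  exact PfaffianDegeneracy.exists_isDifferentialBasis k (S.OX p) S.X.functionField S.dim_eq

end LinearSystem

/-! ## Products with an affine space -/

section PolynomialPushout

/-- A base change of a polynomial ring is a polynomial ring in the same variables; the inverse comes
from the universal property of the pushout. -/
lemma bijective_eval₂Hom_of_isPushout {K A B C : CommRingCat.{u}} {φ : K ⟶ A} {ψ : K ⟶ B}
    {a : A ⟶ C} {b : B ⟶ C} (h : IsPushout φ ψ a b) {τ : Type} (t : τ → B)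
    (ht : Function.Bijective (MvPolynomial.eval₂Hom ψ.hom t)) :
    Function.Bijective (MvPolynomial.eval₂Hom a.hom fun j => b.hom (t j)) := by
  let e := RingEquiv.ofBijective _ ht
  have he : ∀ f, e f = MvPolynomial.eval₂Hom ψ.hom t f := fun _ => rfl
  let b' : B ⟶ .of (MvPolynomial τ A) :=
    CommRingCat.ofHom ((MvPolynomial.map φ.hom).comp e.symm.toRingHom)
  have hb' : ∀ f, b'.hom (e f) = MvPolynomial.map φ.hom f := fun f => by simp [b']
  have w : φ ≫ CommRingCat.ofHom MvPolynomial.C = ψ ≫ b' := by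
    ext c : 2
    have h1 : e (MvPolynomial.C c) = ψ.hom c := by simp [he]
    change MvPolynomial.C (φ.hom c) = b'.hom (ψ.hom c)
    rw [← h1, hb', MvPolynomial.map_C]
  let g : C ⟶ .of (MvPolynomial τ A) := h.desc _ _ w
  have hg₁ : ∀ x, g.hom (a.hom x) = MvPolynomial.C x := fun x =>
    congrArg (fun f => f.hom x) (h.inl_desc _ _ w)
  have hg₂ : ∀ x, g.hom (b.hom x) = b'.hom x := fun x =>
    congrArg (fun f => f.hom x) (h.inr_desc _ _ w)
  have ht' : ∀ j, e (MvPolynomial.X j) = t j := fun j => by simp [he]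
  refine Function.bijective_iff_has_inverse.mpr ⟨g.hom, fun f => ?_, fun f => ?_⟩
  · have : (g.hom.comp (MvPolynomial.eval₂Hom a.hom fun j => b.hom (t j))) =
        RingHom.id (MvPolynomial τ A) := by
      refine MvPolynomial.ringHom_ext (fun x => ?_) fun j => ?_
      · simp [hg₁]
      · simp only [RingHom.comp_apply, MvPolynomial.eval₂Hom_X', RingHom.id_apply]
        rw [hg₂, ← ht', hb', MvPolynomial.map_X]
    exact RingHom.congr_fun this f
  · have : g ≫ CommRingCat.ofHom (MvPolynomial.eval₂Hom a.hom fun j => b.hom (t j)) = 𝟙 C := by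
      refine h.hom_ext ?_ ?_
      · ext x : 2
        simp [hg₁]
      · ext x : 2
        obtain ⟨f, rfl⟩ := e.surjective x
        simp only [CommRingCat.hom_comp, RingHom.comp_apply, hg₂, hb' f, CommRingCat.hom_ofHom,
          Category.comp_id]
        have : (MvPolynomial.eval₂Hom a.hom fun j => b.hom (t j)).comp (MvPolynomial.map φ.hom) =
            b.hom.comp (MvPolynomial.eval₂Hom ψ.hom t) := by
          refine MvPolynomial.ringHom_ext (fun x => ?_) fun j => ?_
          · simpa using congrArg (fun f => f.hom x) h.w
          · simp
        exact RingHom.congr_fun this f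
    exact congrArg (fun u => u.hom f) this

-- Passage from sections to stalks: a localization of `A[t]` in which `N` becomes invertible is a
-- localization of `(N⁻¹A)[t]`.
attribute [local instance] MvPolynomial.algebraMvPolynomial in
lemma isPolynomialLocalization_of_bijective {A O C R τ : Type*} [CommRing A] [CommRing O]
    [CommRing C] [CommRing R] [Algebra A O] [Algebra C R] [Algebra O R] (N : Submonoid A)
    [IsLocalization N O] (M : Submonoid C) [IsLocalization M R] (a : A →+* C) (t : τ → C)
    (ht : Function.Bijective (MvPolynomial.eval₂Hom a t))
    (hcomp : (algebraMap O R).comp (algebraMap A O) = (algebraMap C R).comp a) :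
    IsPolynomialLocalization O (algebraMap C R ∘ t) := by
  let e := RingEquiv.ofBijective _ ht
  let _ : Algebra (MvPolynomial τ A) R := ((algebraMap C R).comp e.toRingHom).toAlgebra
  have h₁ : IsLocalization (M.comap e.toRingHom) R := by
    have := IsLocalization.isLocalization_of_base_ringEquiv M R e.symm
    convert this using 1
    · ext x
      simp only [Submonoid.mem_comap, Submonoid.mem_map]
      exact ⟨fun hx => ⟨e x, hx, by simp⟩, by rintro ⟨y, hy, rfl⟩; simpa using hy⟩
    · rfl
  -- Enlarging the denominators to everything that becomes a unit does not change the localization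
  -- and ensures that they contain `N`.
  let M' : Submonoid (MvPolynomial τ A) :=
    (IsUnit.submonoid R).comap (algebraMap (MvPolynomial τ A) R)
  have h₂ : IsLocalization M' R := IsLocalization.of_le (M.comap e.toRingHom) M'
    (fun x hx => IsLocalization.map_units (M := M.comap e.toRingHom) R ⟨x, hx⟩) fun _ hr => hr
  have hC : ∀ x, algebraMap (MvPolynomial τ A) R (MvPolynomial.C x) =
      algebraMap O R (algebraMap A O x) := fun x => by
    refine .trans ?_ (RingHom.congr_fun hcomp x).symm
    exact congrArg (algebraMap C R) (MvPolynomial.eval₂_C a t x)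
  have hX : ∀ j, algebraMap (MvPolynomial τ A) R (MvPolynomial.X j) = algebraMap C R (t j) :=
    fun j => congrArg (algebraMap C R) (MvPolynomial.eval₂_X a t j)
  have hle : N.map (MvPolynomial.C (σ := τ)) ≤ M' := by
    rintro _ ⟨x, hx, rfl⟩
    change IsUnit _
    rw [hC]
    exact (IsLocalization.map_units O ⟨x, hx⟩).map _
  let _ := (MvPolynomial.aeval (R := O) (algebraMap C R ∘ t)).toRingHom.toAlgebra
  have : IsScalarTower (MvPolynomial τ A) (MvPolynomial τ O) R := by
    refine .of_algebraMap_eq' (MvPolynomial.ringHom_ext (fun x => ?_) fun j => ?_)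
    · rw [hC, RingHom.comp_apply, MvPolynomial.algebraMap_def, MvPolynomial.map_C]
      exact (MvPolynomial.aeval_C (algebraMap C R ∘ t) _).symm
    · rw [hX, RingHom.comp_apply, MvPolynomial.algebraMap_def, MvPolynomial.map_X]
      exact (MvPolynomial.aeval_X (algebraMap C R ∘ t) _).symm
  exact ⟨_, IsLocalization.isLocalization_of_submonoid_le (MvPolynomial τ O) R
    (N.map (MvPolynomial.C (σ := τ))) M' hle⟩

end PolynomialPushout

/-! ## Affine charts of projective space -/

section Charts

/-- Homogeneity: substituting `w_j u` for the variables multiplies the value at `w` by `u ^ d`. -/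
lemma eval₂_mul_pow_of_isHomogeneous {k σ S : Type*} [CommRing k] [CommRing S] [Fintype σ]
    (g : MvPolynomial σ k →+* S) (u : S) (w : σ → S) (hw : ∀ j, w j * u = g (MvPolynomial.X j))
    {f : MvPolynomial σ k} {d : ℕ} (hf : f.IsHomogeneous d) :
    f.eval₂ (g.comp MvPolynomial.C) w * u ^ d = g f := by
  have hg : g f = f.eval₂ (g.comp MvPolynomial.C) fun j => g (MvPolynomial.X j) := by
    have : g = MvPolynomial.eval₂Hom (g.comp MvPolynomial.C) fun j => g (MvPolynomial.X j) :=
      MvPolynomial.ringHom_ext (fun c => by simp) fun j => by simp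
    exact RingHom.congr_fun this f
  rw [hg, MvPolynomial.eval₂_eq', MvPolynomial.eval₂_eq', Finset.sum_mul]
  refine Finset.sum_congr rfl fun a ha => ?_
  have hd : ∑ j, a j = d := by
    rw [← hf (MvPolynomial.mem_support_iff.mp ha), ← Finsupp.degree_eq_sum,
      Finsupp.degree_eq_weight_one]
    rfl
  simp only [← hw, mul_pow, Finset.prod_mul_distrib, Finset.prod_pow_eq_pow_sum, hd, mul_assoc]

variable (k : Type u) [Field k] {m : ℕ}

open HomogeneousLocalization

/-- The function `Y_j / Y_i` on the basic open subset `Y_i ≠ 0` of projective space. -/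
def chartCoord (i j : Fin (m + 1)) :
    Away (MvPolynomial.homogeneousSubmodule (Fin (m + 1)) k) (MvPolynomial.X i) :=
  HomogeneousLocalization.mk
    { deg := 1
      num := ⟨MvPolynomial.X j, MvPolynomial.isHomogeneous_X k j⟩
      den := ⟨MvPolynomial.X i, MvPolynomial.isHomogeneous_X k i⟩
      den_mem := Submonoid.mem_powers _ }

/-- The constant functions on the basic open subset `Y_i ≠ 0` of projective space. -/
def chartConstants (i : Fin (m + 1)) : k →+*
    Away (MvPolynomial.homogeneousSubmodule (Fin (m + 1)) k) (MvPolynomial.X i) :=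
  (fromZeroRingHom (MvPolynomial.homogeneousSubmodule (Fin (m + 1)) k) _).comp (algebraMap k _)

lemma val_chartConstants (i : Fin (m + 1)) (c : k) : (chartConstants k i c).val =
    algebraMap (MvPolynomial (Fin (m + 1)) k) _ (MvPolynomial.C c) := by
  rw [← Localization.mk_one_eq_algebraMap]
  rfl

lemma val_chartCoord_mul (i j : Fin (m + 1)) : (chartCoord k i j).val *
    algebraMap (MvPolynomial (Fin (m + 1)) k) _ (MvPolynomial.X i) =
      algebraMap (MvPolynomial (Fin (m + 1)) k) _ (MvPolynomial.X j) := by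
  rw [← Localization.mk_one_eq_algebraMap, ← Localization.mk_one_eq_algebraMap, chartCoord, val_mk,
    Localization.mk_mul, Localization.mk_eq_mk_iff, Localization.r_iff_exists]
  exact ⟨1, by simp [mul_comm]⟩

lemma chartCoord_self (i : Fin (m + 1)) : chartCoord k i i = 1 := by
  refine val_injective _ ((IsLocalization.Away.algebraMap_isUnit
    (S := Localization.Away (MvPolynomial.X i : MvPolynomial (Fin (m + 1)) k))
      (MvPolynomial.X i : MvPolynomial (Fin (m + 1)) k)).mul_right_cancel ?_)
  rw [val_chartCoord_mul, val_one, one_mul]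

/-- The basic open subset `Y_i ≠ 0` of projective space is an affine space. -/
lemma bijective_chart (i : Fin (m + 1)) : Function.Bijective
    (MvPolynomial.eval₂Hom (chartConstants k i) fun j => chartCoord k i (i.succAbove j)) := by
  let L := Localization.Away (MvPolynomial.X i : MvPolynomial (Fin (m + 1)) k)
  -- Dehomogenization, which sets the `i`-th variable to `1`. It extends to the localization and
  -- gives a left inverse.
  let dehom : MvPolynomial (Fin (m + 1)) k →+* MvPolynomial (Fin m) k :=
    MvPolynomial.eval₂Hom MvPolynomial.C (i.insertNth 1 MvPolynomial.X)
  have hX : dehom (MvPolynomial.X i) = 1 := by simp [dehom]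
  constructor
  · let r : L →+* MvPolynomial (Fin m) k :=
      IsLocalization.Away.lift (MvPolynomial.X i) (g := dehom) (hX ▸ isUnit_one)
    have hr : ∀ f, r (algebraMap _ L f) = dehom f := fun f => IsLocalization.Away.lift_eq _ _ f
    refine Function.LeftInverse.injective (g := fun f => r f.val) fun f => ?_
    have : (r.comp (algebraMap (Away (MvPolynomial.homogeneousSubmodule (Fin (m + 1)) k)
        (MvPolynomial.X i)) L)).comp (MvPolynomial.eval₂Hom (chartConstants k i)
          fun j => chartCoord k i (i.succAbove j)) = RingHom.id (MvPolynomial (Fin m) k) := by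
      refine MvPolynomial.ringHom_ext (fun c => ?_) fun j => ?_
      · simp only [RingHom.comp_apply, MvPolynomial.eval₂Hom_C, RingHom.id_apply]
        change r (chartConstants k i c).val = _
        rw [val_chartConstants, hr]
        simp [dehom]
      · simp only [RingHom.comp_apply, MvPolynomial.eval₂Hom_X', RingHom.id_apply]
        change r (chartCoord k i (i.succAbove j)).val = _
        have := congrArg r (val_chartCoord_mul k i (i.succAbove j))
        rw [map_mul, hr, hr, hX, mul_one] at this
        rw [this]
        simp [dehom]
    exact RingHom.congr_fun this f
  -- A fraction `f / Y_i ^ d` is the value of the dehomogenized `f` at the coordinates; this is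
  -- checked after multiplication by the unit `Y_i ^ d`.
  · intro z
    have hi : (MvPolynomial.X i : MvPolynomial (Fin (m + 1)) k) ∈
        MvPolynomial.homogeneousSubmodule (Fin (m + 1)) k 1 := MvPolynomial.isHomogeneous_X k i
    obtain ⟨d, f, hf', rfl⟩ := Away.mk_surjective _ hi z
    have hf : f.IsHomogeneous d := by simpa using hf'
    refine ⟨dehom f, val_injective _ ((IsLocalization.Away.algebraMap_isUnit (S := L)
      (MvPolynomial.X i : MvPolynomial (Fin (m + 1)) k)).pow d |>.mul_right_cancel ?_)⟩
    have h₁ : (MvPolynomial.eval₂Hom (chartConstants k i)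
        fun j => chartCoord k i (i.succAbove j)).comp dehom =
          MvPolynomial.eval₂Hom (chartConstants k i) (chartCoord k i) := by
      refine MvPolynomial.ringHom_ext (fun c => by simp [dehom]) fun j => ?_
      obtain rfl | ⟨j, rfl⟩ := i.eq_self_or_eq_succAbove j
      · simp [dehom, chartCoord_self]
      · simp [dehom]
    have h₂ : (algebraMap (Away (MvPolynomial.homogeneousSubmodule (Fin (m + 1)) k)
        (MvPolynomial.X i)) L).comp (MvPolynomial.eval₂Hom (chartConstants k i) (chartCoord k i)) =
          MvPolynomial.eval₂Hom ((algebraMap (MvPolynomial (Fin (m + 1)) k) L).comp MvPolynomial.C)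
            (fun j => (chartCoord k i j).val) := by
      refine MvPolynomial.ringHom_ext (fun c => ?_) fun j => ?_
      · simp only [RingHom.comp_apply, MvPolynomial.eval₂Hom_C]
        exact val_chartConstants k i c
      · simp only [RingHom.comp_apply, MvPolynomial.eval₂Hom_X']
        rfl
    have h₃ := eval₂_mul_pow_of_isHomogeneous (algebraMap (MvPolynomial (Fin (m + 1)) k) L) _
      (fun j => (chartCoord k i j).val) (fun j => val_chartCoord_mul k i j) hf
    rw [Away.val_mk, ← RingHom.comp_apply, h₁]
    refine (congrArg (· * _) (RingHom.congr_fun h₂ f)).trans (h₃.trans ?_)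
    rw [← map_pow, ← Localization.mk_one_eq_algebraMap, ← Localization.mk_one_eq_algebraMap,
      Localization.mk_mul, Localization.mk_eq_mk_iff, Localization.r_iff_exists]
    exact ⟨1, by simp [mul_comm]⟩

end Charts

/-! ### Charts as open subschemes, and the local rings of projective space -/

section ProjectiveCharts

variable (k : Type u) [Field k] {m : ℕ}

lemma X_mem_homogeneousSubmodule (i : Fin (m + 1)) : (MvPolynomial.X i : MvPolynomial (Fin (m + 1)) k) ∈
    MvPolynomial.homogeneousSubmodule (Fin (m + 1)) k 1 := MvPolynomial.isHomogeneous_X k i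

/-- The basic open subset `Y_i ≠ 0` of projective space. -/
def chart (i : Fin (m + 1)) : (projSpace k m).Opens :=
  Proj.basicOpen (MvPolynomial.homogeneousSubmodule (Fin (m + 1)) k) (MvPolynomial.X i)

lemma isAffineOpen_chart (i : Fin (m + 1)) : IsAffineOpen (chart k i) :=
  Proj.isAffineOpen_basicOpen _ _ (X_mem_homogeneousSubmodule k i) one_pos

/-- The functions on a chart. -/
def chartSection (i : Fin (m + 1)) : HomogeneousLocalization.Away
    (MvPolynomial.homogeneousSubmodule (Fin (m + 1)) k) (MvPolynomial.X i) ≃+*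
      Γ(projSpace k m, chart k i) :=
  (Proj.basicOpenIsoAway (MvPolynomial.homogeneousSubmodule (Fin (m + 1)) k) (MvPolynomial.X i)
    (X_mem_homogeneousSubmodule k i) one_pos).commRingCatIsoToRingEquiv

lemma germ_chartSection {y : projSpace k m} (i : Fin (m + 1))
    (hi : (MvPolynomial.X i : MvPolynomial (Fin (m + 1)) k) ∉ pointIdeal y) (j : Fin (m + 1)) :
    ((projSpace k m).presheaf.germ (chart k i) y hi).hom (chartSection k i (chartCoord k i j)) =
      affineCoord y i hi j := by
  have h := congrArg (fun f => f.hom (chartCoord k i j))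
    (ProjectiveSpectrum.Proj.awayToSection_germ
      (MvPolynomial.homogeneousSubmodule (Fin (m + 1)) k) (MvPolynomial.X i) y hi)
  exact h

/-- The scalars of the chart as an affine space agree with those coming from the structure morphism.
-/
lemma chartSection_chartConstants (i : Fin (m + 1)) (c : k) :
    chartSection k i (chartConstants k i c) = ((projStr k m).appLE ⊤ (chart k i) le_top).hom
      ((Scheme.ΓSpecIso (.of k)).inv.hom c) := by
  have h₁ : (chart k i).ι ≫ projStr k m = (chart k i).toSpecΓ ≫
      Spec.map (CommRingCat.ofHom (chartConstants k i) ≫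
        Proj.awayToSection (MvPolynomial.homogeneousSubmodule (Fin (m + 1)) k)
          (MvPolynomial.X i)) := by
    have := Proj.awayι_toSpecZero (MvPolynomial.homogeneousSubmodule (Fin (m + 1)) k)
      (MvPolynomial.X i) (X_mem_homogeneousSubmodule k i) one_pos
    rw [← Proj.basicOpenIsoSpec_inv_ι, Category.assoc, Iso.inv_comp_eq, Proj.basicOpenIsoSpec_hom,
      Proj.basicOpenToSpec] at this
    have h₂ := congrArg (· ≫ Spec.map (CommRingCat.ofHom
      (algebraMap k (MvPolynomial.homogeneousSubmodule (Fin (m + 1)) k 0)))) this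
    simp only [Category.assoc, ← Spec.map_comp] at h₂
    exact h₂
  have h₂ := congrArg (fun f => (Scheme.ΓSpecIso (.of k)).inv ≫ f.appTop ≫
    (chart k i).topIso.hom) h₁
  simp only [Scheme.Hom.comp_appTop, Category.assoc] at h₂
  rw [← Scheme.ΓSpecIso_inv_naturality_assoc, Scheme.Opens.toSpecΓ_appTop] at h₂
  simp only [Category.assoc, Iso.inv_hom_id, Category.comp_id] at h₂
  have h₃ : (chart k i).ι.appTop ≫ (chart k i).topIso.hom =
      (projSpace k m).presheaf.map (homOfLE (le_top : chart k i ≤ ⊤)).op := by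
    rw [Scheme.Opens.ι_appTop, Scheme.Opens.topIso_hom]
    exact ((projSpace k m).presheaf.map_comp _ _).symm
  rw [h₃] at h₂
  exact (congrArg (fun f => f.hom c) h₂).symm

/-- A chart of projective space is an affine space. -/
lemma bijective_chartSection (i : Fin (m + 1)) : Function.Bijective (MvPolynomial.eval₂Hom
    ((projStr k m).appLE ⊤ (chart k i) le_top).hom
      fun j => chartSection k i (chartCoord k i (i.succAbove j))) := by
  let e := (Scheme.ΓSpecIso (.of k)).symm.commRingCatIsoToRingEquiv
  have h := ((chartSection k i).bijective.comp (bijective_chart k i)).comp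
    (MvPolynomial.mapEquiv (Fin m) e.symm).bijective
  convert h using 1
  have : (MvPolynomial.eval₂Hom ((projStr k m).appLE ⊤ (chart k i) le_top).hom
      fun j => chartSection k i (chartCoord k i (i.succAbove j))) =
      ((chartSection k i).toRingHom.comp (MvPolynomial.eval₂Hom (chartConstants k i)
        fun j => chartCoord k i (i.succAbove j))).comp
          (MvPolynomial.mapEquiv (Fin m) e.symm).toRingHom := by
    refine MvPolynomial.ringHom_ext (fun c => ?_) fun j => ?_
    · obtain ⟨c, rfl⟩ := e.surjective c
      simp [chartSection_chartConstants]
      rfl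
    · simp
  exact congrArg DFunLike.coe this

/-- The local ring is a localization of the functions on the chart, which is an affine space. -/
lemma isPolynomialLocalization_projSpace {y : projSpace k m} (i : Fin (m + 1))
    (hi : (MvPolynomial.X i : MvPolynomial (Fin (m + 1)) k) ∉ pointIdeal y) :
    IsPolynomialLocalization k fun j => affineCoord y i hi (i.succAbove j) := by
  let _ : Algebra Γ(projSpace k m, chart k i) ((projSpace k m).presheaf.stalk y) :=
    ((projSpace k m).presheaf.germ (chart k i) y hi).hom.toAlgebra
  have hloc : IsLocalization.AtPrime ((projSpace k m).presheaf.stalk y)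
    ((isAffineOpen_chart k i).primeIdealOf ⟨y, hi⟩).asIdeal :=
      (isAffineOpen_chart k i).isLocalization_stalk ⟨y, hi⟩
  have : IsLocalization (⊥ : Submonoid k) k := .of_le_isUnit bot_le
  have h := isPolynomialLocalization_of_bijective (O := k) (R := (projSpace k m).presheaf.stalk y)
    (⊥ : Submonoid k) ((isAffineOpen_chart k i).primeIdealOf ⟨y, hi⟩).asIdeal.primeCompl
    ((chartSection k i).toRingHom.comp (chartConstants k i))
    (fun j => chartSection k i (chartCoord k i (i.succAbove j))) ?_ ?_
  · convert h using 1
    exact funext fun j => (germ_chartSection k i hi _).symm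
  · convert (chartSection k i).bijective.comp (bijective_chart k i) using 1
    have : MvPolynomial.eval₂Hom ((chartSection k i).toRingHom.comp (chartConstants k i))
        (fun j => chartSection k i (chartCoord k i (i.succAbove j))) =
        (chartSection k i).toRingHom.comp (MvPolynomial.eval₂Hom (chartConstants k i)
          fun j => chartCoord k i (i.succAbove j)) :=
      MvPolynomial.ringHom_ext (fun c => by simp) fun j => by simp
    exact congrArg DFunLike.coe this
  · ext c
    have := chartSection_chartConstants k i c
    change algebraMap k ((projSpace k m).presheaf.stalk y) c =
      ((projSpace k m).presheaf.germ (chart k i) y hi).hom (chartSection k i (chartConstants k i c))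
    rw [this]
    exact (TopCat.Presheaf.germ_res_apply (projSpace k m).presheaf (homOfLE le_top) y hi _).symm

end ProjectiveCharts

lemma stalkMap_germ_eq_germ_appLE {X Y : Scheme.{u}} (f : X ⟶ Y) {U : Y.Opens} {W : X.Opens}
    (h : W ≤ f ⁻¹ᵁ U) (x : X) (hx : x ∈ W) (s : Γ(Y, U)) :
    (f.stalkMap x).hom ((Y.presheaf.germ U (f x) (h hx)).hom s) =
      (X.presheaf.germ W x hx).hom ((f.appLE U W h).hom s) := by
  refine (Scheme.Hom.germ_stalkMap_apply f U x (h hx) s).trans ?_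
  rw [Scheme.Hom.appLE, CommRingCat.hom_comp, RingHom.comp_apply]
  exact (TopCat.Presheaf.germ_res_apply X.presheaf (homOfLE h) x hx _).symm

/-! ### Local rings of the product of the variety and the parameter space -/

namespace LinearSystem

variable {k : Type u} [Field k] {n m : ℕ} (S : LinearSystem k n m)

instance algebraOXOZ (z : S.Z) : Algebra (S.OX (S.pr₁ z)) (S.OZ z) :=
  (S.pr₁.stalkMap z).hom.toAlgebra

/-- The scalars of `OZ` were defined by means of `pr₂`; by the pullback square `pr₁` gives the same
ones. -/
instance isScalarTower_OX_OZ (z : S.Z) : IsScalarTower k (S.OX (S.pr₁ z)) (S.OZ z) := by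
  refine .of_algebraMap_eq' ?_
  have h₁ := stalkConstants_comp S.pr₁ S.str z
  have h₂ := stalkConstants_comp S.pr₂ (projStr k m) z
  have h₃ : S.pr₁ ≫ S.str = S.pr₂ ≫ projStr k m := pullback.condition
  exact h₂.symm.trans ((congrArg (fun f => stalkConstants f z) h₃.symm).trans h₁)

instance isLocalHom_OX_OZ (z : S.Z) : IsLocalHom (algebraMap (S.OX (S.pr₁ z)) (S.OZ z)) :=
  inferInstanceAs (IsLocalHom (S.pr₁.stalkMap z).hom)

instance isLocalHom_OP_OZ (z : S.Z) : IsLocalHom (algebraMap (S.OP z) (S.OZ z)) :=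
  inferInstanceAs (IsLocalHom (S.pr₂.stalkMap z).hom)

/-- Affine coordinates of the parameter space at the second projection of a point. -/
def coord (z : S.Z) (i : Fin (m + 1))
    (hi : (MvPolynomial.X i : MvPolynomial (Fin (m + 1)) k) ∉ pointIdeal (S.pr₂ z)) (j : Fin m) :
    S.OP z := affineCoord (S.pr₂ z) i hi (i.succAbove j)

lemma isDifferentialBasis_coord (z : S.Z) (i : Fin (m + 1))
    (hi : (MvPolynomial.X i : MvPolynomial (Fin (m + 1)) k) ∉ pointIdeal (S.pr₂ z)) :
    IsDifferentialBasis k (S.OP z) (S.coord z i hi) :=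
  (isPolynomialLocalization_projSpace k i hi).isDifferentialBasis

/-- Over an affine open `U` of the variety and a chart, the functions on the product are polynomials
over `Γ(U)` in the affine coordinates; then one localizes at `z`. -/
lemma isPolynomialLocalization_OZ (z : S.Z) (i : Fin (m + 1))
    (hi : (MvPolynomial.X i : MvPolynomial (Fin (m + 1)) k) ∉ pointIdeal (S.pr₂ z)) :
    IsPolynomialLocalization (S.OX (S.pr₁ z)) (algebraMap (S.OP z) (S.OZ z) ∘ S.coord z i hi) := by
  obtain ⟨_, ⟨U, hU, rfl⟩, hz, -⟩ := S.X.isBasis_affineOpens.exists_subset_of_mem_open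
    (Set.mem_univ (S.pr₁ z)) isOpen_univ
  let V := chart k (m := m) i
  let W : S.Z.Opens := S.pr₁ ⁻¹ᵁ U ⊓ S.pr₂ ⁻¹ᵁ V
  have hW : z ∈ W := ⟨hz, hi⟩
  have H : IsPullback S.pr₁ S.pr₂ S.str (projStr k m) := .of_hasPullback _ _
  have hS : IsAffineOpen (⊤ : (Spec (.of k)).Opens) := isAffineOpen_top _
  have hpush := (isIso_pushoutSection_iff H (US := ⊤) (UT := V) (UX := U) le_top le_top
    (UY := W) rfl).mp (isIso_pushoutSection_of_isAffineOpen H le_top le_top rfl hS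
      (isAffineOpen_chart k i) hU)
  have hWa : IsAffineOpen W := by
    have : IsAffine _ := hS
    have : IsAffine _ := isAffineOpen_chart k (m := m) i
    have : IsAffine _ := hU
    exact IsAffine.of_isPullback (Scheme.Hom.isPullback_resLE H (US := ⊤) (UT := V) (UX := U)
      le_top le_top (UY := W) rfl)
  have hbij := bijective_eval₂Hom_of_isPushout hpush _ (bijective_chartSection k i)
  let _ : Algebra Γ(S.X, U) (S.OX (S.pr₁ z)) := (S.X.presheaf.germ U _ hz).hom.toAlgebra
  let _ : Algebra Γ(S.Z, W) (S.OZ z) := (S.Z.presheaf.germ W z hW).hom.toAlgebra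
  have h₁ : IsLocalization.AtPrime (S.OX (S.pr₁ z)) (hU.primeIdealOf ⟨_, hz⟩).asIdeal :=
    hU.isLocalization_stalk ⟨_, hz⟩
  have h₂ : IsLocalization.AtPrime (S.OZ z) (hWa.primeIdealOf ⟨z, hW⟩).asIdeal :=
    hWa.isLocalization_stalk ⟨z, hW⟩
  have h := isPolynomialLocalization_of_bijective (O := S.OX (S.pr₁ z)) (R := S.OZ z)
    (hU.primeIdealOf ⟨_, hz⟩).asIdeal.primeCompl (hWa.primeIdealOf ⟨z, hW⟩).asIdeal.primeCompl
    _ _ hbij (by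
      ext f
      exact stalkMap_germ_eq_germ_appLE S.pr₁ inf_le_left z hW f)
  convert h using 1
  funext j
  change (S.pr₂.stalkMap z).hom (affineCoord (S.pr₂ z) i hi (i.succAbove j)) =
    (S.Z.presheaf.germ W z hW).hom ((S.pr₂.appLE V W inf_le_right).hom
      (chartSection k i (chartCoord k i (i.succAbove j))))
  rw [← germ_chartSection]
  exact stalkMap_germ_eq_germ_appLE S.pr₂ inf_le_right z hW _

end LinearSystem

/-! ## Local equations -/

section Frames

lemma res_res {X : Scheme.{u}} (L : X.Modules) {U V W : X.Opens} (h : V ≤ U) (h' : W ≤ V)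
    (s : Γ(L, U)) : res L h' (res L h s) = res L (h'.trans h) s :=
  (congrArg (fun f => f.hom s) (L.presheaf.map_comp (homOfLE h).op (homOfLE h').op)).symm

lemma res_smul {X : Scheme.{u}} (L : X.Modules) {U V : X.Opens} (h : V ≤ U) (r : Γ(X, U))
    (s : Γ(L, U)) : res L h (r • s) = (X.presheaf.map (homOfLE h).op).hom r • res L h s :=
  Scheme.Modules.map_smul L (homOfLE h) r s

end Frames

section AffineCoord

variable {k : Type u} [Field k] {m : ℕ}

lemma affineCoord_self (y : projSpace k m) (i : Fin (m + 1))
    (hi : (MvPolynomial.X i : MvPolynomial (Fin (m + 1)) k) ∉ pointIdeal y) :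
    affineCoord y i hi i = 1 := by
  rw [← germ_chartSection, chartCoord_self, map_one, map_one]

lemma affineCoord_mul (y : projSpace k m) (i i' : Fin (m + 1))
    (hi : (MvPolynomial.X i : MvPolynomial (Fin (m + 1)) k) ∉ pointIdeal y)
    (hi' : (MvPolynomial.X i' : MvPolynomial (Fin (m + 1)) k) ∉ pointIdeal y) (j : Fin (m + 1)) :
    affineCoord y i' hi' i * affineCoord y i hi j = affineCoord y i' hi' j := by
  refine (RingHom.map_mul (Proj.stalkIso _ y).inv.hom _ _).symm.trans (congrArg _ ?_)
  apply HomogeneousLocalization.val_injective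
  rw [HomogeneousLocalization.val_mul, HomogeneousLocalization.val_mk, HomogeneousLocalization.val_mk,
    HomogeneousLocalization.val_mk, Localization.mk_mul, Localization.mk_eq_mk_iff,
    Localization.r_iff_exists]
  refine ⟨1, ?_⟩
  simp
  ring

lemma isUnit_affineCoord (y : projSpace k m) (i i' : Fin (m + 1))
    (hi : (MvPolynomial.X i : MvPolynomial (Fin (m + 1)) k) ∉ pointIdeal y)
    (hi' : (MvPolynomial.X i' : MvPolynomial (Fin (m + 1)) k) ∉ pointIdeal y) :
    IsUnit (affineCoord y i hi i') :=
  IsUnit.of_mul_eq_one _ ((affineCoord_mul y i' i hi' hi i).trans (affineCoord_self y i hi))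

/-- The variables generate the polynomial ring over its part of degree zero, so their basic open
subsets cover `Proj`. -/
lemma exists_X_notMem_pointIdeal (y : projSpace k m) :
    ∃ i, (MvPolynomial.X i : MvPolynomial (Fin (m + 1)) k) ∉ pointIdeal y := by
  have hadj : Algebra.adjoin (MvPolynomial.homogeneousSubmodule (Fin (m + 1)) k 0)
      (Set.range fun i => (MvPolynomial.X i : MvPolynomial (Fin (m + 1)) k)) = ⊤ := by
    rw [eq_top_iff]
    intro f _
    induction f using MvPolynomial.induction_on with
    | C a =>
      let c : MvPolynomial.homogeneousSubmodule (Fin (m + 1)) k 0 :=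
        ⟨MvPolynomial.C a, MvPolynomial.isHomogeneous_C _ a⟩
      exact Subalgebra.algebraMap_mem _ c
    | add p q hp hq => exact add_mem (hp trivial) (hq trivial)
    | mul_X p i hp => exact mul_mem (hp trivial) (Algebra.subset_adjoin (Set.mem_range_self i))
  have h := Proj.iSup_basicOpen_eq_top' (MvPolynomial.homogeneousSubmodule (Fin (m + 1)) k)
    (fun i => (MvPolynomial.X i : MvPolynomial (Fin (m + 1)) k))
    (fun i => ⟨1, X_mem_homogeneousSubmodule k i⟩) hadj
  have hy : y ∈ ⨆ i, Proj.basicOpen (MvPolynomial.homogeneousSubmodule (Fin (m + 1)) k)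
      (MvPolynomial.X i : MvPolynomial (Fin (m + 1)) k) := h ▸ trivial
  obtain ⟨i, hi⟩ := TopologicalSpace.Opens.mem_iSup.mp hy
  exact ⟨i, hi⟩

end AffineCoord

namespace LinearSystem

variable {k : Type u} [Field k] {n m : ℕ} (S : LinearSystem k n m)

variable {S} in
-- On the intersection of their domains two frames of a line bundle differ by an invertible
-- function.
lemma IsLocalTuple.exists_eq_mul {p : S.X} {s s' : Fin (m + 1) → S.OX p} (h : S.IsLocalTuple p s)
    (h' : S.IsLocalTuple p s') : ∃ u, IsUnit u ∧ ∀ j, s' j = u * s j := by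
  obtain ⟨U, hp, e, r, he, hr, hs⟩ := h
  obtain ⟨U', hp', e', r', he', hr', hs'⟩ := h'
  let W := U ⊓ U'
  have hW : W ≤ U := inf_le_left
  have hW' : W ≤ U' := inf_le_right
  have hpW : p ∈ W := ⟨hp, hp'⟩
  obtain ⟨a, ha⟩ := (he W hW).2 (res S.L hW' e')
  obtain ⟨b, hb⟩ := (he' W hW').2 (res S.L hW e)
  have hab : a * b = 1 := (he W hW).1 (by
    change (a * b) • res S.L hW e = 1 • res S.L hW e
    rw [mul_comm, mul_smul, one_smul]
    exact (congrArg (b • ·) ha).trans hb)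
  have hj : ∀ j, (S.X.presheaf.map (homOfLE hW).op).hom (r j) =
      a * (S.X.presheaf.map (homOfLE hW').op).hom (r' j) := fun j => (he W hW).1 (by
    change _ • res S.L hW e = (a * _) • res S.L hW e
    rw [mul_comm a, mul_smul]
    refine .trans ?_ (congrArg (_ • ·) ha.symm)
    rw [← res_smul, ← res_smul, hr, hr', res_res, res_res])
  refine ⟨(S.X.presheaf.germ W p hpW).hom b, ?_, fun j => ?_⟩
  · exact IsUnit.map _ (IsUnit.of_mul_eq_one a (by rw [mul_comm, hab]))
  · rw [hs, hs', ← TopCat.Presheaf.germ_res_apply S.X.presheaf (homOfLE hW) p hpW,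
      ← TopCat.Presheaf.germ_res_apply S.X.presheaf (homOfLE hW') p hpW]
    have := congrArg (b * ·) (hj j)
    simp only [← mul_assoc, mul_comm b a, hab, one_mul] at this
    rw [← map_mul, this]

/-- A tuple of functions with the `i`-th member singled out. -/
def affineTuple {O : Type*} (i : Fin (m + 1)) (s : Fin (m + 1) → O) (o : Option (Fin m)) : O :=
  o.elim (s i) fun j => s (i.succAbove j)

lemma sum_affineCoord_eq_affineForm (z : S.Z) (s : Fin (m + 1) → S.OX (S.pr₁ z)) (i : Fin (m + 1))
    (hi : (MvPolynomial.X i : MvPolynomial (Fin (m + 1)) k) ∉ pointIdeal (S.pr₂ z)) :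
    ∑ j, (S.pr₁.stalkMap z).hom (s j) * (S.pr₂.stalkMap z).hom (affineCoord (S.pr₂ z) i hi j) =
      affineForm (S.OZ z) (S.coord z i hi) (affineTuple i s) := by
  rw [Fin.sum_univ_succAbove _ i, affineCoord_self, map_one, mul_one]
  rfl

variable {S} in
lemma IsLocalEquation.associated {z : S.Z} {Φ Φ' : S.OZ z} (h : S.IsLocalEquation z Φ)
    (h' : S.IsLocalEquation z Φ') : ∃ u, IsUnit u ∧ Φ' = u * Φ := by
  obtain ⟨s, hs, i, hi, rfl⟩ := h
  obtain ⟨s', hs', i', hi', rfl⟩ := h'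
  obtain ⟨u, hu, h⟩ := hs.exists_eq_mul hs'
  refine ⟨(S.pr₁.stalkMap z).hom u * (S.pr₂.stalkMap z).hom (affineCoord (S.pr₂ z) i' hi' i),
    (hu.map _).mul ((isUnit_affineCoord _ _ _ hi' hi).map _), ?_⟩
  rw [Finset.mul_sum]
  refine Finset.sum_congr rfl fun j _ => ?_
  rw [h, ← affineCoord_mul _ i i' hi hi' j, map_mul, map_mul]
  ring

variable {S} in
lemma IsLocalEquation.idealD_eq {z : S.Z} {Φ : S.OZ z} (h : S.IsLocalEquation z Φ) :
    S.idealD z = Ideal.span {Φ} := by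
  refine le_antisymm (Ideal.span_le.mpr fun Φ' h' => ?_)
    ((Ideal.span_singleton_le_iff_mem _).mpr (Ideal.subset_span h))
  obtain ⟨u, -, rfl⟩ := h.associated h'
  exact Ideal.mul_mem_left _ _ (Ideal.mem_span_singleton_self Φ)

/-- A relation `c` between the rows gives the tangent vector `v` with components `c (some l)`, and
it says `v (s_j) = -c none * s_j (p)` for all `j`. By the Leibniz rule `v` kills all quotients `s_j
/ s_i`, so `v = 0` by the injectivity of the differential. Then `c none = 0`, because some `s_a`
does not vanish at `p`. -/
lemma linearIndependent_jetMatrix {p : S.X} {x : Fin n → S.OX p}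
    (hx : IsDifferentialBasis k (S.OX p) x) (s : Fin (m + 1) → S.OX p) (hu : ∃ i, IsUnit (s i))
    (hv : ∀ v : Derivation k (S.OX p) (IsLocalRing.ResidueField (S.OX p)),
      (∀ i j g, IsUnit (s i) → s j = g * s i → v g = 0) → v = 0) (i : Fin (m + 1)) :
    LinearIndependent (IsLocalRing.ResidueField (S.OX p)) fun r =>
      ((jetMatrix hx (affineTuple i s)).map (IsLocalRing.residue (S.OX p))) r := by
  rw [Fintype.linearIndependent_iff]
  intro c hc
  obtain ⟨v, hvx⟩ := hx.exists_derivation fun l => c (some l)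
  have hvs : ∀ f, v f = ∑ l, c (some l) * IsLocalRing.residue _ (hx.dual l f) := fun f => by
    rw [hx.apply_eq v]
    refine Finset.sum_congr rfl fun l _ => ?_
    rw [hvx, Algebra.smul_def, mul_comm]
    rfl
  have h₁ : ∀ j, v (s j) = - (c none * IsLocalRing.residue _ (s j)) := by
    intro j
    have ho : ∀ o, v (affineTuple i s o) = - (c none * IsLocalRing.residue _ (affineTuple i s o)) :=
      fun o => by
        have := congrFun hc o
        rw [Finset.sum_apply, Fintype.sum_option] at this
        simp only [Pi.smul_apply, Matrix.map_apply, smul_eq_mul, Pi.zero_apply] at this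
        rw [hvs]
        exact eq_neg_of_add_eq_zero_right this
    obtain rfl | ⟨j, rfl⟩ := i.eq_self_or_eq_succAbove j
    exacts [ho none, ho (some j)]
  have hv0 : v = 0 := hv v fun a b g ha hg => by
    have h₂ := h₁ b
    rw [hg, Derivation.leibniz, h₁ a, map_mul, Algebra.smul_def, Algebra.smul_def] at h₂
    change IsLocalRing.residue _ g * _ + IsLocalRing.residue _ (s a) * v g = _ at h₂
    have h₃ : IsLocalRing.residue _ (s a) * v g = 0 := by linear_combination h₂
    exact (mul_eq_zero.mp h₃).resolve_left ((ha.map _).ne_zero)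
  obtain ⟨a, ha⟩ := hu
  rintro (_ | l)
  · have := h₁ a
    rw [hv0, Derivation.zero_apply, eq_comm, neg_eq_zero] at this
    exact (mul_eq_zero.mp this).resolve_right ((ha.map _).ne_zero)
  · rw [← hvx, hv0, Derivation.zero_apply]

end LinearSystem

/-! ## Local structure of the critical subscheme -/

namespace LinearSystem

variable {k : Type u} [Field k] {n m : ℕ} (S : LinearSystem k n m)

lemma two_eq_zero_OX [CharP k 2] (p : S.X) : (2 : S.OX p) = 0 := by
  have := congrArg (algebraMap k (S.OX p)) (CharTwo.two_eq_zero (R := k))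
  rwa [map_ofNat, map_zero] at this

lemma two_eq_zero_OZ [CharP k 2] (z : S.Z) : (2 : S.OZ z) = 0 := by
  have := congrArg (algebraMap k (S.OZ z)) (CharTwo.two_eq_zero (R := k))
  rwa [map_ofNat, map_zero] at this

variable {S}

/-- Coordinates at a point over `X°` for which the linear independence of jets holds. -/
lemma exists_coordinates [PerfectField k] {z : S.Z} (hz : S.pr₁ z ∈ S.Xcirc) (i : Fin (m + 1)) :
    ∃ (x : Fin n → S.OX (S.pr₁ z)) (hx : IsDifferentialBasis k (S.OX (S.pr₁ z)) x)
      (s : Fin (m + 1) → S.OX (S.pr₁ z)), S.IsLocalTuple (S.pr₁ z) s ∧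
        LinearIndependent (IsLocalRing.ResidueField (S.OX (S.pr₁ z))) fun r =>
          ((jetMatrix hx (affineTuple i s)).map (IsLocalRing.residue (S.OX (S.pr₁ z)))) r := by
  obtain ⟨x, hx⟩ := S.exists_isDifferentialBasis hz
  obtain ⟨-, s, hs, hu, hv⟩ := hz
  exact ⟨x, hx, s, hs, S.linearIndependent_jetMatrix hx s hu hv i⟩

lemma isLocalEquation_affineForm {z : S.Z} {i : Fin (m + 1)}
    (hi : (MvPolynomial.X i : MvPolynomial (Fin (m + 1)) k) ∉ pointIdeal (S.pr₂ z))
    {s : Fin (m + 1) → S.OX (S.pr₁ z)} (hs : S.IsLocalTuple (S.pr₁ z) s) :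
    S.IsLocalEquation z (affineForm (S.OZ z) (S.coord z i hi) (affineTuple i s)) :=
  ⟨s, hs, i, hi, (S.sum_affineCoord_eq_affineForm z s i hi).symm⟩

section Coordinates

variable {z : S.Z} {i : Fin (m + 1)}
  (hi : (MvPolynomial.X i : MvPolynomial (Fin (m + 1)) k) ∉ pointIdeal (S.pr₂ z))
  {x : Fin n → S.OX (S.pr₁ z)} (hx : IsDifferentialBasis k (S.OX (S.pr₁ z)) x)
include hx

variable (z) in
lemma isDifferentialBasis_OZ : IsDifferentialBasis k (S.OZ z)
    (Sum.elim (algebraMap (S.OX (S.pr₁ z)) (S.OZ z) ∘ x)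
      (algebraMap (S.OP z) (S.OZ z) ∘ S.coord z i hi)) :=
  isDifferentialBasis_sum hx (S.isPolynomialLocalization_OZ z i hi)

variable (z) in
/-- The frame of derivations relative to the parameter space. -/
def frame : Module.Basis (Fin n) (S.OZ z) (Derivation (S.OP z) (S.OZ z) (S.OZ z)) :=
  (isDifferentialBasis_OZ z hi hx).relBasis (S.isDifferentialBasis_coord z i hi)

lemma frame_apply (l : Fin n) (f : S.OZ z) :
    frame z hi hx l f = (isDifferentialBasis_OZ z hi hx).dual (Sum.inl l) f :=
  IsDifferentialBasis.relBasis_apply _ _ _ _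

lemma frame_algebraMap (l : Fin n) (f : S.OX (S.pr₁ z)) :
    frame z hi hx l (algebraMap (S.OX (S.pr₁ z)) (S.OZ z) f) =
      algebraMap (S.OX (S.pr₁ z)) (S.OZ z) (hx.dual l f) := by
  rw [frame_apply, dual_inl_algebraMap hx]

variable {s : Fin (m + 1) → S.OX (S.pr₁ z)}

lemma span_range_jet : Ideal.span (Set.range (jet (S.OZ z) (S.coord z i hi) hx (affineTuple i s))) =
    jacobianIdeal (frame z hi hx) (affineForm (S.OZ z) (S.coord z i hi) (affineTuple i s)) := by
  rw [jacobianIdeal]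
  congr 1
  ext f
  simp only [Set.mem_range, Option.exists, Set.mem_union, Set.mem_singleton_iff, frame_apply,
    jet_some hx (isDifferentialBasis_OZ z hi hx)]
  exact or_congr eq_comm Iff.rfl

variable (hs : S.IsLocalTuple (S.pr₁ z) s)
  (hli : LinearIndependent (IsLocalRing.ResidueField (S.OX (S.pr₁ z))) fun r =>
    ((jetMatrix hx (affineTuple i s)).map (IsLocalRing.residue (S.OX (S.pr₁ z)))) r)
  (hC : S.idealC z ≠ ⊤)
include hi hs hli hC

/-- `𝒞` is cut out by the local equation and its derivatives along the variety; all later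
computations on `𝒞` start from this form. -/
lemma idealC_eq (hn0 : 0 < n) : S.idealC z =
    jacobianIdeal (frame z hi hx) (affineForm (S.OZ z) (S.coord z i hi) (affineTuple i s)) := by
  have : Nonempty (Fin n) := ⟨⟨0, hn0⟩⟩
  rw [← span_range_jet]
  exact comap_criticalIdeal_eq hx (isDifferentialBasis_OZ z hi hx)
    (S.isDifferentialBasis_coord z i hi) hli (isLocalEquation_affineForm hi hs).idealD_eq hC

lemma isDomain_OC (hn0 : 0 < n) : IsDomain (S.OC z) :=
  isDomain_quotient_jet hx (S.isPolynomialLocalization_OZ z i hi) hli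
    ((idealC_eq hi hx hs hli hC hn0).trans (span_range_jet hi hx).symm) hC

/-- One Pfaffian suffices, since those for other frames and equations are associated to it. -/
lemma idealR_eq [CharP k 2] (hn0 : 0 < n) (hn : Even n) : S.idealR z =
    Ideal.span {pfaffian n (hessianMod (S.idealC z) (frame z hi hx)
      (affineForm (S.OZ z) (S.coord z i hi) (affineTuple i s)))} := by
  have heq := isLocalEquation_affineForm hi hs
  refine le_antisymm (Ideal.span_le.mpr ?_) ((Ideal.span_singleton_le_iff_mem _).mpr
    (Ideal.subset_span ⟨frame z hi hx, _, heq, rfl⟩))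
  rintro _ ⟨D, Φ', hΦ', rfl⟩
  obtain ⟨u, hu, rfl⟩ := heq.associated hΦ'
  have hC' := idealC_eq hi hx hs hli hC hn0
  have := associated_pfaffian_hessianMod (S.two_eq_zero_OZ z) hn (frame z hi hx) D hu
    (I := S.idealC z) (hC' ▸ self_mem_jacobianIdeal _ _)
    (hC' ▸ derivation_mem_jacobianIdeal (frame z hi hx) _)
  exact Ideal.mem_span_singleton.mpr this.dvd

/-- `ℰ` is the zero scheme of the determinant of the Hessian, an alternating matrix on `𝒞`, hence of
the square of the Pfaffian. -/
lemma idealE_eq [CharP k 2] (hn0 : 0 < n) (hn : Even n) : S.idealE z =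
    Ideal.span {pfaffian n (hessianMod (S.idealC z) (frame z hi hx)
      (affineForm (S.OZ z) (S.coord z i hi) (affineTuple i s))) ^ 2} := by
  have hC' := idealC_eq hi hx hs hli hC hn0
  have hE : ∀ E : Derivation (S.OP z) (S.OZ z) (S.OZ z),
      E (affineForm (S.OZ z) (S.coord z i hi) (affineTuple i s)) ∈ S.idealC z :=
    hC' ▸ derivation_mem_jacobianIdeal (frame z hi hx) _
  have : Nontrivial (S.OC z) := Ideal.Quotient.nontrivial_iff.mpr hC
  have : CharP (S.OC z) 2 := charP_of_injective_algebraMap (algebraMap k (S.OC z)).injective 2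
  rw [← det_eq_pfaffian_sq hn _ (hessianMod_symm _ hE) (hessianMod_diag (S.two_eq_zero_OZ z) _ hE)]
  have := criticalIdeal_eq_span_det hx (isDifferentialBasis_OZ z hi hx)
    (S.isDifferentialBasis_coord z i hi) hli (hC'.trans (span_range_jet hi hx).symm) hC
  refine this.trans ?_
  rw [← Matrix.det_transpose]
  congr 3
  ext a b
  simp only [hessianMod, Matrix.transpose_apply, Matrix.of_apply, frame_apply]

end Coordinates

/-- The local rings of the critical subscheme over `X°` are Noetherian domains, in which `ℛ` is
defined by one equation, and `ℰ` by its square. -/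
theorem exists_equation [CharP k 2] [PerfectField k] (hn0 : 0 < n) (hn : Even n) {z : S.Z}
    (hz : z ∈ S.Ccirc) : IsNoetherianRing (S.OC z) ∧ IsDomain (S.OC z) ∧
      ∃ g, S.idealR z = Ideal.span {g} ∧ S.idealE z = Ideal.span {g ^ 2} := by
  obtain ⟨i, hi⟩ := exists_X_notMem_pointIdeal (S.pr₂ z)
  obtain ⟨x, hx, s, hs, hli⟩ := exists_coordinates hz.1 i
  have : IsNoetherianRing (S.OZ z) := (S.isPolynomialLocalization_OZ z i hi).isNoetherianRing
  exact ⟨inferInstance, isDomain_OC hi hx hs hli hz.2 hn0, _,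
    idealR_eq hi hx hs hli hz.2 hn0 hn, idealE_eq hi hx hs hli hz.2 hn0 hn⟩

/-- Krull's principal ideal theorem, applied to the single equation of `ℛ`. -/
theorem height_le_one [CharP k 2] [PerfectField k] (hn0 : 0 < n) (hn : Even n) {z : S.Z}
    (hz : z ∈ S.Ccirc) {q : Ideal (S.OC z)} (hq : q ∈ (S.idealR z).minimalPrimes) :
    q.height ≤ 1 := by
  obtain ⟨_, _, g, hR, -⟩ := exists_equation hn0 hn hz
  have : (S.idealR z).IsPrincipal := ⟨g, hR⟩
  exact Ideal.height_le_one_of_isPrincipal_of_mem_minimalPrimes _ q hq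

/-- The local ring is a domain, so only `g = 0` has to be excluded. In that case `z` would lie on
`ℛ` and the zero ideal, of height `0`, would be a minimal prime of the ideal of `ℛ`. -/
theorem exists_nonZeroDivisor [CharP k 2] [PerfectField k] (hn0 : 0 < n) (hn : Even n) {z : S.Z}
    (hz : z ∈ S.Ccirc) (h : z ∈ S.R → ∀ q ∈ (S.idealR z).minimalPrimes, q.height = 1) :
    ∃ g ∈ nonZeroDivisors (S.OC z),
      S.idealR z = Ideal.span {g} ∧ S.idealE z = Ideal.span {g ^ 2} := by
  obtain ⟨_, _, g, hR, hE⟩ := exists_equation hn0 hn hz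
  refine ⟨g, mem_nonZeroDivisors_of_ne_zero ?_, hR, hE⟩
  rintro rfl
  rw [Ideal.span_singleton_eq_bot.mpr rfl] at hR
  have hmin : (⊥ : Ideal (S.OC z)) ∈ (S.idealR z).minimalPrimes := by
    rw [hR]
    change _ ∈ minimalPrimes (S.OC z)
    rw [IsDomain.minimalPrimes_eq_singleton_bot]
    rfl
  have := h ⟨hz, hR ▸ bot_ne_top⟩ ⊥ hmin
  rw [Ideal.height_bot] at this
  exact zero_ne_one this

end LinearSystem

/-! ## Derivations of completions -/

section Completion

open IsLocalRing

/-- Derivations are continuous for the adic topology: they lower the order by at most one. -/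
lemma derivation_pow_mem {S A : Type*} [CommRing S] [CommRing A] [Algebra S A] (I : Ideal A)
    (D : Derivation S A A) (N : ℕ) : ∀ f ∈ I ^ (N + 1), D f ∈ I ^ N := by
  induction N with
  | zero => simp
  | succ N ih =>
    intro f hf
    rw [pow_succ] at hf
    refine Submodule.mul_induction_on hf (fun a ha b hb => ?_) fun a b ha hb => ?_
    · rw [D.leibniz, smul_eq_mul, smul_eq_mul]
      refine add_mem (Ideal.mul_mem_right _ _ ha) ?_
      rw [pow_succ']
      exact Ideal.mul_mem_mul hb (ih a ha)
    · rw [map_add]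
      exact add_mem ha hb

lemma hessianIdeal_map {S A S' A' : Type*} [CommRing S] [CommRing A] [Algebra S A] [CommRing S']
    [CommRing A'] [Algebra S' A'] {n : ℕ} (ι : A →+* A') (D : Fin n → Derivation S A A)
    (D' : Fin n → Derivation S' A' A') (h : ∀ i f, D' i (ι f) = ι (D i f)) (Φ : A) :
    (hessianIdeal D Φ).map ι = hessianIdeal D' (ι Φ) := by
  have hpf : ι (pfaffian n (Matrix.of fun i j => D i (D j Φ))) =
      pfaffian n (Matrix.of fun i j => D' i (D' j (ι Φ))) := by
    rw [map_pfaffian]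
    congr 1
    ext i j
    simp [h]
  rw [hessianIdeal, hessianIdeal, Ideal.map_span, Set.image_union, Set.image_union,
    Set.image_singleton, Set.image_singleton, hpf, ← Set.range_comp]
  simp only [Function.comp_def, h]

section Bases

variable {n : ℕ} {k O A : Type*} [Field k] [CommRing O] [CommRing A] [Algebra k O] [Algebra k A]
  [Algebra O A] [IsScalarTower k O A]

lemma linearIndependent_derivation {D : Fin n → Derivation k A A} {X : Fin n → A}
    (h : ∀ i j, D i (X j) = if j = i then 1 else 0) : LinearIndependent A D := by
  rw [Fintype.linearIndependent_iff]
  intro g hg j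
  have := Derivation.congr_fun hg (X j)
  rw [derivation_sum_apply] at this
  simpa [h] using this

variable [IsLocalRing A] {x : Fin n → O} (hx : IsDifferentialBasis k O x)
  (hdense : ∀ (N : ℕ) (f : A), ∃ g : O, f - algebraMap O A g ∈ maximalIdeal A ^ N)
include hx hdense

/-- `E` vanishes on the image of `O`, which is dense, and is continuous. -/
lemma derivation_eq_zero [IsHausdorff (maximalIdeal A) A] (E : Derivation k A A)
    (hE : ∀ l, E (algebraMap O A (x l)) = 0) : E = 0 := by
  have h₀ : E.compAlgebraMap O = 0 := hx.derivation_ext hE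
  ext f
  refine IsHausdorff.haus (inferInstance : IsHausdorff (maximalIdeal A) A) _ fun N => ?_
  obtain ⟨g, hg⟩ := hdense (N + 1) f
  rw [SModEq.zero, smul_eq_mul, Ideal.mul_top]
  have := derivation_pow_mem _ E N _ hg
  rwa [map_sub, show E (algebraMap O A g) = 0 from Derivation.congr_fun h₀ g, sub_zero] at this

/-- If the determinant were not a unit, some combination `W = ∑ d_i D_i` with a nonzero residue
among the `d_i` would send all `x_l`, hence all of `O`, into the maximal ideal. By density `W (X_j)`
lies there too, but it equals `d_j`. -/
lemma isUnit_det_derivation {D : Fin n → Derivation k A A} {X : Fin n → A}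
    (h : ∀ i j, D i (X j) = if j = i then 1 else 0) :
    IsUnit (Matrix.of fun i l => D i (algebraMap O A (x l))).det := by
  set M : Matrix (Fin n) (Fin n) A := Matrix.of fun i l => D i (algebraMap O A (x l))
  rw [← isUnit_map_iff (residue A), RingHom.map_det, isUnit_iff_ne_zero]
  intro h0
  obtain ⟨c, hc, hcM⟩ := Matrix.exists_vecMul_eq_zero_iff.mpr h0
  choose d hd using fun i => residue_surjective (c i)
  let W : Derivation k A A := ∑ i, d i • D i
  have hW : ∀ f, W f = ∑ i, d i * D i f := derivation_sum_apply d D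
  have hWx : ∀ l, W (algebraMap O A (x l)) ∈ maximalIdeal A := fun l => by
    rw [← residue_eq_zero_iff, hW, map_sum]
    have := congrFun hcM l
    simpa [Matrix.vecMul, dotProduct, M, hd] using this
  have hWO : ∀ g, W (algebraMap O A g) ∈ maximalIdeal A := fun g => by
    have := hx.apply_eq (W.compAlgebraMap O) g
    change W (algebraMap O A g) = ∑ l, hx.dual l g • W (algebraMap O A (x l)) at this
    rw [this]
    refine sum_mem fun l _ => ?_
    rw [Algebra.smul_def]
    exact Ideal.mul_mem_left _ _ (hWx l)
  refine hc (funext fun j => ?_)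
  obtain ⟨g, hg⟩ := hdense 2 (X j)
  have h₁ := derivation_pow_mem _ W 1 _ hg
  rw [pow_one, map_sub] at h₁
  have h₂ := add_mem h₁ (hWO g)
  rw [sub_add_cancel, hW] at h₂
  rw [← hd, Pi.zero_apply, residue_eq_zero_iff]
  simpa [h] using h₂

/-- If derivations dual to some elements exist, they form a basis of all derivations, and the
derivations dual to a differential basis extend to another basis. -/
lemma exists_bases_derivation [IsHausdorff (maximalIdeal A) A] {D : Fin n → Derivation k A A}
    {X : Fin n → A} (h : ∀ i j, D i (X j) = if j = i then 1 else 0) :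
    ∃ b b' : Module.Basis (Fin n) A (Derivation k A A),
      (∀ l f, b l (algebraMap O A f) = algebraMap O A (hx.dual l f)) ∧ ∀ i, b' i = D i := by
  set M : Matrix (Fin n) (Fin n) A := Matrix.of fun i l => D i (algebraMap O A (x l)) with hM
  have hdet := isUnit_det_derivation hx hdense h
  rw [← hM] at hdet
  -- The inverse of the Jacobian matrix turns the `D_i` into derivations dual to the images of the
  -- `x_l`, so that they extend the dual derivations of `O`.
  let E : Fin n → Derivation k A A := fun l => ∑ i, M⁻¹ l i • D i
  have hDO : ∀ i f, D i (algebraMap O A f) = ∑ l, algebraMap O A (hx.dual l f) * M i l :=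
    fun i f => by
      refine (hx.apply_eq ((D i).compAlgebraMap O) f).trans ?_
      exact Finset.sum_congr rfl fun l _ => Algebra.smul_def _ _
  have hEO : ∀ l f, E l (algebraMap O A f) = algebraMap O A (hx.dual l f) := fun l f => by
    change (∑ i, M⁻¹ l i • D i) _ = _
    rw [derivation_sum_apply]
    have hmul := congrFun (Matrix.nonsing_inv_mul M hdet) l
    simp only [hDO, Finset.mul_sum]
    rw [Finset.sum_comm]
    have : ∀ a, ∑ i, M⁻¹ l i * (algebraMap O A (hx.dual a f) * M i a) =
        algebraMap O A (hx.dual a f) * (1 : Matrix (Fin n) (Fin n) A) l a := fun a => by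
      rw [← congrFun hmul a, Matrix.mul_apply, Finset.mul_sum]
      exact Finset.sum_congr rfl fun i _ => by ring
    simp only [this, Matrix.one_apply]
    simp
  have hEx : ∀ l j, E l (algebraMap O A (x j)) = if j = l then 1 else 0 := fun l j => by
    rw [hEO, hx.dual_apply_self]
    split_ifs <;> simp
  -- A derivation is determined by its values at the `x_l`, so it equals the combination of the `E
  -- l` with these coefficients.
  have hspan : ⊤ ≤ Submodule.span A (Set.range E) := fun F _ => by
    have : F = ∑ l, F (algebraMap O A (x l)) • E l := by
      rw [← sub_eq_zero]
      refine derivation_eq_zero hx hdense _ fun j => ?_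
      rw [Derivation.sub_apply, derivation_sum_apply]
      simp [hEx]
    rw [this]
    exact sum_mem fun l _ => Submodule.smul_mem _ _ (Submodule.subset_span ⟨l, rfl⟩)
  have hspan' : ⊤ ≤ Submodule.span A (Set.range D) := hspan.trans (Submodule.span_le.mpr (by
    rintro _ ⟨l, rfl⟩
    exact sum_mem fun i _ => Submodule.smul_mem _ _ (Submodule.subset_span ⟨i, rfl⟩)))
  refine ⟨.mk (linearIndependent_derivation hEx) hspan, .mk (linearIndependent_derivation h) hspan',
    fun l f => ?_, fun i => ?_⟩
  · rw [Module.Basis.mk_apply, hEO]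
  · rw [Module.Basis.mk_apply]

end Bases

section Adic

variable {O : Type*} [CommRing O] [IsLocalRing O] [IsNoetherianRing O]

lemma exists_sub_algebraMap_mem_maximalIdeal_pow (N : ℕ)
    (f : AdicCompletion (maximalIdeal O) O) : ∃ g : O,
      f - algebraMap O (AdicCompletion (maximalIdeal O) O) g ∈
        maximalIdeal (AdicCompletion (maximalIdeal O) O) ^ N := by
  obtain ⟨g, hg⟩ := Submodule.Quotient.mk_surjective _ (f.val N)
  refine ⟨g, ?_⟩
  have fg : (maximalIdeal O).FG := (maximalIdeal O).fg_of_isNoetherianRing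
  rw [AdicCompletion.maximalIdeal_eq_map, ← Ideal.map_pow, ← Submodule.restrictScalars_mem O,
    ← Ideal.smul_top_eq_map, AdicCompletion.pow_smul_top_eq_ker_eval fg, LinearMap.mem_ker,
    map_sub, sub_eq_zero]
  exact hg.symm

/-- The completion of an ideal is its extension to the completed ring. -/
lemma ker_map_mkQ (m I : Ideal O) : LinearMap.ker (AdicCompletion.map m I.mkQ) =
    I.map (algebraMap O (AdicCompletion m O)) := by
  -- Completion is exact on finite modules over a Noetherian ring, and the completion of `I` is
  -- generated by `I` over the completed ring.
  have hex := AdicCompletion.map_exact (I := m) (f := I.subtype) (g := I.mkQ)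
    I.injective_subtype (LinearMap.exact_subtype_mkQ I) I.mkQ_surjective
  refine le_antisymm (fun f hf => ?_) (Ideal.map_le_iff_le_comap.mpr fun f hf => ?_)
  · obtain ⟨w, rfl⟩ := (hex f).mp hf
    obtain ⟨t, rfl⟩ := AdicCompletion.ofTensorProduct_surjective_of_finite m I w
    clear hf
    induction t with
    | zero =>
      rw [map_zero, map_zero]
      exact zero_mem _
    | add t t' ht ht' =>
      rw [map_add, map_add]
      exact add_mem ht ht'
    | tmul r g =>
      rw [AdicCompletion.ofTensorProduct_tmul, map_smul, AdicCompletion.map_of, smul_eq_mul]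
      exact Ideal.mul_mem_left _ _ (Ideal.mem_map_of_mem _ g.2)
  · change AdicCompletion.map m I.mkQ (AdicCompletion.of m O f) = 0
    rw [AdicCompletion.map_of, show I.mkQ f = 0 from (Submodule.Quotient.mk_eq_zero I).mpr hf,
      map_zero]

variable {k : Type*} [Field k] [Algebra k O] {n : ℕ}

/-- The ideal of a hypersurface singularity in formal parameters is the completion of the ideal that
is given by a differential basis. -/
theorem map_singularityIdealR (h2 : (2 : O) = 0) (hn : Even n) {x : Fin n → O}
    (hx : IsDifferentialBasis k O x)
    (e : MvPowerSeries (Fin n) k ≃ₐ[k] AdicCompletion (maximalIdeal O) O)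
    (φ : MvPowerSeries (Fin n) k) (ψ : O)
    (h : Ideal.span {e φ} = Ideal.span {algebraMap O (AdicCompletion (maximalIdeal O) O) ψ}) :
    (hessianIdeal hx.dual ψ).map (algebraMap O (AdicCompletion (maximalIdeal O) O)) =
      (singularityIdealR φ).map (e : _ →+* AdicCompletion (maximalIdeal O) O) := by
  -- The partial derivatives of the power series ring, transported along `e`; they are dual to the
  -- formal parameters.
  let D : Fin n → Derivation k (AdicCompletion (maximalIdeal O) O)
      (AdicCompletion (maximalIdeal O) O) := fun i =>
    Derivation.mk' (e.toLinearMap.comp ((MvPowerSeries.pderiv k i).toLinearMap.comp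
      e.symm.toLinearMap)) fun a b => by simp
  have hD : ∀ i f, D i (e f) = e (MvPowerSeries.pderiv k i f) := fun i f => by
    change e (MvPowerSeries.pderiv k i (e.symm (e f))) = _
    rw [e.symm_apply_apply]
  have hDX : ∀ i j, D i (e (MvPowerSeries.X j)) = if j = i then 1 else 0 := fun i j => by
    rw [hD, MvPowerSeries.pderiv_X, Pi.single_apply]
    split_ifs <;> simp_all
  obtain ⟨b, b', hb, hb'⟩ := exists_bases_derivation hx exists_sub_algebraMap_mem_maximalIdeal_pow hDX
  have : IsDomain (MvPowerSeries (Fin n) k) := NoZeroDivisors.to_isDomain _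
  -- In a domain two generators of the same principal ideal differ by a unit, which the Hessian
  -- ideal does not see.
  have : IsDomain (AdicCompletion (maximalIdeal O) O) := e.symm.toMulEquiv.isDomain _
  obtain ⟨u, hu⟩ := Ideal.span_singleton_eq_span_singleton.mp h
  have h2' : (2 : AdicCompletion (maximalIdeal O) O) = 0 := by
    have := congrArg (algebraMap O (AdicCompletion (maximalIdeal O) O)) h2
    rwa [map_ofNat, map_zero] at this
  rw [hessianIdeal_map _ hx.dual b hb ψ, ← hu, mul_comm, hessianIdeal_eq h2' hn b' b _ u.isUnit]
  change _ = (hessianIdeal (fun i => MvPowerSeries.pderiv k i) φ).map _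
  rw [hessianIdeal_map _ _ b' (fun i f => by rw [hb']; exact hD i f)]
  rfl

end Adic

end Completion

/-! ## Fibers over rational points -/

section Retraction

open IsLocalRing

/-- The evaluation of the coordinates at a point of the local scheme. -/
lemma IsPolynomialLocalization.exists_retraction {O R τ : Type*} [CommRing O] [CommRing R]
    [Algebra O R] [IsLocalRing R] [IsLocalHom (algebraMap O R)] {y : τ → R}
    (h : IsPolynomialLocalization O y) (α : τ → O)
    (hα : ∀ j, y j - algebraMap O R (α j) ∈ maximalIdeal R) :
    ∃ ev : R →ₐ[O] O, (∀ j, ev (y j) = α j) ∧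
      RingHom.ker ev = Ideal.span (Set.range fun j => y j - algebraMap O R (α j)) := by
  obtain ⟨M, hM⟩ := h
  let _ := (MvPolynomial.aeval (R := O) y).toRingHom.toAlgebra
  have : IsScalarTower O (MvPolynomial τ O) R := .of_algebraMap_eq fun a =>
    ((MvPolynomial.aeval (R := O) y).commutes a).symm
  set J := Ideal.span (Set.range fun j => y j - algebraMap O R (α j))
  have hJ : J ≤ maximalIdeal R := Ideal.span_le.mpr (by rintro _ ⟨j, rfl⟩; exact hα j)
  -- Modulo the ideal of the `y_j - α_j`, a polynomial is its value at `α`.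
  have hsub : ∀ f : MvPolynomial τ O, algebraMap (MvPolynomial τ O) R f -
      algebraMap O R (MvPolynomial.aeval α f) ∈ J := fun f => by
    rw [← Ideal.Quotient.eq]
    have : (Ideal.Quotient.mkₐ O J).comp (MvPolynomial.aeval (R := O) y) =
        (Ideal.Quotient.mkₐ O J).comp ((Algebra.ofId O R).comp (MvPolynomial.aeval α)) :=
      MvPolynomial.algHom_ext fun j => by
        simp only [AlgHom.comp_apply, MvPolynomial.aeval_X]
        exact Ideal.Quotient.eq.mpr (Ideal.subset_span ⟨j, rfl⟩)
    exact AlgHom.congr_fun this f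
  -- A denominator with a non-unit value at `α` would lie in the maximal ideal of `R`; so the
  -- evaluation extends to the localization.
  have hunit : ∀ f : M, IsUnit (MvPolynomial.aeval α (f : MvPolynomial τ O) : O) := fun f => by
    rw [← isUnit_map_iff (algebraMap O R)]
    by_contra hn
    have h₁ := add_mem (hJ (hsub f)) ((mem_maximalIdeal _).mpr hn)
    rw [sub_add_cancel] at h₁
    exact (mem_maximalIdeal _).mp h₁ (IsLocalization.map_units R f)
  let ev : R →ₐ[O] O := IsLocalization.liftAlgHom (M := M) (f := MvPolynomial.aeval α) hunit
  have hev : ∀ f, ev (algebraMap (MvPolynomial τ O) R f) = MvPolynomial.aeval α f := fun f => by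
    exact IsLocalization.lift_eq _ f
  have hy : ∀ j, ev (y j) = α j := fun j => by
    have := hev (MvPolynomial.X j)
    rwa [MvPolynomial.aeval_X, show algebraMap (MvPolynomial τ O) R (MvPolynomial.X j) = y j from
      MvPolynomial.aeval_X _ _] at this
  refine ⟨ev, hy, le_antisymm (fun r hr => ?_) (Ideal.span_le.mpr ?_)⟩
  · obtain ⟨⟨f, d⟩, hfd⟩ := IsLocalization.surj M r
    have h₁ := congrArg ev hfd
    rw [map_mul, show ev r = 0 from hr, zero_mul, hev] at h₁
    have h₂ := hsub f
    rw [← h₁, map_zero, sub_zero, ← hfd] at h₂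
    exact (Ideal.mul_unit_mem_iff_mem _ (IsLocalization.map_units R d)).mp h₂
  · rintro _ ⟨j, rfl⟩
    change ev (y j - algebraMap O R (α j)) = 0
    rw [map_sub, hy, AlgHom.commutes]
    exact sub_self _

/-- The evaluation at the rational point maps onto the field `k`, so its kernel is the maximal
ideal. -/
lemma maximalIdeal_eq_span {k R τ : Type*} [Field k] [CommRing R] [Algebra k R] [IsLocalRing R]
    {y : τ → R} (h : IsPolynomialLocalization k y) (α : τ → k)
    (hα : ∀ j, y j - algebraMap k R (α j) ∈ maximalIdeal R) :
    maximalIdeal R = Ideal.span (Set.range fun j => y j - algebraMap k R (α j)) := by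
  obtain ⟨ev, -, hker⟩ := h.exists_retraction α hα
  rw [← hker]
  have : Function.Surjective ev := fun c => ⟨algebraMap k R c, ev.commutes c⟩
  exact (eq_maximalIdeal (RingHom.ker_isMaximal_of_surjective ev this)).symm

end Retraction

section RationalPoint

variable {k : Type u} [Field k] {m : ℕ}

lemma algebraMap_eq_stalkIso_inv (y : projSpace k m) (c : k) :
    algebraMap k ((projSpace k m).presheaf.stalk y) c =
      (Proj.stalkIso (MvPolynomial.homogeneousSubmodule (Fin (m + 1)) k) y).inv.hom
        (HomogeneousLocalization.fromZeroRingHom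
          (MvPolynomial.homogeneousSubmodule (Fin (m + 1)) k) _ (algebraMap k _ c)) := by
  obtain ⟨i, hi⟩ := exists_X_notMem_pointIdeal y
  have h : algebraMap k ((projSpace k m).presheaf.stalk y) c =
      ((projSpace k m).presheaf.germ (chart k i) y hi).hom
        (chartSection k i (chartConstants k i c)) := by
    rw [chartSection_chartConstants]
    exact (TopCat.Presheaf.germ_res_apply (projSpace k m).presheaf (homOfLE le_top) y hi _).symm
  rw [h]
  exact congrArg (fun f => f.hom (chartConstants k i c))
    (ProjectiveSpectrum.Proj.awayToSection_germ
      (MvPolynomial.homogeneousSubmodule (Fin (m + 1)) k) (MvPolynomial.X i) y hi)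

/-- If `a i = 0` and `a j ≠ 0`, the form `a_i Y_j - a_j Y_i` in the prime ideal is a nonzero
multiple of `Y_i`. -/
lemma HasCoordinates.ne_zero {y : projSpace k m} {a : Fin (m + 1) → k} (h : HasCoordinates y a)
    (ha : a ≠ 0) {i : Fin (m + 1)}
    (hi : (MvPolynomial.X i : MvPolynomial (Fin (m + 1)) k) ∉ pointIdeal y) : a i ≠ 0 := by
  intro h0
  obtain ⟨j, hj⟩ := Function.ne_iff.mp ha
  have := h i j
  rw [h0, map_zero, zero_mul, zero_sub, ← neg_mul, ← map_neg] at this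
  refine hi ?_
  have h₂ := (pointIdeal y).toIdeal.mul_mem_left (MvPolynomial.C (-a j)⁻¹) this
  rwa [← mul_assoc, ← map_mul, inv_mul_cancel₀ (neg_ne_zero.mpr hj), map_one, one_mul] at h₂

/-- The maximal ideal at a rational point contains the differences of the coordinates. -/
lemma HasCoordinates.affineCoord_sub_mem {y : projSpace k m} {a : Fin (m + 1) → k}
    (h : HasCoordinates y a) (ha : a ≠ 0) {i : Fin (m + 1)}
    (hi : (MvPolynomial.X i : MvPolynomial (Fin (m + 1)) k) ∉ pointIdeal y) (j : Fin (m + 1)) :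
    affineCoord y i hi j - algebraMap k ((projSpace k m).presheaf.stalk y) (a j / a i) ∈
      IsLocalRing.maximalIdeal ((projSpace k m).presheaf.stalk y) := by
  rw [algebraMap_eq_stalkIso_inv, affineCoord, IsLocalRing.mem_maximalIdeal, mem_nonunits_iff]
  intro hu
  have : (pointIdeal y).toIdeal.IsPrime := ProjectiveSpectrum.isPrime
    (show ProjectiveSpectrum (MvPolynomial.homogeneousSubmodule (Fin (m + 1)) k) from y)
  let F := (Proj.stalkIso (MvPolynomial.homogeneousSubmodule (Fin (m + 1)) k) y).symm
    |>.commRingCatIsoToRingEquiv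
  set A : HomogeneousLocalization.AtPrime (MvPolynomial.homogeneousSubmodule (Fin (m + 1)) k)
      (pointIdeal y).toIdeal := HomogeneousLocalization.mk
      { deg := 1
        num := ⟨MvPolynomial.X j, MvPolynomial.isHomogeneous_X k j⟩
        den := ⟨MvPolynomial.X i, MvPolynomial.isHomogeneous_X k i⟩
        den_mem := hi }
  set B : HomogeneousLocalization.AtPrime (MvPolynomial.homogeneousSubmodule (Fin (m + 1)) k)
      (pointIdeal y).toIdeal := HomogeneousLocalization.fromZeroRingHom
          (MvPolynomial.homogeneousSubmodule (Fin (m + 1)) k) _ (algebraMap k _ (a j / a i))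
  have hu₁ : IsUnit (F (A - B)) := (congrArg IsUnit (RingHom.map_sub F.toRingHom A B)).mpr hu
  have hu₂ : IsUnit (A - B).val := (HomogeneousLocalization.isUnit_iff_isUnit_val _ _ _).mpr
    ((MulEquiv.isUnit_map F).mp hu₁)
  have hi' := IsLocalization.map_units (Localization.AtPrime (pointIdeal y).toIdeal)
    (⟨MvPolynomial.X i, hi⟩ : (pointIdeal y).toIdeal.primeCompl)
  -- Clearing the denominator `Y_i` turns the difference into `(a_i Y_j - a_j Y_i) / a_i`, which
  -- belongs to the prime ideal of the point.
  have hmul : (A - B).val * algebraMap (MvPolynomial (Fin (m + 1)) k)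
      (Localization.AtPrime (pointIdeal y).toIdeal) (MvPolynomial.X i) =
      algebraMap (MvPolynomial (Fin (m + 1)) k) (Localization.AtPrime (pointIdeal y).toIdeal)
        (MvPolynomial.X j - MvPolynomial.C (a j / a i) * MvPolynomial.X i) := by
    rw [HomogeneousLocalization.val_sub, sub_mul, map_sub, map_mul]
    congr 1
    · rw [HomogeneousLocalization.val_mk, Localization.mk_eq_mk']
      exact IsLocalization.mk'_spec _ _ _
  have hu₃ := hu₂.mul hi'
  rw [hmul, IsLocalization.AtPrime.isUnit_to_map_iff _ (pointIdeal y).toIdeal] at hu₃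
  refine hu₃ ?_
  have h₂ := (pointIdeal y).toIdeal.mul_mem_left (MvPolynomial.C (a i)⁻¹) (h i j)
  rwa [mul_sub, ← mul_assoc, ← mul_assoc, ← map_mul, ← map_mul,
    inv_mul_cancel₀ (h.ne_zero ha hi), map_one, one_mul, inv_mul_eq_div] at h₂

end RationalPoint

namespace LinearSystem

open IsLocalRing

variable {k : Type u} [Field k] {n m : ℕ} {S : LinearSystem k n m} {z : S.Z}

section Evaluation

variable {i : Fin (m + 1)}
  (hi : (MvPolynomial.X i : MvPolynomial (Fin (m + 1)) k) ∉ pointIdeal (S.pr₂ z))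
  {a : Fin (m + 1) → k}

/-- The restriction of functions to the fiber of the second projection over a rational point. -/
lemma exists_evaluation (ha : a ≠ 0) (h : HasCoordinates (S.pr₂ z) a) :
    ∃ ev : S.OZ z →ₐ[S.OX (S.pr₁ z)] S.OX (S.pr₁ z),
      (∀ j, ev (algebraMap (S.OP z) (S.OZ z) (S.coord z i hi j)) =
        algebraMap k (S.OX (S.pr₁ z)) (a (i.succAbove j) / a i)) ∧
      RingHom.ker ev = (maximalIdeal (S.OP z)).map (algebraMap (S.OP z) (S.OZ z)) := by
  have hmem : ∀ j, S.coord z i hi j - algebraMap k (S.OP z) (a (i.succAbove j) / a i) ∈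
      maximalIdeal (S.OP z) := fun j => h.affineCoord_sub_mem ha hi _
  have hmap : ∀ j, algebraMap (S.OP z) (S.OZ z)
      (S.coord z i hi j - algebraMap k (S.OP z) (a (i.succAbove j) / a i)) =
      algebraMap (S.OP z) (S.OZ z) (S.coord z i hi j) -
        algebraMap (S.OX (S.pr₁ z)) (S.OZ z)
          (algebraMap k (S.OX (S.pr₁ z)) (a (i.succAbove j) / a i)) := fun j => by
    rw [map_sub, ← IsScalarTower.algebraMap_apply, ← IsScalarTower.algebraMap_apply]
  obtain ⟨ev, hev, hker⟩ := (S.isPolynomialLocalization_OZ z i hi).exists_retraction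
    (fun j => algebraMap k (S.OX (S.pr₁ z)) (a (i.succAbove j) / a i)) fun j => by
      change algebraMap (S.OP z) (S.OZ z) (S.coord z i hi j) - _ ∈ _
      rw [← hmap, mem_maximalIdeal, mem_nonunits_iff, isUnit_map_iff]
      exact hmem j
  refine ⟨ev, hev, hker.trans ?_⟩
  rw [maximalIdeal_eq_span (isPolynomialLocalization_projSpace k i hi)
    (fun j => a (i.succAbove j) / a i) hmem, Ideal.map_span, ← Set.range_comp]
  congr 2
  funext j
  exact (hmap j).symm

variable {x : Fin n → S.OX (S.pr₁ z)} (hx : IsDifferentialBasis k (S.OX (S.pr₁ z)) x)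
  {ev : S.OZ z →ₐ[S.OX (S.pr₁ z)] S.OX (S.pr₁ z)}
  (hev : ∀ j, ev (algebraMap (S.OP z) (S.OZ z) (S.coord z i hi j)) =
    algebraMap k (S.OX (S.pr₁ z)) (a (i.succAbove j) / a i))
include hev

/-- Differentiation along the variety commutes with restriction to the fiber. Both sides are
derivations of `OZ` with values in `OX`, a module through `ev`; they agree on the `x_l`, and both
kill the affine coordinates, whose values under `ev` are constants. -/
lemma dual_evaluation (l : Fin n) (f : S.OZ z) : hx.dual l (ev f) = ev (frame z hi hx l f) := by
  let _ : Module (S.OZ z) (S.OX (S.pr₁ z)) := Module.compHom _ (ev : S.OZ z →+* S.OX (S.pr₁ z))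
  have hsmul : ∀ (r : S.OZ z) (g : S.OX (S.pr₁ z)), r • g = ev r * g := fun _ _ => rfl
  have hk : ∀ c : k, ev (algebraMap k (S.OZ z) c) = algebraMap k (S.OX (S.pr₁ z)) c :=
    (ev.restrictScalars k).commutes
  have : IsScalarTower k (S.OZ z) (S.OX (S.pr₁ z)) := ⟨fun c r g => by
    rw [hsmul, hsmul, Algebra.smul_def, map_mul, hk, Algebra.smul_def, mul_assoc]⟩
  let v : Derivation k (S.OZ z) (S.OX (S.pr₁ z)) :=
    Derivation.mk' ((hx.dual l).toLinearMap.comp (ev.restrictScalars k).toLinearMap) fun r r' => by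
      change hx.dual l (ev (r * r')) = ev r * hx.dual l (ev r') + ev r' * hx.dual l (ev r)
      rw [map_mul, Derivation.leibniz, smul_eq_mul, smul_eq_mul]
  let w : Derivation k (S.OZ z) (S.OX (S.pr₁ z)) :=
    Derivation.mk' ((ev.restrictScalars k).toLinearMap.comp
      ((frame z hi hx l).toLinearMap.restrictScalars k)) fun r r' => by
      change ev (frame z hi hx l (r * r')) =
        ev r * ev (frame z hi hx l r') + ev r' * ev (frame z hi hx l r)
      rw [Derivation.leibniz, smul_eq_mul, smul_eq_mul, map_add, map_mul, map_mul]
  refine Derivation.congr_fun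
    (show v = w from (isDifferentialBasis_OZ z hi hx).derivation_ext fun o => ?_) f
  rcases o with j | j
  · change hx.dual l (ev (algebraMap (S.OX (S.pr₁ z)) (S.OZ z) (x j))) =
      ev (frame z hi hx l (algebraMap (S.OX (S.pr₁ z)) (S.OZ z) (x j)))
    rw [frame_algebraMap, ev.commutes, ev.commutes]
    rfl
  · change hx.dual l (ev (algebraMap (S.OP z) (S.OZ z) (S.coord z i hi j))) =
      ev (frame z hi hx l (algebraMap (S.OP z) (S.OZ z) (S.coord z i hi j)))
    rw [hev, Derivation.map_algebraMap, Derivation.map_algebraMap, map_zero]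

variable {s : Fin (m + 1) → S.OX (S.pr₁ z)} (hs : S.IsLocalTuple (S.pr₁ z) s)
  (hli : LinearIndependent (ResidueField (S.OX (S.pr₁ z))) fun r =>
    ((jetMatrix hx (affineTuple i s)).map (residue (S.OX (S.pr₁ z)))) r)
  (hC : S.idealC z ≠ ⊤)
  (hker : RingHom.ker ev = (maximalIdeal (S.OP z)).map (algebraMap (S.OP z) (S.OZ z)))
include hs hli hC hker

/-- In `OZ` the fiber of `ℛ` is defined by the Hessian ideal of `Φ` and the kernel of `ev`, that is,
by the preimage under `ev` of the Hessian ideal of `ev Φ`. Since `ev` is a retraction of `OX → OZ`,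
pulling this back to `OX` gives the ideal itself. -/
lemma fiberIdeal_eq [CharP k 2] (hn0 : 0 < n) (hn : Even n) : S.fiberIdeal z =
    hessianIdeal hx.dual (ev (affineForm (S.OZ z) (S.coord z i hi) (affineTuple i s))) := by
  set Φ := affineForm (S.OZ z) (S.coord z i hi) (affineTuple i s)
  have hcomap : (S.idealR z ⊔ (maximalIdeal (S.OP z)).map (algebraMap (S.OP z) (S.OC z))).comap
      (Ideal.Quotient.mk (S.idealC z)) = hessianIdeal (frame z hi hx) Φ ⊔ RingHom.ker ev := by
    rw [hessianIdeal_eq_comap _ _ (idealC_eq hi hx hs hli hC hn0).symm,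
      ← idealR_eq hi hx hs hli hC hn0 hn, hker,
      IsScalarTower.algebraMap_eq (S.OP z) (S.OZ z) (S.OC z), ← Ideal.map_map]
    have hsurj : Function.Surjective (Ideal.Quotient.mk (S.idealC z)) :=
      Ideal.Quotient.mk_surjective
    conv_lhs => rw [← Ideal.map_comap_of_surjective _ hsurj (S.idealR z)]
    change Ideal.comap _ (_ ⊔ Ideal.map (Ideal.Quotient.mk (S.idealC z)) _) = _
    rw [← Ideal.map_sup, Ideal.comap_map_of_surjective _ hsurj, sup_eq_left]
    exact (Ideal.comap_mono bot_le).trans le_sup_left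
  have hev₁ : Function.Surjective ev := fun f => ⟨algebraMap _ _ f, ev.commutes f⟩
  have hmap : hessianIdeal (frame z hi hx) Φ ⊔ RingHom.ker ev =
      (hessianIdeal hx.dual (ev Φ)).comap ev := by
    rw [← RingHom.coe_coe ev, ← hessianIdeal_map (ev : S.OZ z →+* S.OX (S.pr₁ z)) (frame z hi hx)
      hx.dual (dual_evaluation hi hx hev) Φ]
    exact (Ideal.comap_map_of_surjective (ev : S.OZ z →+* S.OX (S.pr₁ z)) hev₁ _).symm
  rw [fiberIdeal, ← Ideal.comap_comap, hcomap, hmap]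
  ext f
  change ev (algebraMap (S.OX (S.pr₁ z)) (S.OZ z) f) ∈
    hessianIdeal hx.dual (ev Φ) ↔ _
  rw [ev.commutes]
  rfl

end Evaluation

lemma divisorIdeal_eq (a : Fin (m + 1) → k) {p : S.X} {s : Fin (m + 1) → S.OX p}
    (hs : S.IsLocalTuple p s) :
    S.divisorIdeal a p = Ideal.span {∑ j, algebraMap k (S.OX p) (a j) * s j} := by
  refine le_antisymm (Ideal.span_le.mpr ?_) ((Ideal.span_singleton_le_iff_mem _).mpr
    (Ideal.subset_span ⟨s, hs, rfl⟩))
  rintro _ ⟨s', hs', rfl⟩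
  obtain ⟨u, -, hu⟩ := hs.exists_eq_mul hs'
  refine Ideal.mem_span_singleton.mpr ⟨u, ?_⟩
  rw [Finset.sum_mul]
  exact Finset.sum_congr rfl fun j _ => by rw [hu]; ring

/-- The universal equation restricts on the fiber over `[f]` to the equation of `D_[f]`, up to the
nonzero constant `a i` by which the coordinates were normalized. -/
lemma sum_eq_evaluation {i : Fin (m + 1)}
    (hi : (MvPolynomial.X i : MvPolynomial (Fin (m + 1)) k) ∉ pointIdeal (S.pr₂ z))
    {a : Fin (m + 1) → k} (hai : a i ≠ 0) {ev : S.OZ z →ₐ[S.OX (S.pr₁ z)] S.OX (S.pr₁ z)}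
    (hev : ∀ j, ev (algebraMap (S.OP z) (S.OZ z) (S.coord z i hi j)) =
      algebraMap k (S.OX (S.pr₁ z)) (a (i.succAbove j) / a i))
    (s : Fin (m + 1) → S.OX (S.pr₁ z)) :
    ∑ j, algebraMap k (S.OX (S.pr₁ z)) (a j) * s j =
      ev (affineForm (S.OZ z) (S.coord z i hi) (affineTuple i s)) *
        algebraMap k (S.OX (S.pr₁ z)) (a i) := by
  rw [affineForm, map_add, map_sum, Fin.sum_univ_succAbove _ i, add_mul, Finset.sum_mul,
    ev.commutes]
  congr 1
  · exact mul_comm _ _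
  · refine Finset.sum_congr rfl fun j _ => ?_
    rw [map_mul, hev, ev.commutes, mul_assoc, ← map_mul, div_mul_cancel₀ _ hai]
    exact mul_comm _ _

/-- The completed fibers of `ℛ` over the parameter space are given by the hypersurface
singularities. -/
theorem completedFiberIdeal_eq [CharP k 2] [PerfectField k] (hn0 : 0 < n) (hn : Even n)
    (hz : z ∈ S.Ccirc) {a : Fin (m + 1) → k} (ha : a ≠ 0) (h : HasCoordinates (S.pr₂ z) a)
    (e : MvPowerSeries (Fin n) k ≃ₐ[k] S.completion (S.pr₁ z)) (φ : MvPowerSeries (Fin n) k)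
    (hφ : Ideal.span {e φ} =
      (S.divisorIdeal a (S.pr₁ z)).map (algebraMap _ (S.completion (S.pr₁ z)))) :
    S.completedFiberIdeal z =
      (singularityIdealR φ).map (e : _ →+* S.completion (S.pr₁ z)) := by
  obtain ⟨i, hi⟩ := exists_X_notMem_pointIdeal (S.pr₂ z)
  obtain ⟨x, hx, s, hs, hli⟩ := exists_coordinates hz.1 i
  obtain ⟨ev, hev, hker⟩ := exists_evaluation hi ha h
  have hai := h.ne_zero ha hi
  refine (ker_map_mkQ _ _).trans ?_
  rw [fiberIdeal_eq hi hx hev hs hli hz.2 hker hn0 hn]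
  refine map_singularityIdealR (S.two_eq_zero_OX _) hn hx e φ _ ?_
  rw [hφ, divisorIdeal_eq a hs, sum_eq_evaluation hi hai hev,
    Ideal.span_singleton_mul_right_unit ((IsUnit.mk0 _ hai).map _), Ideal.map_span,
    Set.image_singleton]

end LinearSystem

end PfaffianDegeneracy

end

/-- All assertions are read in the local rings: the irreducible components of `ℛ` through `z` are
the minimal primes of its ideal in the local ring of `𝒞°` at `z`, and their codimensions are the
heights. -/
theorem proposition5p0 {k : Type*} [Field k] [IsAlgClosed k] [CharP k 2] {n m : ℕ}
    (hn0 : 0 < n) (hn : Even n) (hnm : n < m)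
    (S : PfaffianDegeneracy.LinearSystem k n m) (hS : Dense S.Xcirc) :
    -- every irreducible component of `ℛ` is of codimension at most `1` in `𝒞°`
    (∀ z ∈ S.R, ∀ q ∈ (S.idealR z).minimalPrimes, q.height ≤ 1) ∧
    -- if all of them are of codimension `1`, then `ℛ` is a divisor of `𝒞°` and `ℰ = 2 ℛ`
    ((∀ z ∈ S.R, ∀ q ∈ (S.idealR z).minimalPrimes, q.height = 1) →
      ∀ z ∈ S.Ccirc, ∃ g ∈ nonZeroDivisors (S.OC z),
        S.idealR z = Ideal.span {g} ∧ S.idealE z = Ideal.span {g ^ 2}) ∧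
    -- at a (closed) point `z = (p, [f])` of `ℛ`, with `f = ∑ a_j b_j`, for every formal parameter
    -- system `x` of `X` at `p` and every equation `φ` of `D_[f]` in these parameters, the completed
    -- fiber of `ϖ₂` is `R(D_[f], p)`
    (∀ z ∈ S.R, IsClosed ({z} : Set S.Z) →
      ∀ a : Fin (m + 1) → k, a ≠ 0 → PfaffianDegeneracy.HasCoordinates (S.pr₂ z) a →
      ∀ (x : MvPowerSeries (Fin n) k ≃ₐ[k] S.completion (S.pr₁ z)) (φ : MvPowerSeries (Fin n) k),
        Ideal.span {x φ} =
          (S.divisorIdeal a (S.pr₁ z)).map (algebraMap _ (S.completion (S.pr₁ z))) →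
        S.completedFiberIdeal z =
          (PfaffianDegeneracy.singularityIdealR φ).map (x : _ →+* S.completion (S.pr₁ z))) :=
  ⟨fun _ hz _ hq => PfaffianDegeneracy.LinearSystem.height_le_one hn0 hn hz.1 hq,
    fun h z hz => PfaffianDegeneracy.LinearSystem.exists_nonZeroDivisor hn0 hn hz (h z),
    fun _ hz _ _ ha hc x φ hφ =>
      PfaffianDegeneracy.LinearSystem.completedFiberIdeal_eq hn0 hn hz.1 ha hc x φ hφ⟩
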